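/- Let $\mathcal K$ be a complex Hilbert space of finite or infinite dimension. A state on $\mathcal K$ is a positive trace class operator of trace one. For states $\rho,\sigma$ let $\Pi_\rho,\Pi_\sigma$ be the orthogonal projections onto their supports and $\Pi^\perp=I-\Pi$. On the Hilbert space $\mathcal B_2(\mathcal K)$ of Hilbert–Schmidt operators let $S$ be the antilinear operator $S(X\sqrt\sigma+Y\Pi_\sigma^\perp)=\Pi_\sigma X^\dagger\sqrt\rho$ ($X$ bounded, $Y$ Hilbert–Schmidt), let $\Delta_{\rho,\sigma}=S^\dagger\overline S$ be the relative modular operator, and let $\xi$ be its spectral measure. For a convex or concave $f:(0,\infty)\to\mathbb R$ put $f(0)=\lim_{t\downarrow0}f(t)$, $f'(\infty)=\lim_{t\to\infty}f(t)/t$ and $$D_f(\rho\|\sigma)=\int_{(0,\infty)}f(\lambda)\,\langle\sqrt\sigma,\xi(d\lambda)\sqrt\sigma\rangle_2+f(0)\operatorname{tr}(\sigma\Pi_\rho^\perp)+f'(\infty)\operatorname{tr}(\rho\Pi_\sigma^\perp)\in[-\infty,\infty],\qquad 0\cdot(\pm\infty)=0.$$ Write $D$ for $f(t)=t\log t$;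 $V$ for $f(t)=|t-1|$; $\chi^2$ for $f(t)=(t-1)^2$; $\mathscr H^2$ for $f(t)=\frac12(\sqrt t-1)^2$, with $\mathscr H=\sqrt{\mathscr H^2}$ and $\mathscr H^4=(\mathscr H^2)^2$; $\mathscr H_\alpha$ for $f(t)=\frac{t^\alpha-1}{\alpha-1}$; and $D_\alpha=\frac1{\alpha-1}\log D_{t^\alpha}$, where $\log 0=-\infty$ and $\log\infty=\infty$ ($\alpha>0$, $\alpha\ne1$). Logarithms are natural except in (2) and in the first line of (7), where any base $b>1$ may be used, the same one in $D$ and on the other side. Conventions: $a/0=\infty$ for $a>0$, $\log\infty=\infty$, $0/0=0$, $\infty/\infty=0$ and $a/\infty=0$ for finite $a$. Then for all states $\rho,\sigma$ on $\mathcal K$, with $V=V(\rho\|\sigma)$, one has $0\le V\le2$, $0\le\mathscr H^2(\rho\|\sigma)\le1$, and 1. $\mathscr H^2(\rho\|\sigma)\le\frac12V\le\mathscr H(\rho\|\sigma)\sqrt{2-\mathscr H^2(\rho\|\sigma)}$; 2. $D(\rho\|\sigma)\le\log(1+\chi^2(\rho\|\sigma))$; 3. $\chi^2(\rho\|\sigma)\le(1+(\alpha-1)\mathscr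 H_\alpha(\rho\|\sigma))^{1/(\alpha-1)}-1$ for all $\alpha>2$; 4. $\chi^2(\rho\|\sigma)\ge V^2$ if $V\in[0,1]$, and $\chi^2(\rho\|\sigma)\ge\frac V{2-V}$ if $V\in(1,2]$; 5. $\frac{D(\rho\|\sigma)^2}{D(\sigma\|\rho)}\le\frac12\chi^2(\rho\|\sigma)$; $\;16\mathscr H^4(\rho\|\sigma)\le D(\rho\|\sigma)D(\sigma\|\rho)\le\frac14\chi^2(\rho\|\sigma)\chi^2(\sigma\|\rho)$; $\;8\mathscr H^2(\rho\|\sigma)\le D(\rho\|\sigma)+D(\sigma\|\rho)\le\frac12(\chi^2(\rho\|\sigma)+\chi^2(\sigma\|\rho))$; 6. $D(\rho\|\sigma)\le\frac12(V+\chi^2(\rho\|\sigma))$; 7. $D(\rho\|\sigma)+D(\sigma\|\rho)\ge V\log\frac{2+V}{2-V}$ and $\chi^2(\rho\|\sigma)+\chi^2(\sigma\|\rho)\ge\frac{8V^2}{4-V^2}$; 8. $\mathscr H_\alpha(\rho\|\sigma)\le D_\alpha(\rho\|\sigma)\le D(\rho\|\sigma)\le D_\beta(\rho\|\sigma)\le\mathscr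 H_\beta(\rho\|\sigma)$ for $0<\alpha<1<\beta<\infty$. 9. Moreover, let $f:(0,\infty)\to[0,\infty)$ be strictly convex with $f(1)=0$. Then there is a real-valued function $\psi_f$, depending only on $f$, with $\lim_{x\downarrow0}\psi_f(x)=0$ and $V(\rho\|\sigma)\le\psi_f(D_f(\rho\|\sigma))$ for all states $\rho,\sigma$ on every $\mathcal K$; and for all sequences of states $\rho_n,\sigma_n$ on $\mathcal K$, $D_f(\rho_n\|\sigma_n)\to0$ implies $V(\rho_n\|\sigma_n)\to0$. -/

import Mathlib

open Set Filter Topology MeasureTheory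
open scoped ENNReal InnerProductSpace

universe u

noncomputable section

namespace QuantumDiv

/-! ### Hilbert-Schmidt operators -/

section HilbertSchmidt

variable (K : Type u) [NormedAddCommGroup K] [InnerProductSpace ℂ K] [CompleteSpace K]

/-- The index set of a fixed orthonormal (Hilbert) basis of `K`. -/
def basisSet : Set K := (exists_hilbertBasis ℂ K).choose

/-- A fixed orthonormal basis of `K`, used to write traces. -/
def basis : HilbertBasis (basisSet K) ℂ K := (exists_hilbertBasis ℂ K).choose_spec.choose

variable {K} in
/-- `T` is Hilbert-Schmidt: `∑ i, ‖T bᵢ‖² = tr (T† T) < ∞`. -/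
def IsHS (T : K →L[ℂ] K) : Prop := Memℓp (fun i => T (basis K i)) 2

/-- The space of Hilbert-Schmidt operators on `K`, as a subspace of the bounded operators. -/
def hsSubmodule : Submodule ℂ (K →L[ℂ] K) where
  carrier := {T | IsHS T}
  zero_mem' := zero_memℓp (E := fun _ : basisSet K => K) (p := 2)
  add_mem' := fun {S T} hS hT => Memℓp.add hS hT
  smul_mem' := fun c T hT => Memℓp.const_smul hT c

/-- The Hilbert space `B₂(K)` of Hilbert-Schmidt operators (a type of its own, so that it carries
the Hilbert-Schmidt norm and not the operator norm). -/
def HS : Type u := hsSubmodule K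

instance : AddCommGroup (HS K) := inferInstanceAs (AddCommGroup (hsSubmodule K))

instance : Module ℂ (HS K) := inferInstanceAs (Module ℂ (hsSubmodule K))

variable {K}

/-- The bounded operator underlying a Hilbert-Schmidt operator. -/
def HS.op (T : HS K) : K →L[ℂ] K := Subtype.val T

variable (K) in
/-- The linear embedding `T ↦ (T bᵢ)ᵢ` of `B₂(K)` in the `K`-valued `ℓ²` space. -/
def HS.toL2 : HS K →ₗ[ℂ] lp (fun _ : basisSet K => K) 2 where
  toFun T := ⟨fun i => T.op (basis K i), T.2⟩
  map_add' _ _ := rfl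
  map_smul' _ _ := rfl

theorem HS.toL2_injective : Function.Injective (HS.toL2 K) := by
  intro S T h
  apply Subtype.ext
  refine ContinuousLinearMap.ext_on (s := Set.range (basis K)) ?_ ?_
  · have := (basis K).dense_span
    rw [← Submodule.dense_iff_topologicalClosure_eq_top] at this
    exact this
  · rintro _ ⟨i, rfl⟩
    exact congrFun (congrArg Subtype.val h) i

/-- The Hilbert-Schmidt inner product `⟨S, T⟩₂ = ∑ i, ⟨S bᵢ, T bᵢ⟩ = tr (S† T)`. -/
@[reducible] def HS.core : InnerProductSpace.Core ℂ (HS K) where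
  inner S T := ⟪HS.toL2 K S, HS.toL2 K T⟫_ℂ
  conj_inner_symm S T := inner_conj_symm _ _
  re_inner_nonneg S := inner_self_nonneg
  add_left S T R := by rw [map_add, inner_add_left]
  smul_left S T c := by rw [map_smul, inner_smul_left]
  definite S h := HS.toL2_injective (by simpa using inner_self_eq_zero.1 h)

instance : NormedAddCommGroup (HS K) :=
  letI := HS.core (K := K)
  InnerProductSpace.Core.toNormedAddCommGroup (𝕜 := ℂ)

instance : InnerProductSpace ℂ (HS K) := InnerProductSpace.ofCore (HS.core (K := K)).toCore

/-- The inner product of `B₂(K)` is `∑ i, ⟨S bᵢ, T bᵢ⟩`. -/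
theorem HS.inner_eq (S T : HS K) :
    ⟪S, T⟫_ℂ = ∑' i, ⟪S.op (basis K i), T.op (basis K i)⟫_ℂ :=
  lp.inner_eq_tsum (HS.toL2 K S) (HS.toL2 K T)

end HilbertSchmidt

/-! ### Spectral measures -/

section Spectral

variable (H : Type u) [NormedAddCommGroup H] [InnerProductSpace ℂ H]

/-- A projection-valued measure on the Borel sets of `ℝ`. -/
structure PVM where
  /-- The projection attached to a Borel set. -/
  proj : Set ℝ → (H →L[ℂ] H)
  isProj : ∀ B, MeasurableSet B → (proj B : H →ₗ[ℂ] H).IsSymmetricProjection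
  empty : proj ∅ = 0
  univ : proj Set.univ = 1
  iUnion : ∀ B : ℕ → Set ℝ, (∀ n, MeasurableSet (B n)) → Pairwise (Function.onFun Disjoint B) →
    ∀ x, HasSum (fun n => proj (B n) x) (proj (⋃ n, B n) x)

variable {H}

theorem PVM.re_nonneg (E : PVM H) (x : H) {B : Set ℝ} (hB : MeasurableSet B) :
    0 ≤ (⟪x, E.proj B x⟫_ℂ).re := by
  have h := E.isProj B hB
  have h1 : E.proj B (E.proj B x) = E.proj B x := by
    simpa using LinearMap.congr_fun h.isIdempotentElem x
  have h2 : ⟪E.proj B x, E.proj B x⟫_ℂ = ⟪x, E.proj B (E.proj B x)⟫_ℂ :=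
    h.isSymmetric x (E.proj B x)
  rw [h1] at h2
  rw [← h2]
  exact inner_self_nonneg (𝕜 := ℂ)

/-- The scalar measure `B ↦ ⟨x, E(B) x⟩`. -/
def PVM.measure (E : PVM H) (x : H) : Measure ℝ :=
  Measure.ofMeasurable (fun B _ => ENNReal.ofReal (⟪x, E.proj B x⟫_ℂ).re)
    (by simp [E.empty])
    (by
      intro B hB hd
      have h := (E.iUnion B hB hd x).mapL (innerSL ℂ x)
      have h' := Complex.hasSum_re h
      simp only [innerSL_apply_apply] at h'
      rw [← h'.tsum_eq, ENNReal.ofReal_tsum_of_nonneg (fun n => E.re_nonneg x (hB n)) h'.summable])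

/-- `E` is the spectral measure of the (possibly unbounded) operator with graph `G`, that is
`A = ∫ t dE(t)`: the domain of `A` is `{x | ∫ t² d⟨x, E(t) x⟩ < ∞}`, and for `x` in the domain
`⟨x, A x⟩ = ∫ t d⟨x, E(t) x⟩` and `‖A x‖² = ∫ t² d⟨x, E(t) x⟩`. -/
def PVM.Represents (E : PVM H) (G : Set (H × H)) : Prop :=
  (∀ x, (∃ y, (x, y) ∈ G) ↔ ∫⁻ t, ENNReal.ofReal (t ^ 2) ∂(E.measure x) < ∞) ∧
  ∀ x y, (x, y) ∈ G →
    ⟪x, y⟫_ℂ = ((∫ t, t ∂(E.measure x) : ℝ) : ℂ) ∧ ‖y‖ ^ 2 = ∫ t, t ^ 2 ∂(E.measure x)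

open Classical in
/-- The spectral measure of zero: the unit mass at `0`. -/
def PVM.atZero : PVM H where
  proj B := if (0 : ℝ) ∈ B then 1 else 0
  isProj B _ := by
    split_ifs
    · exact ⟨LinearMap.ext fun _ => rfl, fun _ _ => rfl⟩
    · exact ⟨by simp [IsIdempotentElem], fun _ _ => by simp⟩
  empty := by simp
  univ := by simp
  iUnion B _ hd x := by
    by_cases h : ∃ n, (0 : ℝ) ∈ B n
    · obtain ⟨n, hn⟩ := h
      have hU : (0 : ℝ) ∈ ⋃ n, B n := Set.mem_iUnion.2 ⟨n, hn⟩
      have := hasSum_ite_eq n x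
      convert this using 2 with m
      · by_cases hm : m = n
        · subst hm; simp [hn]
        · have : (0 : ℝ) ∉ B m := fun h0 => Set.disjoint_left.1 (hd hm) h0 hn
          simp [this, hm]
      · simp [hU]
    · have hU : (0 : ℝ) ∉ ⋃ n, B n := by simpa using h
      have h' : ∀ n, (0 : ℝ) ∉ B n := by simpa using h
      simp only [h', hU, if_false]
      simp

instance : Nonempty (PVM H) := ⟨PVM.atZero⟩

/-- The spectral measure of the self-adjoint operator with graph `G`. -/
def spectralMeasure (G : Set (H × H)) : PVM H := Classical.epsilon fun E => E.Represents G

end Spectral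

section States

/-- A state on `K`: a positive trace class operator of trace one. -/
structure State (K : Type u) [NormedAddCommGroup K] [InnerProductSpace ℂ K] [CompleteSpace K] where
  /-- The density operator. -/
  op : K →L[ℂ] K
  isPositive : op.IsPositive
  hasSum_trace : HasSum (fun i => ⟪basis K i, op (basis K i)⟫_ℂ) 1

variable {K : Type u} [NormedAddCommGroup K] [InnerProductSpace ℂ K] [CompleteSpace K]

/-- The trace of a trace class operator. -/
def trace (T : K →L[ℂ] K) : ℂ := ∑' i, ⟪basis K i, T (basis K i)⟫_ℂ

/-- The positive square root of a state, as a bounded operator. -/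
def State.sqrtOp (ρ : State K) : K →L[ℂ] K := CFC.sqrt ρ.op

/-- The orthogonal projection onto the support `(ker ρ)ᗮ` of a state. -/
def State.supp (ρ : State K) : K →L[ℂ] K := (LinearMap.ker ρ.op.toLinearMap)ᗮ.starProjection

theorem State.norm_sqrtOp_sq (ρ : State K) (x : K) :
    ‖ρ.sqrtOp x‖ ^ 2 = (⟪x, ρ.op x⟫_ℂ).re := by
  have h0 : 0 ≤ ρ.op := (ContinuousLinearMap.nonneg_iff_isPositive _).2 ρ.isPositive
  have hs : 0 ≤ CFC.sqrt ρ.op := CFC.sqrt_nonneg _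
  have hp := (ContinuousLinearMap.nonneg_iff_isPositive _).1 hs
  have hm : CFC.sqrt ρ.op (CFC.sqrt ρ.op x) = ρ.op x := by
    have := CFC.sqrt_mul_sqrt_self ρ.op h0
    exact DFunLike.congr_fun this x
  have h2 : ⟪CFC.sqrt ρ.op x, CFC.sqrt ρ.op x⟫_ℂ = ⟪x, CFC.sqrt ρ.op (CFC.sqrt ρ.op x)⟫_ℂ :=
    hp.isSymmetric x _
  rw [hm] at h2
  rw [← h2, State.sqrtOp]
  exact (inner_self_eq_norm_sq (𝕜 := ℂ) _).symm

/-- The square root of a state, as a vector of `B₂(K)`. -/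
def State.sqrtHS (ρ : State K) : HS K :=
  ⟨ρ.sqrtOp, by
    have h := Complex.hasSum_re ρ.hasSum_trace
    refine (memℓp_gen_iff (by norm_num)).2 ?_
    refine h.summable.congr fun i => ?_
    rw [← ρ.norm_sqrtOp_sq]
    norm_num⟩

/-! ### The relative modular operator -/

/-- The graph of the antilinear operator `S`, with domain `{X √σ + Y (1 - Π_σ)}`, `X` bounded and
`Y` Hilbert-Schmidt, and `S (X √σ + Y (1 - Π_σ)) = Π_σ X† √ρ`. -/
def graphS (ρ σ : State K) : Set (HS K × HS K) :=
  {p | ∃ (X : K →L[ℂ] K) (Y : HS K),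
    p.1.op = X * σ.sqrtOp + Y.op * (1 - σ.supp) ∧
    p.2.op = σ.supp * ContinuousLinearMap.adjoint X * ρ.sqrtOp}

/-- The graph of the adjoint `S†` of the antilinear operator `S`:
`⟨a, S b⟩₂` is the conjugate of `⟨S† a, b⟩₂` for all `b` in the domain of `S`. -/
def graphSAdj (ρ σ : State K) : Set (HS K × HS K) :=
  {p | ∀ q ∈ graphS ρ σ, ⟪p.1, q.2⟫_ℂ = starRingEnd ℂ ⟪p.2, q.1⟫_ℂ}

/-- The graph of the relative modular operator `Δ_{ρ,σ} = S† S̄`, where `S̄` is the closure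
of `S`. -/
def modularGraph (ρ σ : State K) : Set (HS K × HS K) :=
  {p | ∃ z : HS K, (p.1, z) ∈ closure (graphS ρ σ) ∧ (z, p.2) ∈ graphSAdj ρ σ}

/-- The measure `⟨√σ, ξ(dλ) √σ⟩₂`, where `ξ` is the spectral measure of `Δ_{ρ,σ}`. -/
def modularMeasure (ρ σ : State K) : Measure ℝ :=
  (spectralMeasure (modularGraph ρ σ)).measure σ.sqrtHS

/-! ### Quantum `f`-divergences -/

/-- `f(0) = lim_{t ↓ 0} f(t)`, in `[-∞, ∞]`. -/
def limZero (f : ℝ → ℝ) : EReal := limUnder (𝓝[>] (0 : ℝ)) fun t => (f t : EReal)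

/-- `f'(∞) = lim_{t → ∞} f(t) / t`, in `[-∞, ∞]`. -/
def slopeInfty (f : ℝ → ℝ) : EReal := limUnder atTop fun t : ℝ => ((f t / t : ℝ) : EReal)

/-- The integral of `f` in `[-∞, ∞]`: that of the positive part minus that of the negative part. -/
def extIntegral (μ : Measure ℝ) (f : ℝ → ℝ) : EReal :=
  ((∫⁻ t, ENNReal.ofReal (f t) ∂μ : ℝ≥0∞) : EReal)
    - ((∫⁻ t, ENNReal.ofReal (-f t) ∂μ : ℝ≥0∞) : EReal)

/-- The quantum `f`-divergence `D_f(ρ‖σ)` for a convex or concave `f` on `(0, ∞)`; the values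
of `f` outside `(0, ∞)` play no role. -/
def fDiv (f : ℝ → ℝ) (ρ σ : State K) : EReal :=
  extIntegral ((modularMeasure ρ σ).restrict (Ioi 0)) f
    + limZero f * ((trace (σ.op * (1 - ρ.supp))).re : EReal)
    + slopeInfty f * ((trace (ρ.op * (1 - σ.supp))).re : EReal)

/-- The logarithm to base `b`, extended to `[0, ∞]` by `log 0 = -∞` and `log ∞ = ∞`. -/
def extLog (b : ℝ) (x : EReal) : EReal := (((Real.log b)⁻¹ : ℝ) : EReal) * ENNReal.log x.toENNReal

/-- Umegaki relative entropy, logarithm to base `b`. -/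
def umegakiBase (b : ℝ) (ρ σ : State K) : EReal := fDiv (fun t => t * Real.logb b t) ρ σ

/-- Umegaki relative entropy, natural logarithm. -/
def umegaki (ρ σ : State K) : EReal := fDiv (fun t => t * Real.log t) ρ σ

/-- Petz-Rényi `α`-relative entropy, natural logarithm. -/
def petzRenyi (α : ℝ) (ρ σ : State K) : EReal :=
  (((α - 1)⁻¹ : ℝ) : EReal) * ENNReal.log (fDiv (fun t => t ^ α) ρ σ).toENNReal

/-- Quantum Hellinger `α`-divergence. -/
def hellingerAlpha (α : ℝ) (ρ σ : State K) : EReal := fDiv (fun t => (t ^ α - 1) / (α - 1)) ρ σ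

/-- Quantum squared Hellinger distance. -/
def hellingerSq (ρ σ : State K) : EReal := fDiv (fun t => 1 / 2 * (√t - 1) ^ 2) ρ σ

/-- Quantum total variation. -/
def totalVar (ρ σ : State K) : EReal := fDiv (fun t => |t - 1|) ρ σ

/-- Quantum `χ²`-divergence. -/
def chiSq (ρ σ : State K) : EReal := fDiv (fun t => (t - 1) ^ 2) ρ σ

end States

end QuantumDiv

end

open QuantumDiv

/-
In eigenbases of `ρ` and `σ`, with eigenvalues `λᵢ` and `μⱼ`, the modular operator is diagonalized
by the rank one operators `|eᵢ⟩⟨uⱼ|`: its eigenvalues are the ratios `λᵢ / μⱼ`, and the spectral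
measure at `√σ` gives them the weights `μⱼ |⟨eᵢ, uⱼ⟩|²`. Every `D_f(ρ‖σ)` is therefore the classical
`f`-divergence of two probability measures, and depends only on the law of their likelihood ratio
`t`. Exchanging `ρ` and `σ` replaces `f(t)` by `t f(1/t)`, and adding `c (t - 1)` to `f` changes
nothing because both measures have mass one, so each linear inequality between divergences follows
from a pointwise inequality between generators on `(0, ∞)`. The others follow from linear families
of such inequalities by optimizing a parameter.
-/

noncomputable section

namespace QuantumDiv

open InformationTheory
open scoped NNReal

section Spectral

variable {H : Type u} [NormedAddCommGroup H] [InnerProductSpace ℂ H]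

theorem PVM.inner_proj_left (E : PVM H) {B : Set ℝ} (hB : MeasurableSet B) (x y : H) :
    ⟪E.proj B x, y⟫_ℂ = ⟪x, E.proj B y⟫_ℂ :=
  (E.isProj B hB).isSymmetric x y

theorem PVM.inner_self_proj (E : PVM H) {B : Set ℝ} (hB : MeasurableSet B) (x : H) :
    ⟪x, E.proj B x⟫_ℂ = ‖E.proj B x‖ ^ 2 := by
  have hidem : E.proj B (E.proj B x) = E.proj B x := by
    simpa using LinearMap.congr_fun (E.isProj B hB).isIdempotentElem x
  rw [← hidem, ← E.inner_proj_left hB, hidem, inner_self_eq_norm_sq_to_K]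
  rfl

theorem PVM.measure_apply (E : PVM H) (x : H) {B : Set ℝ} (hB : MeasurableSet B) :
    E.measure x B = ENNReal.ofReal (‖E.proj B x‖ ^ 2) := by
  rw [PVM.measure, Measure.ofMeasurable_apply B hB, E.inner_self_proj hB, ← Complex.ofReal_pow,
    Complex.ofReal_re]

theorem PVM.measure_univ (E : PVM H) (x : H) :
    E.measure x Set.univ = ENNReal.ofReal (‖x‖ ^ 2) := by
  rw [E.measure_apply x MeasurableSet.univ, E.univ, one_apply_eq_self]

instance (E : PVM H) (x : H) : IsFiniteMeasure (E.measure x) :=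
  ⟨by rw [E.measure_univ]; exact ENNReal.ofReal_lt_top⟩

theorem PVM.proj_eq_zero_of_measure_eq_zero (E : PVM H) {B : Set ℝ} (hB : MeasurableSet B) {x : H}
    (h : E.measure x B = 0) : E.proj B x = 0 := by
  rw [E.measure_apply x hB, ENNReal.ofReal_eq_zero] at h
  simpa using le_antisymm h (sq_nonneg _)

theorem PVM.proj_eq_self_of_measure_compl_eq_zero (E : PVM H) {B : Set ℝ} (hB : MeasurableSet B)
    {x : H} (h : E.measure x Bᶜ = 0) : E.proj B x = x := by
  have hnorm : ‖E.proj B x‖ ^ 2 = ‖x‖ ^ 2 := by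
    have hadd := measure_add_measure_compl (μ := E.measure x) hB
    rwa [h, add_zero, E.measure_univ, E.measure_apply x hB,
      ENNReal.ofReal_eq_ofReal_iff (by positivity) (by positivity)] at hadd
  have hdist : ‖E.proj B x - x‖ ^ 2 = 0 := by
    rw [norm_sub_sq (𝕜 := ℂ), E.inner_proj_left hB, E.inner_self_proj hB, ← Complex.ofReal_pow,
      RCLike.re_to_complex, Complex.ofReal_re, hnorm]
    ring
  rwa [sq_eq_zero_iff, norm_eq_zero, sub_eq_zero] at hdist

theorem PVM.Represents.integrable_sq {E : PVM H} {G : Set (H × H)} (hE : E.Represents G) {x y : H}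
    (hxy : (x, y) ∈ G) : Integrable (fun t : ℝ => t ^ 2) (E.measure x) := by
  refine ⟨by fun_prop, ?_⟩
  rw [hasFiniteIntegral_iff_ofReal (Eventually.of_forall fun t => sq_nonneg t)]
  exact (hE.1 x).1 ⟨y, hxy⟩

theorem integrable_id_of_integrable_sq {μ : Measure ℝ} [IsFiniteMeasure μ]
    (h : Integrable (fun t : ℝ => t ^ 2) μ) : Integrable (fun t : ℝ => t) μ :=
  ((memLp_two_iff_integrable_sq (f := fun t : ℝ => t) (by fun_prop)).2 h).integrable (by norm_num)

theorem PVM.Represents.integral_sub_sq {E : PVM H} {G : Set (H × H)} (hE : E.Represents G) {x y : H}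
    (hxy : (x, y) ∈ G) (l : ℝ) : ∫ t, (t - l) ^ 2 ∂(E.measure x) = ‖y - (l : ℂ) • x‖ ^ 2 := by
  obtain ⟨hinner, hnorm⟩ := hE.2 x y hxy
  have hsq := hE.integrable_sq hxy
  have hid := integrable_id_of_integrable_sq hsq
  have hmass : (E.measure x).real Set.univ = ‖x‖ ^ 2 := by
    rw [Measure.real, E.measure_univ, ENNReal.toReal_ofReal (by positivity)]
  have hexpand : ∀ t : ℝ, (t - l) ^ 2 = t ^ 2 - 2 * l * t + l ^ 2 := fun t => by ring
  simp only [hexpand]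
  rw [integral_add (f := fun t => t ^ 2 - 2 * l * t) (hsq.sub (hid.const_mul _))
    (integrable_const _), integral_sub hsq (hid.const_mul _), integral_const_mul, integral_const,
    hmass, norm_sub_sq (𝕜 := ℂ), inner_smul_right, ← inner_conj_symm, hinner, ← hnorm, norm_smul]
  simp only [Complex.conj_ofReal, ← Complex.ofReal_mul, RCLike.re_to_complex, Complex.ofReal_re,
    Complex.norm_real, Real.norm_eq_abs, mul_pow, sq_abs, smul_eq_mul]
  ring

theorem PVM.Represents.measure_compl_singleton {E : PVM H} {G : Set (H × H)}
    (hE : E.Represents G) {e : H} {l : ℝ} (he : (e, (l : ℂ) • e) ∈ G) :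
    E.measure e {l}ᶜ = 0 := by
  have hint : ∫ t, (t - l) ^ 2 ∂(E.measure e) = 0 := by simp [hE.integral_sub_sq he]
  have hsq : Integrable (fun t : ℝ => (t - l) ^ 2) (E.measure e) :=
    (((memLp_two_iff_integrable_sq (by fun_prop)).2 (hE.integrable_sq he)).sub
      (memLp_const l)).integrable_sq
  have hae := (integral_eq_zero_iff_of_nonneg (fun t => sq_nonneg (t - l)) hsq).1 hint
  rw [Filter.EventuallyEq, ae_iff] at hae
  refine measure_mono_null (fun t ht => ?_) hae
  simpa [sub_eq_zero] using ht

variable {Ω : Type*} (e : HilbertBasis Ω ℂ H) (l : Ω → ℝ)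

theorem PVM.Represents.proj_eigenvector {E : PVM H} {G : Set (H × H)} (hE : E.Represents G) {ω : Ω}
    (he : (e ω, (l ω : ℂ) • e ω) ∈ G) {B : Set ℝ} (hB : MeasurableSet B) :
    E.proj B (e ω) = (l ⁻¹' B).indicator e ω := by
  have hconc := hE.measure_compl_singleton he
  by_cases hl : l ω ∈ B
  · rw [Set.indicator_of_mem (show ω ∈ l ⁻¹' B from hl)]
    refine E.proj_eq_self_of_measure_compl_eq_zero hB (measure_mono_null ?_ hconc)
    exact compl_subset_compl.2 (singleton_subset_iff.2 hl)
  · rw [Set.indicator_of_notMem (show ω ∉ l ⁻¹' B from hl)]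
    refine E.proj_eq_zero_of_measure_eq_zero hB (measure_mono_null ?_ hconc)
    exact subset_compl_singleton_iff.2 hl

/-- The measure `∑ ω, ‖⟨e ω, x⟩‖² δ_{l ω}`: the scalar spectral measure at `x` of the operator that
is diagonal in the basis `e` with eigenvalues `l`. -/
def diagMeasure (x : H) : Measure ℝ :=
  Measure.sum fun ω => ENNReal.ofReal (‖⟪e ω, x⟫_ℂ‖ ^ 2) • Measure.dirac (l ω)

theorem hasSum_norm_inner_sq (x : H) : HasSum (fun ω => ‖⟪e ω, x⟫_ℂ‖ ^ 2) (‖x‖ ^ 2) := by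
  have h := Complex.hasSum_re (e.hasSum_inner_mul_inner x x)
  rw [← RCLike.re_to_complex, inner_self_eq_norm_sq (𝕜 := ℂ)] at h
  refine h.congr_fun fun ω => ?_
  rw [← inner_conj_symm x (e ω), ← Complex.normSq_eq_conj_mul_self, Complex.ofReal_re,
    Complex.normSq_eq_norm_sq]

theorem PVM.measure_eq_diagMeasure (E : PVM H)
    (h : ∀ ω B, MeasurableSet B → E.proj B (e ω) = (l ⁻¹' B).indicator e ω) (x : H) :
    E.measure x = diagMeasure e l x := by
  ext B hB
  rw [E.measure_apply x hB, diagMeasure, Measure.sum_apply _ hB,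
    ← (hasSum_norm_inner_sq e (E.proj B x)).tsum_eq, ENNReal.ofReal_tsum_of_nonneg
      (fun _ => by positivity) (hasSum_norm_inner_sq e _).summable]
  refine tsum_congr fun ω => ?_
  rw [← E.inner_proj_left hB, h ω B hB, Measure.smul_apply, Measure.dirac_apply' _ hB]
  by_cases hl : l ω ∈ B <;> simp [hl]

theorem lintegral_diagMeasure (x : H) (f : ℝ → ℝ≥0∞) :
    ∫⁻ t, f t ∂(diagMeasure e l x) = ∑' ω, ENNReal.ofReal (‖⟪e ω, x⟫_ℂ‖ ^ 2) * f (l ω) := by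
  simp [diagMeasure, lintegral_sum_measure, lintegral_smul_measure]

theorem hasSum_integral_diagMeasure (x : H) {f : ℝ → ℝ} (hf : Integrable f (diagMeasure e l x)) :
    HasSum (fun ω => ‖⟪e ω, x⟫_ℂ‖ ^ 2 * f (l ω)) (∫ t, f t ∂(diagMeasure e l x)) := by
  refine (hasSum_integral_measure hf).congr_fun fun ω => ?_
  simp [integral_smul_measure]

theorem hilbertBasis_ext {x y : H} (h : ∀ ω, ⟪e ω, x⟫_ℂ = ⟪e ω, y⟫_ℂ) : x = y := by
  apply e.repr.injective
  ext ω
  simp only [e.repr_apply_apply, h]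

theorem lintegral_sq_diagMeasure (x : H) :
    ∫⁻ t, ENNReal.ofReal (t ^ 2) ∂(diagMeasure e l x) =
      ∑' ω, ENNReal.ofReal (‖(l ω : ℂ) * ⟪e ω, x⟫_ℂ‖ ^ 2) := by
  rw [lintegral_diagMeasure]
  refine tsum_congr fun ω => ?_
  rw [← ENNReal.ofReal_mul (by positivity), norm_mul, mul_pow, mul_comm, Complex.norm_real,
    Real.norm_eq_abs, sq_abs]

theorem exists_coord_eq_mul_iff (x : H) :
    (∃ y, ∀ ω, ⟪e ω, y⟫_ℂ = (l ω : ℂ) * ⟪e ω, x⟫_ℂ) ↔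
      ∫⁻ t, ENNReal.ofReal (t ^ 2) ∂(diagMeasure e l x) < ∞ := by
  rw [lintegral_sq_diagMeasure]
  constructor
  · rintro ⟨y, hy⟩
    simp only [← hy]
    rw [← ENNReal.ofReal_tsum_of_nonneg (fun _ => by positivity)
      (hasSum_norm_inner_sq e y).summable]
    exact ENNReal.ofReal_lt_top
  · intro hfin
    have hsum : Summable fun ω => ‖(l ω : ℂ) * ⟪e ω, x⟫_ℂ‖ ^ 2 :=
      (ENNReal.summable_toReal hfin.ne).congr fun ω => by rw [ENNReal.toReal_ofReal (by positivity)]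
    have hmem : Memℓp (fun ω => (l ω : ℂ) * ⟪e ω, x⟫_ℂ) 2 :=
      (memℓp_gen_iff (by norm_num)).2 (hsum.congr fun ω => by norm_num)
    refine ⟨e.repr.symm ⟨_, hmem⟩, fun ω => ?_⟩
    rw [← e.repr_apply_apply, LinearIsometryEquiv.apply_symm_apply]

variable [CompleteSpace H]

/-- The orthogonal projection onto the closed span of the basis vectors `e ω`, `ω ∈ s`. -/
def coordProj (s : Set Ω) : H →L[ℂ] H := (Submodule.span ℂ (e '' sᶜ))ᗮ.starProjection

theorem coordProj_apply_basis (s : Set Ω) (ω : Ω) : coordProj e s (e ω) = s.indicator e ω := by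
  by_cases hω : ω ∈ s
  · rw [Set.indicator_of_mem hω, coordProj, Submodule.starProjection_eq_self_iff,
      Submodule.mem_orthogonal]
    intro y hy
    induction hy using Submodule.span_induction with
    | mem y hy =>
      obtain ⟨ω', hω', rfl⟩ := hy
      exact e.orthonormal.2 fun heq => hω' (heq ▸ hω)
    | zero => exact inner_zero_left _
    | add y z _ _ hy hz => rw [inner_add_left, hy, hz, add_zero]
    | smul c y _ hy => rw [inner_smul_left, hy, mul_zero]
  · rw [Set.indicator_of_notMem hω, coordProj, Submodule.starProjection_apply_eq_zero_iff]
    exact Submodule.le_orthogonal_orthogonal _ (Submodule.subset_span ⟨ω, hω, rfl⟩)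

theorem inner_coordProj (s : Set Ω) (ω : Ω) (x : H) :
    ⟪e ω, coordProj e s x⟫_ℂ = s.indicator (fun ω => ⟪e ω, x⟫_ℂ) ω := by
  rw [coordProj, ← Submodule.inner_starProjection_left_eq_right, ← coordProj,
    coordProj_apply_basis]
  by_cases hω : ω ∈ s <;> simp [hω]

theorem hasSum_coordProj (s : Set Ω) (x : H) :
    HasSum (fun ω : s => ⟪e ω, x⟫_ℂ • e ω) (coordProj e s x) := by
  refine (hasSum_subtype_iff_indicator (f := fun ω => ⟪e ω, x⟫_ℂ • e ω)).2 ?_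
  refine (e.hasSum_repr (coordProj e s x)).congr_fun fun ω => ?_
  rw [e.repr_apply_apply, inner_coordProj]
  by_cases hω : ω ∈ s <;> simp [hω]

theorem hasSum_coordProj_iUnion {s : ℕ → Set Ω} (hs : Pairwise (Function.onFun Disjoint s))
    (x : H) :
    HasSum (fun n => coordProj e (s n) x) (coordProj e (⋃ n, s n) x) := by
  have h : HasSum (fun z : Σ n, s n => ⟪e z.2, x⟫_ℂ • e z.2) (coordProj e (⋃ n, s n) x) :=
    (Set.unionEqSigmaOfDisjoint hs).symm.hasSum_iff.2 (hasSum_coordProj e _ x)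
  exact h.sigma fun n => hasSum_coordProj e (s n) x

/-- The projection-valued measure of the operator that is diagonal in the basis `e` with
eigenvalues `l`. -/
def diagPVM : PVM H where
  proj B := coordProj e (l ⁻¹' B)
  isProj _ _ := Submodule.isSymmetricProjection_starProjection _
  empty := by
    ext x
    exact hilbertBasis_ext e fun ω => by simp [inner_coordProj]
  univ := by
    ext x
    exact hilbertBasis_ext e fun ω => by simp [inner_coordProj]
  iUnion B _ hd x := by
    rw [Set.preimage_iUnion]
    exact hasSum_coordProj_iUnion e (fun _ _ hmn => (hd hmn).preimage l) x

theorem diagPVM_measure (x : H) : (diagPVM e l).measure x = diagMeasure e l x :=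
  PVM.measure_eq_diagMeasure e l _ (fun ω B _ => coordProj_apply_basis e (l ⁻¹' B) ω) x

theorem diagPVM_represents {G : Set (H × H)}
    (hG : ∀ x y, (x, y) ∈ G ↔ ∀ ω, ⟪e ω, y⟫_ℂ = (l ω : ℂ) * ⟪e ω, x⟫_ℂ) :
    (diagPVM e l).Represents G := by
  refine ⟨fun x => ?_, fun x y hxy => ?_⟩
  · simp only [hG, diagPVM_measure, exists_coord_eq_mul_iff]
  have hy := (hG x y).1 hxy
  have hfin : IsFiniteMeasure (diagMeasure e l x) := by
    rw [← diagPVM_measure]; infer_instance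
  have hsq : Integrable (fun t : ℝ => t ^ 2) (diagMeasure e l x) := by
    refine ⟨by fun_prop, ?_⟩
    rw [hasFiniteIntegral_iff_ofReal (Eventually.of_forall fun t => sq_nonneg t)]
    exact (exists_coord_eq_mul_iff e l x).1 ⟨y, hy⟩
  rw [diagPVM_measure]
  constructor
  · have hint := Complex.hasSum_ofReal.2
      (hasSum_integral_diagMeasure e l x (integrable_id_of_integrable_sq hsq))
    refine (e.hasSum_inner_mul_inner x y).unique (hint.congr_fun fun ω => ?_)
    rw [hy, ← inner_conj_symm x (e ω)]
    push_cast
    rw [← Complex.conj_mul']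
    ring
  · refine (hasSum_norm_inner_sq e y).unique
      ((hasSum_integral_diagMeasure e l x hsq).congr_fun fun ω => ?_)
    rw [hy, norm_mul, mul_pow, Complex.norm_real, Real.norm_eq_abs, sq_abs, mul_comm]

/-- The spectral measure is unique here because its value on each eigenvector is forced. -/
theorem spectralMeasure_measure {G : Set (H × H)}
    (hG : ∀ x y, (x, y) ∈ G ↔ ∀ ω, ⟪e ω, y⟫_ℂ = (l ω : ℂ) * ⟪e ω, x⟫_ℂ) (x : H) :
    (spectralMeasure G).measure x = diagMeasure e l x := by
  have hE : (spectralMeasure G).Represents G :=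
    Classical.epsilon_spec (p := fun E : PVM H => E.Represents G) ⟨_, diagPVM_represents e l hG⟩
  refine PVM.measure_eq_diagMeasure e l _ (fun ω B hB => hE.proj_eigenvector e l ?_ hB) x
  refine (hG _ _).2 fun ω' => ?_
  rw [inner_smul_right]
  rcases eq_or_ne ω' ω with rfl | h
  · rfl
  · rw [e.orthonormal.2 h, mul_zero, mul_zero]

end Spectral

section HilbertSchmidt

section OfBasis

variable {E F ι : Type*} [NormedAddCommGroup E] [InnerProductSpace ℂ E] [NormedAddCommGroup F]
  (e : HilbertBasis ι ℂ E) (w : lp (fun _ : ι => F) 2)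

theorem hasSum_norm_sq : HasSum (fun i => ‖w i‖ ^ 2) (‖w‖ ^ 2) := by
  simpa using lp.hasSum_norm (p := 2) (by norm_num) w

theorem summable_norm_inner_mul_norm (x : E) : Summable fun i => ‖⟪e i, x⟫_ℂ‖ * ‖w i‖ :=
  Real.summable_mul_of_Lp_Lq_of_nonneg Real.HolderConjugate.two_two (fun _ => norm_nonneg _)
    (fun _ => norm_nonneg _) (by simpa using (hasSum_norm_inner_sq e x).summable)
    (by simpa using (hasSum_norm_sq w).summable)

theorem tsum_norm_inner_mul_norm_le (x : E) : ∑' i, ‖⟪e i, x⟫_ℂ‖ * ‖w i‖ ≤ ‖w‖ * ‖x‖ := by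
  have hx := hasSum_norm_inner_sq e x
  have hw := hasSum_norm_sq w
  have holder := Real.inner_le_Lp_mul_Lq_tsum_of_nonneg
    (f := fun i => ‖⟪e i, x⟫_ℂ‖) (g := fun i => ‖w i‖) Real.HolderConjugate.two_two
    (fun _ => norm_nonneg _) (fun _ => norm_nonneg _)
    (by simpa using hx.summable) (by simpa using hw.summable)
  simp only [Real.rpow_ofNat, hx.tsum_eq, hw.tsum_eq, ← Real.sqrt_eq_rpow] at holder
  rwa [Real.sqrt_sq (norm_nonneg _), Real.sqrt_sq (norm_nonneg _), mul_comm ‖x‖] at holder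

theorem hilbertBasis_clm_ext [NormedSpace ℂ F] {S T : E →L[ℂ] F} (h : ∀ i, S (e i) = T (e i)) :
    S = T :=
  ContinuousLinearMap.ext_on (s := Set.range e)
    (Submodule.dense_iff_topologicalClosure_eq_top.2 e.dense_span) (Set.forall_mem_range.2 h)

variable [NormedSpace ℂ F] [CompleteSpace F]

theorem summable_inner_smul (x : E) : Summable fun i => ⟪e i, x⟫_ℂ • w i :=
  .of_norm (by simpa only [norm_smul] using summable_norm_inner_mul_norm e w x)

/-- The bounded operator taking the values `w i` on the basis vectors `e i`. -/
def opOfL2 : E →L[ℂ] F :=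
  LinearMap.mkContinuous
    { toFun x := ∑' i, ⟪e i, x⟫_ℂ • w i
      map_add' x y := by
        simp only [inner_add_right, add_smul]
        exact (summable_inner_smul e w x).tsum_add (summable_inner_smul e w y)
      map_smul' c x := by
        simp only [inner_smul_right, mul_smul, RingHom.id_apply]
        exact (summable_inner_smul e w x).tsum_const_smul c }
    ‖w‖ fun x => by
      refine (norm_tsum_le_tsum_norm ?_).trans ?_
      · simpa only [norm_smul] using summable_norm_inner_mul_norm e w x
      · simpa only [norm_smul] using tsum_norm_inner_mul_norm_le e w x

theorem norm_opOfL2_le : ‖opOfL2 e w‖ ≤ ‖w‖ :=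
  LinearMap.mkContinuous_norm_le _ (norm_nonneg _) _

theorem opOfL2_apply_basis (i : ι) : opOfL2 e w (e i) = w i := by
  change ∑' j, ⟪e j, e i⟫_ℂ • w j = w i
  rw [tsum_eq_single i fun j hj => by rw [e.orthonormal.2 hj, zero_smul],
    inner_self_eq_norm_sq_to_K, e.orthonormal.1 i, RCLike.ofReal_one, one_pow, one_smul]

end OfBasis

variable {K : Type u} [NormedAddCommGroup K] [InnerProductSpace ℂ K] [CompleteSpace K]

theorem HS.ext {S T : HS K} (h : S.op = T.op) : S = T := Subtype.ext h

theorem HS.add_op (S T : HS K) : (S + T).op = S.op + T.op := rfl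

theorem HS.smul_op (c : ℂ) (T : HS K) : (c • T).op = c • T.op := rfl

theorem HS.zero_op : (0 : HS K).op = 0 := rfl

theorem HS.toL2_surjective : Function.Surjective (HS.toL2 K) := by
  intro w
  have h : (fun i => opOfL2 (basis K) w (basis K i)) = w := funext (opOfL2_apply_basis (basis K) w)
  exact ⟨⟨opOfL2 (basis K) w, show Memℓp _ _ from h ▸ w.2⟩, Subtype.ext h⟩

instance : CompleteSpace (HS K) := by
  have e : HS K ≃ₗᵢ[ℂ] lp (fun _ : basisSet K => K) 2 :=
    .ofSurjective ((HS.toL2 K).isometryOfInner fun _ _ => rfl) HS.toL2_surjective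
  exact (completeSpace_congr (e := e.toEquiv) e.isometry.isUniformEmbedding).2 inferInstance

/-- The rank-one operator `|x⟩⟨y|` as a vector of `B₂(K)`. -/
def rankOneHS (x y : K) : HS K :=
  ⟨InnerProductSpace.rankOne ℂ x y, by
    refine (memℓp_gen_iff (by norm_num)).2 ?_
    refine ((hasSum_norm_inner_sq (basis K) y).summable.mul_right (‖x‖ ^ 2)).congr fun i => ?_
    rw [InnerProductSpace.rankOne_apply, norm_smul, ← norm_inner_symm]
    norm_num [mul_pow]⟩

theorem rankOneHS_op_apply (x y z : K) : (rankOneHS x y).op z = ⟪y, z⟫_ℂ • x := rfl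

theorem inner_rankOneHS (x y : K) (T : HS K) : ⟪rankOneHS x y, T⟫_ℂ = ⟪x, T.op y⟫_ℂ := by
  rw [HS.inner_eq, ← ContinuousLinearMap.adjoint_inner_left, ← (basis K).tsum_inner_mul_inner]
  refine tsum_congr fun i => ?_
  rw [rankOneHS_op_apply, inner_smul_left, inner_conj_symm,
    ContinuousLinearMap.adjoint_inner_left, mul_comm]

variable {ι κ : Type*} (u : HilbertBasis ι ℂ K) (v : HilbertBasis κ ℂ K)

theorem orthonormal_rankOneHS : Orthonormal ℂ fun ω : ι × κ => rankOneHS (u ω.1) (v ω.2) := by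
  classical
  rw [orthonormal_iff_ite]
  rintro ⟨i, j⟩ ⟨k, l⟩
  rw [inner_rankOneHS, rankOneHS_op_apply, inner_smul_right,
    orthonormal_iff_ite.1 u.orthonormal, orthonormal_iff_ite.1 v.orthonormal, mul_comm]
  simp only [Prod.mk.injEq, ite_and, eq_comm (a := j), ite_mul, one_mul, zero_mul]

/-- The orthonormal basis `|uᵢ⟩⟨vⱼ|` of `B₂(K)`. -/
def hsBasis : HilbertBasis (ι × κ) ℂ (HS K) :=
  HilbertBasis.mkOfOrthogonalEqBot (orthonormal_rankOneHS u v) <| by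
    refine (Submodule.eq_bot_iff _).2 fun T hT => ?_
    refine HS.ext (hilbertBasis_clm_ext v fun j => hilbertBasis_ext u fun i => ?_)
    rw [← inner_rankOneHS,
      (Submodule.mem_orthogonal _ _).1 hT _ (Submodule.subset_span ⟨(i, j), rfl⟩), HS.zero_op,
      zero_apply, inner_zero_right]

theorem hsBasis_apply (i : ι) (j : κ) : hsBasis u v (i, j) = rankOneHS (u i) (v j) := by
  simp [hsBasis]

theorem inner_hsBasis (i : ι) (j : κ) (T : HS K) :
    ⟪hsBasis u v (i, j), T⟫_ℂ = ⟪u i, T.op (v j)⟫_ℂ := by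
  rw [hsBasis_apply, inner_rankOneHS]

end HilbertSchmidt

section Modular

variable {K : Type u} [NormedAddCommGroup K] [InnerProductSpace ℂ K] [CompleteSpace K]
  {ρ σ : State K}

theorem State.inner_op_left (ρ : State K) (x y : K) : ⟪ρ.op x, y⟫_ℂ = ⟪x, ρ.op y⟫_ℂ :=
  ρ.isPositive.isSymmetric x y

theorem State.sqrtOp_isPositive (ρ : State K) : ρ.sqrtOp.IsPositive :=
  (ContinuousLinearMap.nonneg_iff_isPositive _).1 (CFC.sqrt_nonneg _)

theorem State.inner_sqrtOp_left (ρ : State K) (x y : K) :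
    ⟪ρ.sqrtOp x, y⟫_ℂ = ⟪x, ρ.sqrtOp y⟫_ℂ :=
  ρ.sqrtOp_isPositive.isSymmetric x y

theorem State.sqrtOp_sqrtOp (ρ : State K) (x : K) : ρ.sqrtOp (ρ.sqrtOp x) = ρ.op x :=
  DFunLike.congr_fun
    (CFC.sqrt_mul_sqrt_self ρ.op ((ContinuousLinearMap.nonneg_iff_isPositive _).2 ρ.isPositive)) x

theorem State.inner_supp_left (ρ : State K) (x y : K) : ⟪ρ.supp x, y⟫_ℂ = ⟪x, ρ.supp y⟫_ℂ :=
  Submodule.inner_starProjection_left_eq_right _ x y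

/-- The orthonormal basis `u` diagonalizes `ρ`, with eigenvalues `r`. -/
structure State.IsEigenbasis {ι : Type*} (ρ : State K) (u : HilbertBasis ι ℂ K) (r : ι → ℝ) :
    Prop where
  nonneg : ∀ i, 0 ≤ r i
  apply_eq : ∀ i, ρ.op (u i) = (r i : ℂ) • u i

namespace State.IsEigenbasis

variable {ι : Type*} {u : HilbertBasis ι ℂ K} {r : ι → ℝ}

theorem sqrtOp_apply (hρ : ρ.IsEigenbasis u r) (i : ι) :
    ρ.sqrtOp (u i) = ((√(r i) : ℝ) : ℂ) • u i := by
  have hop := hρ.apply_eq i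
  rcases (hρ.nonneg i).eq_or_lt with hr | hr
  · have h := ρ.norm_sqrtOp_sq (u i)
    rw [hop, ← hr] at h
    simpa [← hr] using h
  -- The defect `z = √ρ uᵢ - √rᵢ uᵢ` satisfies `√ρ z = -√rᵢ z`, so it vanishes as `√ρ ≥ 0`.
  set z := ρ.sqrtOp (u i) - ((√(r i) : ℝ) : ℂ) • u i with hz
  have hsqrt_z : ρ.sqrtOp z = -(((√(r i) : ℝ) : ℂ) • z) := by
    rw [hz, map_sub, map_smul, ρ.sqrtOp_sqrtOp, hop, smul_sub, smul_smul, ← Complex.ofReal_mul,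
      Real.mul_self_sqrt hr.le]
    abel
  have hnonneg : 0 ≤ -(√(r i) * ‖z‖ ^ 2) := by
    have h := ρ.sqrtOp_isPositive.inner_nonneg_right z
    rw [hsqrt_z, inner_neg_right, inner_smul_right, inner_self_eq_norm_sq_to_K] at h
    rw [← Complex.zero_le_real]
    push_cast
    exact h
  have hz0 : ‖z‖ ^ 2 = 0 := by nlinarith [sq_nonneg ‖z‖, Real.sqrt_pos.2 hr]
  rwa [sq_eq_zero_iff, norm_eq_zero, hz, sub_eq_zero] at hz0

theorem supp_apply_of_eq_zero (hρ : ρ.IsEigenbasis u r) {i : ι} (hr : r i = 0) :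
    ρ.supp (u i) = 0 := by
  rw [State.supp, Submodule.starProjection_apply_eq_zero_iff]
  refine Submodule.le_orthogonal_orthogonal _ ?_
  simpa [hr] using hρ.apply_eq i

theorem supp_apply_of_ne_zero (hρ : ρ.IsEigenbasis u r) {i : ι} (hr : r i ≠ 0) :
    ρ.supp (u i) = u i := by
  refine Submodule.starProjection_eq_self_iff.2 ((Submodule.mem_orthogonal _ _).2 fun y hy => ?_)
  have h := ρ.inner_op_left y (u i)
  rw [show ρ.op y = 0 from hy, inner_zero_left, hρ.apply_eq, inner_smul_right] at h
  exact (mul_eq_zero.1 h.symm).resolve_left (by exact_mod_cast hr)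

end State.IsEigenbasis

theorem zero_mem_graphS (ρ σ : State K) : 0 ∈ graphS ρ σ :=
  ⟨0, 0, by simp [HS.zero_op], by simp [HS.zero_op]⟩

theorem add_mem_graphS {a b : HS K × HS K} (ha : a ∈ graphS ρ σ) (hb : b ∈ graphS ρ σ) :
    a + b ∈ graphS ρ σ := by
  obtain ⟨X, Y, ha₁, ha₂⟩ := ha
  obtain ⟨X', Y', hb₁, hb₂⟩ := hb
  refine ⟨X + X', Y + Y', ?_, ?_⟩
  · rw [Prod.fst_add, HS.add_op, HS.add_op, ha₁, hb₁]
    noncomm_ring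
  · rw [Prod.snd_add, HS.add_op, ha₂, hb₂, map_add]
    noncomm_ring

theorem smul_mem_graphS {a b : HS K} (c : ℂ) (h : (a, b) ∈ graphS ρ σ) :
    (c • a, starRingEnd ℂ c • b) ∈ graphS ρ σ := by
  obtain ⟨X, Y, ha, hb⟩ := h
  refine ⟨c • X, c • Y, ?_, ?_⟩
  · simp only [HS.smul_op] at ha ⊢
    rw [ha, smul_add, smul_mul_assoc, smul_mul_assoc]
  · simp only [HS.smul_op] at hb ⊢
    rw [hb, map_smulₛₗ, mul_smul_comm, smul_mul_assoc]

variable {ι κ : Type*} {u : HilbertBasis ι ℂ K} {v : HilbertBasis κ ℂ K} {r : ι → ℝ} {s : κ → ℝ}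

theorem hsBasis_mem_graphS (hρ : ρ.IsEigenbasis u r) (hσ : σ.IsEigenbasis v s) (i : ι) (j : κ) :
    (hsBasis u v (i, j), ((√(r i / s j) : ℝ) : ℂ) • hsBasis v u (j, i)) ∈ graphS ρ σ := by
  simp only [hsBasis_apply]
  by_cases hs : s j = 0
  · refine ⟨0, rankOneHS (u i) (v j), ?_, ?_⟩
    · ext z
      simp [rankOneHS_op_apply, ← σ.inner_supp_left, hσ.supp_apply_of_eq_zero hs]
    · simp [hs, HS.zero_op]
  have hs_pos : 0 < √(s j) := Real.sqrt_pos.2 (lt_of_le_of_ne (hσ.nonneg j) (Ne.symm hs))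
  have hs_ne : ((√(s j) : ℝ) : ℂ) ≠ 0 := by exact_mod_cast hs_pos.ne'
  refine ⟨(((√(s j))⁻¹ : ℝ) : ℂ) • (rankOneHS (u i) (v j)).op, 0, ?_, ?_⟩
  · ext z
    simp only [rankOneHS_op_apply, HS.zero_op, zero_mul, add_zero, mul_apply_eq_comp, smul_apply]
    rw [← σ.inner_sqrtOp_left, hσ.sqrtOp_apply, inner_smul_left, smul_smul, Complex.conj_ofReal,
      Complex.ofReal_inv, inv_mul_cancel_left₀ hs_ne]
  · have hadj : ContinuousLinearMap.adjoint ((((√(s j))⁻¹ : ℝ) : ℂ) • (rankOneHS (u i) (v j)).op) =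
        (((√(s j))⁻¹ : ℝ) : ℂ) • (rankOneHS (v j) (u i)).op := by
      rw [map_smulₛₗ, Complex.conj_ofReal]
      congr 1
      exact InnerProductSpace.adjoint_rankOne (u i) (v j)
    ext z
    rw [hadj]
    simp only [rankOneHS_op_apply, HS.smul_op, mul_apply_eq_comp, smul_apply, map_smul,
      hσ.supp_apply_of_ne_zero hs]
    rw [← ρ.inner_sqrtOp_left, hρ.sqrtOp_apply, inner_smul_left, smul_smul, smul_smul,
      Complex.conj_ofReal, Real.sqrt_div (hρ.nonneg i), Complex.ofReal_inv, Complex.ofReal_div]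
    congr 1
    field_simp

theorem inner_hsBasis_of_mem_graphS (hρ : ρ.IsEigenbasis u r) (hσ : σ.IsEigenbasis v s) (i : ι)
    (j : κ) {b c : HS K} (h : (b, c) ∈ graphS ρ σ) :
    ⟪hsBasis v u (j, i), c⟫_ℂ =
      ((√(r i / s j) : ℝ) : ℂ) * starRingEnd ℂ ⟪hsBasis u v (i, j), b⟫_ℂ := by
  obtain ⟨X, Y, hb, hc⟩ := h
  simp only at hb hc
  rw [inner_hsBasis, inner_hsBasis, hb, hc]
  simp only [mul_apply_eq_comp, add_apply, sub_apply, one_apply_eq_self, ← σ.inner_supp_left,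
    hσ.sqrtOp_apply, hρ.sqrtOp_apply]
  by_cases hs : s j = 0
  · simp [hs, hσ.supp_apply_of_eq_zero hs]
  have hs_pos : 0 < √(s j) := Real.sqrt_pos.2 (lt_of_le_of_ne (hσ.nonneg j) (Ne.symm hs))
  have hs_ne : ((√(s j) : ℝ) : ℂ) ≠ 0 := by exact_mod_cast hs_pos.ne'
  rw [hσ.supp_apply_of_ne_zero hs, sub_self, map_zero, add_zero, map_smul, map_smul,
    inner_smul_right, inner_smul_right, ContinuousLinearMap.adjoint_inner_right, map_mul,
    inner_conj_symm, Complex.conj_ofReal, Real.sqrt_div (hρ.nonneg i), Complex.ofReal_div]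
  field_simp

theorem mem_closure_graphS_iff (hρ : ρ.IsEigenbasis u r) (hσ : σ.IsEigenbasis v s) (b c : HS K) :
    (b, c) ∈ closure (graphS ρ σ) ↔ ∀ i j, ⟪hsBasis v u (j, i), c⟫_ℂ =
      ((√(r i / s j) : ℝ) : ℂ) * starRingEnd ℂ ⟪hsBasis u v (i, j), b⟫_ℂ := by
  constructor
  · intro h
    have hclosed : IsClosed {p : HS K × HS K | ∀ i j, ⟪hsBasis v u (j, i), p.2⟫_ℂ =
        ((√(r i / s j) : ℝ) : ℂ) * starRingEnd ℂ ⟪hsBasis u v (i, j), p.1⟫_ℂ} := by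
      simp only [Set.ofPred_forall]
      refine isClosed_iInter fun i => isClosed_iInter fun j => isClosed_eq (by fun_prop) ?_
      exact continuous_const.mul (Complex.continuous_conj.comp (by fun_prop))
    exact closure_minimal (fun _ hp i j => inner_hsBasis_of_mem_graphS hρ hσ i j hp) hclosed h
  · intro h
    have hb := (hsBasis u v).hasSum_repr b
    have hc := (Equiv.prodComm ι κ).hasSum_iff.2 ((hsBasis v u).hasSum_repr c)
    refine mem_closure_of_tendsto (hb.prodMk hc) (Eventually.of_forall fun F => ?_)
    refine Finset.sum_induction _ (· ∈ graphS ρ σ) (fun _ _ => add_mem_graphS)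
      (zero_mem_graphS ρ σ) ?_
    rintro ⟨i, j⟩ -
    have hmem := smul_mem_graphS ⟪hsBasis u v (i, j), b⟫_ℂ (hsBasis_mem_graphS hρ hσ i j)
    rw [smul_smul, mul_comm, ← h i j] at hmem
    simpa only [Function.comp, Equiv.prodComm_apply, Prod.swap_prod_mk,
      HilbertBasis.repr_apply_apply] using hmem

theorem mem_graphSAdj_iff (hρ : ρ.IsEigenbasis u r) (hσ : σ.IsEigenbasis v s) (z y : HS K) :
    (z, y) ∈ graphSAdj ρ σ ↔ ∀ i j, ⟪hsBasis u v (i, j), y⟫_ℂ =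
      ((√(r i / s j) : ℝ) : ℂ) * starRingEnd ℂ ⟪hsBasis v u (j, i), z⟫_ℂ := by
  constructor
  · intro h i j
    have hij := h _ (hsBasis_mem_graphS hρ hσ i j)
    rw [inner_smul_right, inner_conj_symm] at hij
    rw [← hij, inner_conj_symm]
  · rintro h ⟨b, c⟩ hbc
    have hcoeff i j := inner_hsBasis_of_mem_graphS hρ hσ i j hbc
    have hzc := (Equiv.prodComm ι κ).hasSum_iff.2 ((hsBasis v u).hasSum_inner_mul_inner z c)
    have hby := (hsBasis u v).hasSum_inner_mul_inner b y
    simp only [inner_conj_symm]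
    refine hzc.unique (hby.congr_fun ?_)
    rintro ⟨i, j⟩
    simp only [Function.comp, Equiv.prodComm_apply, Prod.swap_prod_mk]
    rw [h, hcoeff, ← inner_conj_symm z, ← inner_conj_symm b]
    ring

theorem exists_mem_closure_graphS (hρ : ρ.IsEigenbasis u r) (hσ : σ.IsEigenbasis v s) {x y : HS K}
    (h : ∀ ω, ⟪hsBasis u v ω, y⟫_ℂ = ((r ω.1 / s ω.2 : ℝ) : ℂ) * ⟪hsBasis u v ω, x⟫_ℂ) :
    ∃ z, (x, z) ∈ closure (graphS ρ σ) := by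
  have hmem : Memℓp (fun ω : κ × ι => ((√(r ω.2 / s ω.1) : ℝ) : ℂ) *
      starRingEnd ℂ ⟪hsBasis u v (ω.2, ω.1), x⟫_ℂ) 2 := by
    have hsum := (Equiv.prodComm κ ι).summable_iff.2 <|
      (hasSum_norm_inner_sq (hsBasis u v) x).summable.add
        (hasSum_norm_inner_sq (hsBasis u v) y).summable
    refine (memℓp_gen_iff (by norm_num)).2 (hsum.of_nonneg_of_le (fun _ => by positivity) ?_)
    rintro ⟨j, i⟩
    have hq : 0 ≤ r i / s j := div_nonneg (hρ.nonneg i) (hσ.nonneg j)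
    have hq_le : r i / s j ≤ 1 + (r i / s j) ^ 2 := by nlinarith [sq_nonneg (r i / s j - 1)]
    simp only [Function.comp, Equiv.prodComm_apply, Prod.swap_prod_mk, h, ENNReal.toReal_ofNat,
      Real.rpow_ofNat, norm_mul, mul_pow, Complex.norm_real, Real.norm_eq_abs, sq_abs,
      Real.sq_sqrt hq, RCLike.norm_conj]
    nlinarith [mul_le_mul_of_nonneg_right hq_le (sq_nonneg ‖⟪hsBasis u v (i, j), x⟫_ℂ‖)]
  refine ⟨(hsBasis v u).repr.symm ⟨_, hmem⟩, (mem_closure_graphS_iff hρ hσ x _).2 fun i j => ?_⟩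
  rw [← (hsBasis v u).repr_apply_apply, LinearIsometryEquiv.apply_symm_apply]

theorem mem_modularGraph_iff (hρ : ρ.IsEigenbasis u r) (hσ : σ.IsEigenbasis v s) (x y : HS K) :
    (x, y) ∈ modularGraph ρ σ ↔ ∀ ω, ⟪hsBasis u v ω, y⟫_ℂ =
      ((r ω.1 / s ω.2 : ℝ) : ℂ) * ⟪hsBasis u v ω, x⟫_ℂ := by
  have hcomp {z} (hz : (x, z) ∈ closure (graphS ρ σ)) i j :
      ((√(r i / s j) : ℝ) : ℂ) * starRingEnd ℂ ⟪hsBasis v u (j, i), z⟫_ℂ =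
        ((r i / s j : ℝ) : ℂ) * ⟪hsBasis u v (i, j), x⟫_ℂ := by
    rw [(mem_closure_graphS_iff hρ hσ x z).1 hz, map_mul, Complex.conj_ofReal, Complex.conj_conj,
      ← mul_assoc, ← Complex.ofReal_mul,
      Real.mul_self_sqrt (div_nonneg (hρ.nonneg i) (hσ.nonneg j))]
  constructor
  · rintro ⟨z, hz, hzy⟩ ⟨i, j⟩
    rw [(mem_graphSAdj_iff hρ hσ z y).1 hzy, hcomp hz]
  · intro h
    obtain ⟨z, hz⟩ := exists_mem_closure_graphS hρ hσ h
    exact ⟨z, hz, (mem_graphSAdj_iff hρ hσ z y).2 fun i j => (h (i, j)).trans (hcomp hz i j).symm⟩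

end Modular

section Eigenbasis

theorem exists_hilbertBasis_mem {E α : Type*} [NormedAddCommGroup E] [InnerProductSpace ℂ E]
    [CompleteSpace E] {V : α → Submodule ℂ E} [∀ a, CompleteSpace (V a)]
    (hV : OrthogonalFamily ℂ (fun a => V a) fun a => (V a).subtypeₗᵢ) (htop : (⨆ a, V a)ᗮ = ⊥) :
    ∃ (w : ∀ a, Set (V a)) (u : HilbertBasis (Σ a, w a) ℂ E), ∀ i, u i ∈ V i.1 := by
  choose w b _ using fun a => exists_hilbertBasis ℂ (V a)
  have hon := hV.orthonormal_sigma_orthonormal fun a => (b a).orthonormal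
  refine ⟨w, HilbertBasis.mkOfOrthogonalEqBot hon ?_, fun i => by simp⟩
  rw [eq_bot_iff, ← htop, ← Submodule.iInf_orthogonal]
  refine fun x hx => (Submodule.mem_iInf _).2 fun a y hy => ?_
  have hzero : (innerSL ℂ x).comp (V a).subtypeL = 0 := hilbertBasis_clm_ext (b a) fun i =>
    (Submodule.mem_orthogonal' _ _).1 hx _ (Submodule.subset_span ⟨⟨a, i⟩, rfl⟩)
  exact inner_eq_zero_symm.1 (by simpa using DFunLike.congr_fun hzero ⟨y, hy⟩)

theorem exists_hilbertBasis_eigenvector {E : Type u} [NormedAddCommGroup E] [InnerProductSpace ℂ E]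
    [CompleteSpace E] {T : E →L[ℂ] E} (hT : IsCompactOperator T)
    (hsym : (T : E →ₗ[ℂ] E).IsSymmetric) :
    ∃ (ι : Type u) (u : HilbertBasis ι ℂ E) (l : ι → ℝ), ∀ i, T (u i) = (l i : ℂ) • u i := by
  have hcomplete (μ : ℂ) : CompleteSpace (Module.End.eigenspace (T : E →ₗ[ℂ] E) μ) := by
    have hset : (Module.End.eigenspace (T : E →ₗ[ℂ] E) μ : Set E) = {x | T x = μ • x} :=
      Set.ext fun x => Module.End.mem_eigenspace_iff
    have hclosed : IsClosed {x | T x = μ • x} := isClosed_eq (by fun_prop) (by fun_prop)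
    exact (hset ▸ hclosed).completeSpace_coe
  obtain ⟨w, u, hu⟩ := exists_hilbertBasis_mem hsym.orthogonalFamily_eigenspaces
    (ContinuousLinearMap.orthogonalComplement_iSup_eigenspaces_eq_bot hT hsym)
  refine ⟨_, u, fun i => i.1.re, fun i => ?_⟩
  have hreal : starRingEnd ℂ i.1 = i.1 := hsym.conj_eigenvalue_eq_self
    (Module.End.hasEigenvalue_of_hasEigenvector ⟨hu i, u.orthonormal.ne_zero i⟩)
  rw [Complex.conj_eq_iff_re.1 hreal]
  exact Module.End.mem_eigenspace_iff.1 (hu i)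

variable {K : Type u} [NormedAddCommGroup K] [InnerProductSpace ℂ K] [CompleteSpace K]

theorem HS.norm_op_le (T : HS K) : ‖T.op‖ ≤ ‖T‖ := by
  have hop : opOfL2 (basis K) (HS.toL2 K T) = T.op :=
    hilbertBasis_clm_ext (basis K) fun i => opOfL2_apply_basis _ _ i
  rw [← hop]
  exact (norm_opOfL2_le _ _).trans_eq (((HS.toL2 K).isometryOfInner fun _ _ => rfl).norm_map T)

/-- The embedding of the Hilbert-Schmidt operators in the bounded operators. -/
def HS.opCLM (K : Type u) [NormedAddCommGroup K] [InnerProductSpace ℂ K] [CompleteSpace K] :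
    HS K →L[ℂ] (K →L[ℂ] K) :=
  LinearMap.mkContinuous { toFun := HS.op, map_add' := HS.add_op, map_smul' := HS.smul_op } 1
    fun T => by rw [one_mul]; exact HS.norm_op_le T

theorem isCompactOperator_rankOneHS (x y : K) : IsCompactOperator (rankOneHS x y).op := by
  have h : IsCompactOperator (ContinuousLinearMap.toSpanSingleton ℂ x) :=
    isCompactOperator_of_locallyCompactSpace_rng _
  exact h.comp_clm (innerSL ℂ y)

theorem HS.isCompactOperator (T : HS K) : IsCompactOperator T.op := by
  have hsum := ((hsBasis (basis K) (basis K)).hasSum_repr T).mapL (HS.opCLM K)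
  refine isCompactOperator_of_tendsto hsum (Eventually.of_forall fun F => ?_)
  refine Submodule.sum_mem (compactOperator (RingHom.id ℂ) K K) ?_
  rintro ⟨i, j⟩ -
  rw [map_smul, hsBasis_apply]
  exact Submodule.smul_mem _ _ (isCompactOperator_rankOneHS _ _)

theorem State.isCompactOperator (ρ : State K) : IsCompactOperator ρ.op := by
  have hop : (ρ.op : K → K) = ρ.sqrtHS.op ∘ ρ.sqrtOp := funext fun x => (ρ.sqrtOp_sqrtOp x).symm
  rw [hop]
  exact ρ.sqrtHS.isCompactOperator.comp_clm ρ.sqrtOp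

theorem State.exists_isEigenbasis (ρ : State K) :
    ∃ (ι : Type u) (u : HilbertBasis ι ℂ K) (r : ι → ℝ), ρ.IsEigenbasis u r := by
  obtain ⟨ι, u, r, hu⟩ :=
    exists_hilbertBasis_eigenvector ρ.isCompactOperator ρ.isPositive.isSymmetric
  refine ⟨ι, u, r, fun i => ?_, hu⟩
  exact eigenvalue_nonneg_of_nonneg (Module.End.hasEigenvalue_of_hasEigenvector
    ⟨Module.End.mem_eigenspace_iff.2 (hu i), u.orthonormal.ne_zero i⟩)
    ρ.isPositive.re_inner_nonneg_right

end Eigenbasis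

section Overlaps

variable {K : Type u} [NormedAddCommGroup K] [InnerProductSpace ℂ K] [CompleteSpace K]
  {ρ σ : State K} {ι κ : Type*} {u : HilbertBasis ι ℂ K} {v : HilbertBasis κ ℂ K} {r : ι → ℝ}
  {s : κ → ℝ}

theorem State.norm_sqrtHS_sq (σ : State K) : ‖σ.sqrtHS‖ ^ 2 = 1 := by
  have hterm (i) : ⟪σ.sqrtHS.op (basis K i), σ.sqrtHS.op (basis K i)⟫_ℂ =
      ⟪basis K i, σ.op (basis K i)⟫_ℂ := by
    rw [← σ.sqrtOp_sqrtOp]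
    exact σ.inner_sqrtOp_left _ _
  have hinner : ⟪σ.sqrtHS, σ.sqrtHS⟫_ℂ = 1 := by
    simp only [HS.inner_eq, hterm, σ.hasSum_trace.tsum_eq]
  rw [inner_self_eq_norm_sq_to_K] at hinner
  exact Complex.ofReal_injective (by push_cast; exact hinner)

theorem norm_inner_hsBasis_left_sqrtHS_sq (hσ : σ.IsEigenbasis v s) (u : HilbertBasis ι ℂ K)
    (ω : κ × ι) :
    ‖⟪hsBasis v u ω, σ.sqrtHS⟫_ℂ‖ ^ 2 = s ω.1 * ‖⟪v ω.1, u ω.2⟫_ℂ‖ ^ 2 := by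
  have h : ⟪hsBasis v u ω, σ.sqrtHS⟫_ℂ = ((√(s ω.1) : ℝ) : ℂ) * ⟪v ω.1, u ω.2⟫_ℂ := by
    rw [← Prod.mk.eta (p := ω), inner_hsBasis, show σ.sqrtHS.op = σ.sqrtOp from rfl,
      ← σ.inner_sqrtOp_left, hσ.sqrtOp_apply, inner_smul_left, Complex.conj_ofReal]
  rw [h, norm_mul, mul_pow, Complex.norm_real, Real.norm_eq_abs, sq_abs, Real.sq_sqrt (hσ.nonneg _)]

theorem norm_inner_hsBasis_right_sqrtHS_sq (hσ : σ.IsEigenbasis v s) (u : HilbertBasis ι ℂ K)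
    (ω : ι × κ) :
    ‖⟪hsBasis u v ω, σ.sqrtHS⟫_ℂ‖ ^ 2 = s ω.2 * ‖⟪u ω.1, v ω.2⟫_ℂ‖ ^ 2 := by
  have h : ⟪hsBasis u v ω, σ.sqrtHS⟫_ℂ = ((√(s ω.2) : ℝ) : ℂ) * ⟪u ω.1, v ω.2⟫_ℂ := by
    rw [← Prod.mk.eta (p := ω), inner_hsBasis, show σ.sqrtHS.op = σ.sqrtOp from rfl,
      hσ.sqrtOp_apply, inner_smul_right]
  rw [h, norm_mul, mul_pow, Complex.norm_real, Real.norm_eq_abs, sq_abs, Real.sq_sqrt (hσ.nonneg _)]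

theorem hasSum_eigenvalue_mul_overlap (hσ : σ.IsEigenbasis v s) (u : HilbertBasis ι ℂ K) :
    HasSum (fun ω : ι × κ => s ω.2 * ‖⟪u ω.1, v ω.2⟫_ℂ‖ ^ 2) 1 := by
  rw [← σ.norm_sqrtHS_sq]
  simpa only [norm_inner_hsBasis_right_sqrtHS_sq hσ u] using
    hasSum_norm_inner_sq (hsBasis u v) σ.sqrtHS

theorem coordProj_hsBasis_sqrtHS_op (hρ : ρ.IsEigenbasis u r) (v : HilbertBasis κ ℂ K)
    (σ : State K) :
    (coordProj (hsBasis v u) {ω | r ω.2 = 0} σ.sqrtHS).op = σ.sqrtOp * (1 - ρ.supp) := by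
  refine hilbertBasis_clm_ext u fun i => hilbertBasis_ext v fun j => ?_
  rw [← inner_hsBasis, inner_coordProj, mul_apply_eq_comp, sub_apply, one_apply_eq_self]
  by_cases hr : r i = 0
  · rw [Set.indicator_of_mem (by exact hr), inner_hsBasis, hρ.supp_apply_of_eq_zero hr, sub_zero]
    rfl
  · rw [Set.indicator_of_notMem (by exact hr), hρ.supp_apply_of_ne_zero hr, sub_self, map_zero,
      inner_zero_right]

theorem hasSum_re_trace_mul_compl_supp (hρ : ρ.IsEigenbasis u r) (hσ : σ.IsEigenbasis v s) :
    HasSum ({ω : κ × ι | r ω.2 = 0}.indicator fun ω => s ω.1 * ‖⟪v ω.1, u ω.2⟫_ℂ‖ ^ 2)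
      (trace (σ.op * (1 - ρ.supp))).re := by
  have htrace : trace (σ.op * (1 - ρ.supp)) =
      ⟪σ.sqrtHS, coordProj (hsBasis v u) {ω | r ω.2 = 0} σ.sqrtHS⟫_ℂ := by
    rw [HS.inner_eq, coordProj_hsBasis_sqrtHS_op hρ v σ, trace]
    refine tsum_congr fun i => ?_
    rw [mul_apply_eq_comp, mul_apply_eq_comp, ← σ.sqrtOp_sqrtOp, ← σ.inner_sqrtOp_left]
    rfl
  rw [htrace]
  refine (Complex.hasSum_re ((hsBasis v u).hasSum_inner_mul_inner _ _)).congr_fun fun ω => ?_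
  rw [inner_coordProj]
  by_cases hr : r ω.2 = 0
  · rw [Set.indicator_of_mem (by exact hr), Set.indicator_of_mem (by exact hr),
      ← norm_inner_hsBasis_left_sqrtHS_sq hσ u, ← inner_conj_symm σ.sqrtHS,
      ← Complex.normSq_eq_conj_mul_self, Complex.ofReal_re, Complex.normSq_eq_norm_sq]
  · rw [Set.indicator_of_notMem (by exact hr), Set.indicator_of_notMem (by exact hr), mul_zero,
      Complex.zero_re]

theorem State.re_trace_mul_compl_supp_nonneg (ρ σ : State K) :
    0 ≤ (trace (σ.op * (1 - ρ.supp))).re := by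
  obtain ⟨ι, u, r, hρ⟩ := ρ.exists_isEigenbasis
  obtain ⟨κ, v, s, hσ⟩ := σ.exists_isEigenbasis
  refine (hasSum_re_trace_mul_compl_supp hρ hσ).nonneg fun ω => Set.indicator_nonneg ?_ ω
  exact fun ω _ => mul_nonneg (hσ.nonneg _) (sq_nonneg _)

theorem ofReal_re_trace_mul_compl_supp (hρ : ρ.IsEigenbasis u r) (hσ : σ.IsEigenbasis v s) :
    ENNReal.ofReal (trace (σ.op * (1 - ρ.supp))).re = ∑' ω : κ × ι,
      ENNReal.ofReal ({ω : κ × ι | r ω.2 = 0}.indicator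
        (fun ω => s ω.1 * ‖⟪v ω.1, u ω.2⟫_ℂ‖ ^ 2) ω) := by
  have h := hasSum_re_trace_mul_compl_supp hρ hσ
  rw [← h.tsum_eq, ENNReal.ofReal_tsum_of_nonneg _ h.summable]
  exact Set.indicator_nonneg fun ω _ => mul_nonneg (hσ.nonneg _) (sq_nonneg _)

theorem lintegral_modularMeasure (hρ : ρ.IsEigenbasis u r) (hσ : σ.IsEigenbasis v s)
    (F : ℝ → ℝ≥0∞) :
    ∫⁻ t in Ioi 0, F t ∂(modularMeasure ρ σ) = ∑' ω : ι × κ,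
      ENNReal.ofReal (s ω.2 * ‖⟪u ω.1, v ω.2⟫_ℂ‖ ^ 2) *
        (Ioi 0).indicator F (r ω.1 / s ω.2) := by
  rw [modularMeasure, spectralMeasure_measure _ _ (mem_modularGraph_iff hρ hσ),
    ← lintegral_indicator measurableSet_Ioi, lintegral_diagMeasure]
  simp only [norm_inner_hsBasis_right_sqrtHS_sq hσ u]

end Overlaps

/-- The law of a likelihood ratio `t = dP/dQ` of two probability measures: a measure on `(0, ∞)`,
the distribution of `t` under `Q` where `0 < t`, with the mass that `Q` puts on `t = 0` and the
mass that `P` puts on `t = ∞`. Both `Q` and `P = t Q` have total mass one. -/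
structure RatioLaw where
  /-- The distribution of the ratio on `(0, ∞)`. -/
  measure : Measure ℝ
  ae_pos : ∀ᵐ t ∂measure, 0 < t
  /-- The mass of `Q` at ratio `0`. -/
  zeroMass : ℝ≥0
  /-- The mass of `P` at ratio `∞`. -/
  topMass : ℝ≥0
  measure_univ_add : measure univ + zeroMass = 1
  lintegral_add : ∫⁻ t, ENNReal.ofReal t ∂measure + topMass = 1

section StateLaw

variable {K : Type u} [NormedAddCommGroup K] [InnerProductSpace ℂ K] [CompleteSpace K]

theorem tsum_ofReal_eigenvalue_mul_overlap {ι κ : Type*} {σ : State K} {v : HilbertBasis κ ℂ K}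
    {s : κ → ℝ} (hσ : σ.IsEigenbasis v s) (u : HilbertBasis ι ℂ K) :
    ∑' ω : ι × κ, ENNReal.ofReal (s ω.2 * ‖⟪u ω.1, v ω.2⟫_ℂ‖ ^ 2) = 1 := by
  have hsum := hasSum_eigenvalue_mul_overlap hσ u
  rw [← ENNReal.ofReal_tsum_of_nonneg (fun ω => mul_nonneg (hσ.nonneg _) (sq_nonneg _))
    hsum.summable, hsum.tsum_eq, ENNReal.ofReal_one]

theorem modularMeasure_Ioi_add (ρ σ : State K) :
    modularMeasure ρ σ (Ioi 0) + ENNReal.ofReal (trace (σ.op * (1 - ρ.supp))).re = 1 := by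
  obtain ⟨ι, u, r, hρ⟩ := ρ.exists_isEigenbasis
  obtain ⟨κ, v, s, hσ⟩ := σ.exists_isEigenbasis
  rw [← setLIntegral_one, lintegral_modularMeasure hρ hσ, ofReal_re_trace_mul_compl_supp hρ hσ,
    ← (Equiv.prodComm ι κ).tsum_eq, ← ENNReal.tsum_add]
  refine (tsum_congr fun ⟨i, j⟩ => ?_).trans (tsum_ofReal_eigenvalue_mul_overlap hσ u)
  simp only [Equiv.prodComm_apply, Prod.swap_prod_mk, Set.indicator_apply, mem_Ioi, mem_ofPred_eq,
    norm_inner_symm (v j)]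
  rcases (hρ.nonneg i).eq_or_lt with hr | hr
  · simp [← hr]
  rcases (hσ.nonneg j).eq_or_lt with hs | hs
  · simp [← hs]
  · simp [hr.ne', div_pos hr hs]

theorem lintegral_ofReal_modularMeasure_add (ρ σ : State K) :
    ∫⁻ t in Ioi 0, ENNReal.ofReal t ∂(modularMeasure ρ σ) +
      ENNReal.ofReal (trace (ρ.op * (1 - σ.supp))).re = 1 := by
  obtain ⟨ι, u, r, hρ⟩ := ρ.exists_isEigenbasis
  obtain ⟨κ, v, s, hσ⟩ := σ.exists_isEigenbasis
  rw [lintegral_modularMeasure hρ hσ, ofReal_re_trace_mul_compl_supp hσ hρ, ← ENNReal.tsum_add,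
    ← tsum_ofReal_eigenvalue_mul_overlap hρ v, ← (Equiv.prodComm ι κ).tsum_eq]
  refine tsum_congr fun ⟨i, j⟩ => ?_
  simp only [Equiv.prodComm_apply, Prod.swap_prod_mk, Set.indicator_apply, mem_Ioi, mem_ofPred_eq,
    norm_inner_symm (v j)]
  rcases (hρ.nonneg i).eq_or_lt with hr | hr
  · simp [← hr]
  rcases (hσ.nonneg j).eq_or_lt with hs | hs
  · simp [← hs]
  · rw [if_pos (div_pos hr hs), if_neg hs.ne', ENNReal.ofReal_zero, add_zero,
      ← ENNReal.ofReal_mul (by positivity)]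
    congr 1
    field_simp

theorem lintegral_modularMeasure_swap (ρ σ : State K) (F : ℝ → ℝ≥0∞) :
    ∫⁻ t in Ioi 0, F t ∂(modularMeasure σ ρ) =
      ∫⁻ t in Ioi 0, ENNReal.ofReal t * F t⁻¹ ∂(modularMeasure ρ σ) := by
  obtain ⟨ι, u, r, hρ⟩ := ρ.exists_isEigenbasis
  obtain ⟨κ, v, s, hσ⟩ := σ.exists_isEigenbasis
  rw [lintegral_modularMeasure hρ hσ, lintegral_modularMeasure hσ hρ,
    ← (Equiv.prodComm ι κ).tsum_eq]
  refine tsum_congr fun ⟨i, j⟩ => ?_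
  simp only [Equiv.prodComm_apply, Prod.swap_prod_mk, Set.indicator_apply, mem_Ioi,
    norm_inner_symm (v j)]
  rcases (hρ.nonneg i).eq_or_lt with hr | hr
  · simp [← hr]
  rcases (hσ.nonneg j).eq_or_lt with hs | hs
  · simp [← hs]
  · rw [if_pos (div_pos hr hs), if_pos (div_pos hs hr), inv_div, ← mul_assoc,
      ← ENNReal.ofReal_mul (by positivity)]
    congr 2
    field_simp

/-- The law of the ratio of two states, read off the relative modular operator. -/
def State.ratioLaw (ρ σ : State K) : RatioLaw where
  measure := (modularMeasure ρ σ).restrict (Ioi 0)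
  ae_pos := ae_restrict_mem measurableSet_Ioi
  zeroMass := ⟨(trace (σ.op * (1 - ρ.supp))).re, ρ.re_trace_mul_compl_supp_nonneg σ⟩
  topMass := ⟨(trace (ρ.op * (1 - σ.supp))).re, σ.re_trace_mul_compl_supp_nonneg ρ⟩
  measure_univ_add := by
    rw [Measure.restrict_apply_univ, ← modularMeasure_Ioi_add ρ σ, ENNReal.ofReal,
      Real.toNNReal_of_nonneg (ρ.re_trace_mul_compl_supp_nonneg σ)]
    rfl
  lintegral_add := by
    rw [← lintegral_ofReal_modularMeasure_add ρ σ, ENNReal.ofReal,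
      Real.toNNReal_of_nonneg (σ.re_trace_mul_compl_supp_nonneg ρ)]
    rfl

end StateLaw

/-- The value `f(0)` of a non-negative `f`, as a limit in `[0, ∞]`. -/
def atZero (f : ℝ → ℝ) : ℝ≥0∞ := limUnder (𝓝[>] (0 : ℝ)) fun t => ENNReal.ofReal (f t)

/-- The slope `f'(∞)` of a non-negative `f`, as a limit in `[0, ∞]`. -/
def slopeTop (f : ℝ → ℝ) : ℝ≥0∞ := limUnder atTop fun t : ℝ => ENNReal.ofReal (f t / t)

/-- The non-negative functions on `(0, ∞)` whose divergence is built from a continuous integrand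
and end values in `[0, ∞]`; convexity is not part of the notion, so that it is preserved by
`starConj` and by positive combinations with affine functions for elementary reasons. -/
structure IsGenerator (f : ℝ → ℝ) : Prop where
  continuousOn : ContinuousOn f (Ioi 0)
  nonneg : ∀ ⦃t⦄, 0 < t → 0 ≤ f t
  exists_atZero : ∃ a : ℝ≥0∞, Tendsto (fun t => ENNReal.ofReal (f t)) (𝓝[>] 0) (𝓝 a)
  exists_slopeTop : ∃ a : ℝ≥0∞, Tendsto (fun t => ENNReal.ofReal (f t / t)) atTop (𝓝 a)

/-- Csiszár's conjugate `t f(1/t)` of a generator: exchanging the two measures replaces `f` by its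
conjugate. -/
def starConj (f : ℝ → ℝ) (t : ℝ) : ℝ := t * f t⁻¹

section Generators

variable {f g : ℝ → ℝ}

theorem IsGenerator.tendsto_atZero (hf : IsGenerator f) :
    Tendsto (fun t => ENNReal.ofReal (f t)) (𝓝[>] 0) (𝓝 (atZero f)) :=
  tendsto_nhds_limUnder hf.exists_atZero

theorem IsGenerator.tendsto_slopeTop (hf : IsGenerator f) :
    Tendsto (fun t => ENNReal.ofReal (f t / t)) atTop (𝓝 (slopeTop f)) :=
  tendsto_nhds_limUnder hf.exists_slopeTop

theorem IsGenerator.tendsto_add_atZero (hf : IsGenerator f) (hg : IsGenerator g) :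
    Tendsto (fun t => ENNReal.ofReal (f t + g t)) (𝓝[>] 0) (𝓝 (atZero f + atZero g)) := by
  refine (hf.tendsto_atZero.add hg.tendsto_atZero).congr' ?_
  filter_upwards [self_mem_nhdsWithin] with t ht
  exact (ENNReal.ofReal_add (hf.nonneg ht) (hg.nonneg ht)).symm

theorem IsGenerator.tendsto_add_slopeTop (hf : IsGenerator f) (hg : IsGenerator g) :
    Tendsto (fun t => ENNReal.ofReal ((f t + g t) / t)) atTop
      (𝓝 (slopeTop f + slopeTop g)) := by
  refine (hf.tendsto_slopeTop.add hg.tendsto_slopeTop).congr' ?_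
  filter_upwards [eventually_gt_atTop 0] with t ht
  rw [add_div, ENNReal.ofReal_add (div_nonneg (hf.nonneg ht) ht.le)
    (div_nonneg (hg.nonneg ht) ht.le)]

theorem IsGenerator.add (hf : IsGenerator f) (hg : IsGenerator g) :
    IsGenerator fun t => f t + g t where
  continuousOn := hf.continuousOn.add hg.continuousOn
  nonneg _ ht := add_nonneg (hf.nonneg ht) (hg.nonneg ht)
  exists_atZero := ⟨_, hf.tendsto_add_atZero hg⟩
  exists_slopeTop := ⟨_, hf.tendsto_add_slopeTop hg⟩

theorem IsGenerator.tendsto_const_mul_atZero (hf : IsGenerator f) {c : ℝ} (hc : 0 ≤ c) :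
    Tendsto (fun t => ENNReal.ofReal (c * f t)) (𝓝[>] 0) (𝓝 (ENNReal.ofReal c * atZero f)) := by
  simp only [ENNReal.ofReal_mul hc]
  exact ENNReal.Tendsto.const_mul hf.tendsto_atZero (.inr ENNReal.ofReal_ne_top)

theorem IsGenerator.tendsto_const_mul_slopeTop (hf : IsGenerator f) {c : ℝ} (hc : 0 ≤ c) :
    Tendsto (fun t => ENNReal.ofReal (c * f t / t)) atTop
      (𝓝 (ENNReal.ofReal c * slopeTop f)) := by
  simp only [mul_div_assoc, ENNReal.ofReal_mul hc]
  exact ENNReal.Tendsto.const_mul hf.tendsto_slopeTop (.inr ENNReal.ofReal_ne_top)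

theorem IsGenerator.const_mul (hf : IsGenerator f) {c : ℝ} (hc : 0 ≤ c) :
    IsGenerator fun t => c * f t where
  continuousOn := hf.continuousOn.const_mul c
  nonneg _ ht := mul_nonneg hc (hf.nonneg ht)
  exists_atZero := ⟨_, hf.tendsto_const_mul_atZero hc⟩
  exists_slopeTop := ⟨_, hf.tendsto_const_mul_slopeTop hc⟩

theorem tendsto_affine_atZero (A B : ℝ) :
    Tendsto (fun t => A * t + B) (𝓝[>] 0) (𝓝 B) := by
  have h : Continuous fun t : ℝ => A * t + B := by fun_prop
  simpa using (h.tendsto 0).mono_left nhdsWithin_le_nhds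

theorem tendsto_affine_div_atTop (A B : ℝ) :
    Tendsto (fun t => (A * t + B) / t) atTop (𝓝 A) := by
  have h : Tendsto (fun t : ℝ => A + B * t⁻¹) atTop (𝓝 A) := by
    simpa using (tendsto_inv_atTop_zero.const_mul B).const_add A
  refine h.congr' ?_
  filter_upwards [eventually_ne_atTop 0] with t ht
  field_simp

theorem isGenerator_affine {A B : ℝ} (hA : 0 ≤ A) (hB : 0 ≤ B) :
    IsGenerator fun t => A * t + B where
  continuousOn := by fun_prop
  nonneg t ht := by positivity
  exists_atZero := ⟨_, ENNReal.tendsto_ofReal (tendsto_affine_atZero A B)⟩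
  exists_slopeTop := ⟨_, ENNReal.tendsto_ofReal (tendsto_affine_div_atTop A B)⟩

theorem IsGenerator.tendsto_starConj_atZero (hf : IsGenerator f) :
    Tendsto (fun t => ENNReal.ofReal (starConj f t)) (𝓝[>] 0) (𝓝 (slopeTop f)) := by
  refine (hf.tendsto_slopeTop.comp tendsto_inv_nhdsGT_zero).congr fun t => ?_
  rw [Function.comp_apply, starConj, div_inv_eq_mul, mul_comm]

theorem IsGenerator.tendsto_starConj_slopeTop (hf : IsGenerator f) :
    Tendsto (fun t => ENNReal.ofReal (starConj f t / t)) atTop (𝓝 (atZero f)) := by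
  refine (hf.tendsto_atZero.comp tendsto_inv_atTop_nhdsGT_zero).congr' ?_
  filter_upwards [eventually_ne_atTop 0] with t ht
  rw [Function.comp_apply, starConj, mul_div_cancel_left₀ _ ht]

theorem IsGenerator.starConj (hf : IsGenerator f) : IsGenerator (starConj f) where
  continuousOn := continuousOn_id.mul (hf.continuousOn.comp
    (continuousOn_inv₀.mono fun _ ht => (mem_Ioi.1 ht).ne') fun _ ht => inv_pos.2 (mem_Ioi.1 ht))
  nonneg _ ht := mul_nonneg ht.le (hf.nonneg (inv_pos.2 ht))
  exists_atZero := ⟨_, hf.tendsto_starConj_atZero⟩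
  exists_slopeTop := ⟨_, hf.tendsto_starConj_slopeTop⟩

theorem map_mul_add_le_of_convexOn (hf : ConvexOn ℝ (Ioi 0) f) (h1 : f 1 = 0) {a t : ℝ}
    (ha0 : 0 ≤ a) (ha1 : a ≤ 1) (ht : 0 < t) : f (a * t + (1 - a)) ≤ a * f t := by
  simpa [h1] using hf.2 (mem_Ioi.2 ht) (mem_Ioi.2 one_pos) ha0 (sub_nonneg.2 ha1) (by ring)

theorem antitoneOn_of_convexOn (hf : ConvexOn ℝ (Ioi 0) f) (h0 : ∀ t, 0 < t → 0 ≤ f t)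
    (h1 : f 1 = 0) : AntitoneOn f (Ioo 0 1) := by
  intro s hs t ht hst
  have hpos : 0 < 1 - s := sub_pos.2 hs.2
  have hle : (1 - t) / (1 - s) ≤ 1 := (div_le_one hpos).2 (by linarith)
  have hmap := map_mul_add_le_of_convexOn hf h1 (div_nonneg (sub_nonneg.2 ht.2.le) hpos.le) hle hs.1
  have ht_eq : (1 - t) / (1 - s) * s + (1 - (1 - t) / (1 - s)) = t := by
    field_simp
    ring
  rw [ht_eq] at hmap
  exact hmap.trans (mul_le_of_le_one_left (h0 s hs.1) hle)

theorem monotoneOn_div_self_of_convexOn (hf : ConvexOn ℝ (Ioi 0) f) (h0 : ∀ t, 0 < t → 0 ≤ f t)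
    (h1 : f 1 = 0) : MonotoneOn (fun t => f t / t) (Ioi 1) := by
  intro s hs t ht hst
  have hs0 : 0 < s := one_pos.trans hs
  have ht0 : 0 < t := one_pos.trans ht
  have hpos : 0 < t - 1 := sub_pos.2 ht
  have hle : (s - 1) / (t - 1) ≤ s / t := by
    rw [div_le_div_iff₀ hpos ht0]
    linarith
  have hmap := map_mul_add_le_of_convexOn hf h1 (div_nonneg (sub_nonneg.2 (le_of_lt hs)) hpos.le)
    ((div_le_one hpos).2 (by linarith)) ht0
  have hs_eq : (s - 1) / (t - 1) * t + (1 - (s - 1) / (t - 1)) = s := by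
    field_simp
    ring
  rw [hs_eq] at hmap
  rw [div_le_iff₀ hs0, div_mul_eq_mul_div, mul_comm, mul_div_right_comm]
  exact hmap.trans (mul_le_mul_of_nonneg_right hle (h0 t ht0))

theorem isGenerator_of_convexOn (hf : ConvexOn ℝ (Ioi 0) f) (h0 : ∀ t, 0 < t → 0 ≤ f t)
    (h1 : f 1 = 0) : IsGenerator f where
  continuousOn := hf.continuousOn isOpen_Ioi
  nonneg := h0
  exists_atZero := ⟨_, AntitoneOn.tendsto_nhdsWithin_Ioo_right (nonempty_Ioo.2 one_pos)
    (ENNReal.ofReal_mono.comp_antitoneOn (antitoneOn_of_convexOn hf h0 h1)) (OrderTop.bddAbove _)⟩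
  exists_slopeTop := by
    have hmono : Monotone fun t : ℝ => ENNReal.ofReal (f (max t 2) / max t 2) := fun s t hst =>
      ENNReal.ofReal_le_ofReal (monotoneOn_div_self_of_convexOn hf h0 h1
        (one_lt_two.trans_le (le_max_right s 2)) (one_lt_two.trans_le (le_max_right t 2))
        (max_le_max_right 2 hst))
    refine ⟨_, (tendsto_atTop_iSup hmono).congr' ?_⟩
    filter_upwards [eventually_ge_atTop 2] with t ht
    rw [max_eq_left ht]

theorem tendsto_coe_add_coe {α : Type*} {l : Filter α} {u w : α → ℝ} {a : ℝ≥0∞} {b : ℝ}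
    (hu : Tendsto (fun t => ENNReal.ofReal (u t)) l (𝓝 a)) (hu0 : ∀ᶠ t in l, 0 ≤ u t)
    (hw : Tendsto w l (𝓝 b)) :
    Tendsto (fun t => ((u t + w t : ℝ) : EReal)) l (𝓝 (a + b)) := by
  have hadd : ContinuousAt (fun p : EReal × EReal => p.1 + p.2) (a, b) :=
    EReal.continuousAt_add (.inr (EReal.coe_ne_bot b)) (.inr (EReal.coe_ne_top b))
  refine (hadd.tendsto.comp (((continuous_coe_ennreal_ereal.tendsto a).comp hu).prodMk_nhds
    ((continuous_coe_real_ereal.tendsto b).comp hw))).congr' (hu0.mono fun t ht => ?_)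
  simp [max_eq_left ht]

theorem limZero_eq_add (hg : IsGenerator g) {A B : ℝ}
    (h : ∀ t, 0 < t → f t = g t + (A * t + B)) : limZero f = atZero g + B := by
  have hpos : ∀ᶠ t : ℝ in 𝓝[>] 0, 0 < t := self_mem_nhdsWithin
  exact ((tendsto_coe_add_coe hg.tendsto_atZero (hpos.mono hg.nonneg)
    (tendsto_affine_atZero A B)).congr' (hpos.mono fun t ht => by rw [h t ht])).limUnder_eq

theorem slopeInfty_eq_add (hg : IsGenerator g) {A B : ℝ}
    (h : ∀ t, 0 < t → f t = g t + (A * t + B)) : slopeInfty f = slopeTop g + A := by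
  have hpos := eventually_gt_atTop (0 : ℝ)
  exact ((tendsto_coe_add_coe hg.tendsto_slopeTop
    (hpos.mono fun t ht => div_nonneg (hg.nonneg ht) ht.le) (tendsto_affine_div_atTop A B)).congr'
    (hpos.mono fun t ht => by rw [h t ht, add_div (g t)])).limUnder_eq

end Generators

theorem le_add_sub_of_add_ofReal_le {x y : ℝ≥0∞} {p q : ℝ} (hp : 0 ≤ p) (hq : 0 ≤ q)
    (h : x + ENNReal.ofReal q ≤ y + ENNReal.ofReal p) : (x : EReal) ≤ y + (p - q : ℝ) := by
  have h' : (x : EReal) + q ≤ y + p := by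
    simpa only [EReal.coe_ennreal_add, EReal.coe_ennreal_ofReal, max_eq_left hp, max_eq_left hq]
      using EReal.coe_ennreal_le_coe_ennreal_iff.2 h
  rw [EReal.coe_sub, sub_eq_add_neg, ← add_assoc, ← sub_eq_add_neg]
  exact (EReal.le_sub_iff_add_le (.inl (EReal.coe_ne_bot q)) (.inl (EReal.coe_ne_top q))).2 h'

theorem coe_sub_coe_of_add_eq_add {x y z p q : ℝ≥0∞} (hy : y ≠ ⊤) (hp : p ≠ ⊤) (hq : q ≠ ⊤)
    (h : x + q = y + (z + p)) : (x : EReal) - y = z + (p.toReal - q.toReal : ℝ) := by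
  lift y to ℝ≥0 using hy
  lift p to ℝ≥0 using hp
  lift q to ℝ≥0 using hq
  induction z with
  | top =>
    have hx : x = ⊤ := by simpa using h
    rw [hx, EReal.coe_ennreal_top, EReal.top_add_coe]
    exact EReal.top_sub_coe y
  | coe z =>
    lift x to ℝ≥0 using ne_top_of_le_ne_top (by simp) (h ▸ le_self_add : x ≤ y + (z + p))
    have h' : (x : ℝ) + q = y + (z + p) := by exact_mod_cast h
    have hreal : (x : ℝ) - y = z + (p - q) := by linarith
    simp only [ENNReal.coe_toReal, EReal.coe_nnreal_eq_coe_real]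
    exact_mod_cast hreal

theorem ofReal_add_add_ofReal_neg {a b : ℝ} (ha : 0 ≤ a) :
    ENNReal.ofReal (a + b) + ENNReal.ofReal (-b) =
      ENNReal.ofReal (-(a + b)) + (ENNReal.ofReal a + ENNReal.ofReal b) := by
  rcases le_total 0 b with hb | hb
  · rw [ENNReal.ofReal_add ha hb, ENNReal.ofReal_of_nonpos (neg_nonpos.2 hb),
      ENNReal.ofReal_of_nonpos (neg_nonpos.2 (add_nonneg ha hb)), add_zero, zero_add]
  · rw [ENNReal.ofReal_of_nonpos hb, add_zero]
    rcases le_total 0 (a + b) with hab | hab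
    · rw [ENNReal.ofReal_of_nonpos (neg_nonpos.2 hab), zero_add,
        ← ENNReal.ofReal_add hab (neg_nonneg.2 hb), add_neg_cancel_right]
    · rw [ENNReal.ofReal_of_nonpos hab, zero_add, ← ENNReal.ofReal_add (neg_nonneg.2 hab) ha]
      congr 1
      ring

theorem coe_ennreal_ofReal_mul {c : ℝ} (hc : 0 ≤ c) (x : ℝ≥0∞) :
    ((ENNReal.ofReal c * x : ℝ≥0∞) : EReal) = (c : EReal) * x := by
  rw [EReal.coe_ennreal_mul, EReal.coe_ennreal_ofReal, max_eq_left hc]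

theorem extIntegral_add {μ : Measure ℝ} {g h : ℝ → ℝ} (hg0 : ∀ᵐ t ∂μ, 0 ≤ g t)
    (hg : AEMeasurable (fun t => ENNReal.ofReal (g t)) μ) (hh : Integrable h μ) :
    extIntegral μ (fun t => g t + h t) =
      ((∫⁻ t, ENNReal.ofReal (g t) ∂μ : ℝ≥0∞) : EReal) + (∫ t, h t ∂μ : ℝ) := by
  have hneg : ∫⁻ t, ENNReal.ofReal (-h t) ∂μ ≠ ⊤ := hh.neg.lintegral_lt_top.ne
  have hle : ∫⁻ t, ENNReal.ofReal (-(g t + h t)) ∂μ ≤ ∫⁻ t, ENNReal.ofReal (-h t) ∂μ :=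
    lintegral_mono_ae (hg0.mono fun t ht => ENNReal.ofReal_le_ofReal (by linarith))
  have hsum : ∫⁻ t, ENNReal.ofReal (g t + h t) ∂μ + ∫⁻ t, ENNReal.ofReal (-h t) ∂μ =
      ∫⁻ t, ENNReal.ofReal (-(g t + h t)) ∂μ +
        (∫⁻ t, ENNReal.ofReal (g t) ∂μ + ∫⁻ t, ENNReal.ofReal (h t) ∂μ) := by
    have hh' := hh.1.aemeasurable
    rw [← lintegral_add_right' _ (by exact hh'.neg.ennreal_ofReal), ← lintegral_add_left' hg,
      ← lintegral_add_right' _ (by exact hg.add hh'.ennreal_ofReal)]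
    exact lintegral_congr_ae (hg0.mono fun t ht => ofReal_add_add_ofReal_neg ht)
  rw [extIntegral, integral_eq_lintegral_pos_part_sub_lintegral_neg_part hh]
  exact coe_sub_coe_of_add_eq_add (ne_top_of_le_ne_top hneg hle) hh.lintegral_lt_top.ne hneg hsum

namespace RatioLaw

variable (ℓ : RatioLaw) {f g : ℝ → ℝ}

/-- The divergence of a law of ratios for a generator, with values in `[0, ∞]`. -/
def div (f : ℝ → ℝ) : ℝ≥0∞ :=
  ∫⁻ t, ENNReal.ofReal (f t) ∂ℓ.measure + atZero f * ℓ.zeroMass + slopeTop f * ℓ.topMass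

theorem aemeasurable_ofReal (hf : IsGenerator f) :
    AEMeasurable (fun t => ENNReal.ofReal (f t)) ℓ.measure := by
  have h := (hf.continuousOn.aemeasurable (μ := ℓ.measure) measurableSet_Ioi).ennreal_ofReal
  have hrestrict : ℓ.measure.restrict (Ioi 0) = ℓ.measure :=
    Measure.restrict_eq_self_of_ae_mem ℓ.ae_pos
  rwa [hrestrict] at h

theorem div_mono (hf : IsGenerator f) (hg : IsGenerator g) (h : ∀ t, 0 < t → f t ≤ g t) :
    ℓ.div f ≤ ℓ.div g := by
  have hint : ∫⁻ t, ENNReal.ofReal (f t) ∂ℓ.measure ≤ ∫⁻ t, ENNReal.ofReal (g t) ∂ℓ.measure :=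
    lintegral_mono_ae (ℓ.ae_pos.mono fun t ht => ENNReal.ofReal_le_ofReal (h t ht))
  have hzero : atZero f ≤ atZero g := by
    refine le_of_tendsto_of_tendsto hf.tendsto_atZero hg.tendsto_atZero ?_
    filter_upwards [self_mem_nhdsWithin] with t ht
    exact ENNReal.ofReal_le_ofReal (h t ht)
  have hslope : slopeTop f ≤ slopeTop g := by
    refine le_of_tendsto_of_tendsto hf.tendsto_slopeTop hg.tendsto_slopeTop ?_
    filter_upwards [eventually_gt_atTop 0] with t ht
    exact ENNReal.ofReal_le_ofReal (div_le_div_of_nonneg_right (h t ht) ht.le)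
  rw [div, div]
  gcongr

theorem div_add (hf : IsGenerator f) (hg : IsGenerator g) :
    ℓ.div (fun t => f t + g t) = ℓ.div f + ℓ.div g := by
  have hint : ∫⁻ t, ENNReal.ofReal (f t + g t) ∂ℓ.measure =
      ∫⁻ t, ENNReal.ofReal (f t) ∂ℓ.measure + ∫⁻ t, ENNReal.ofReal (g t) ∂ℓ.measure := by
    rw [← lintegral_add_left' (ℓ.aemeasurable_ofReal hf)]
    exact lintegral_congr_ae (ℓ.ae_pos.mono fun t ht =>
      ENNReal.ofReal_add (hf.nonneg ht) (hg.nonneg ht))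
  have hzero : atZero (fun t => f t + g t) = atZero f + atZero g :=
    (hf.tendsto_add_atZero hg).limUnder_eq
  have hslope : slopeTop (fun t => f t + g t) = slopeTop f + slopeTop g :=
    (hf.tendsto_add_slopeTop hg).limUnder_eq
  rw [div, div, div, hint, hzero, hslope]
  ring

theorem div_const_mul (hf : IsGenerator f) {c : ℝ} (hc : 0 ≤ c) :
    ℓ.div (fun t => c * f t) = ENNReal.ofReal c * ℓ.div f := by
  have hzero : atZero (fun t => c * f t) = ENNReal.ofReal c * atZero f :=
    (hf.tendsto_const_mul_atZero hc).limUnder_eq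
  have hslope : slopeTop (fun t => c * f t) = ENNReal.ofReal c * slopeTop f :=
    (hf.tendsto_const_mul_slopeTop hc).limUnder_eq
  simp only [div, hzero, hslope, ENNReal.ofReal_mul hc]
  rw [lintegral_const_mul' _ _ ENNReal.ofReal_ne_top]
  ring

theorem lintegral_affine {A B : ℝ} (hA : 0 ≤ A) (hB : 0 ≤ B) :
    ∫⁻ t, ENNReal.ofReal (A * t + B) ∂ℓ.measure =
      ENNReal.ofReal A * ∫⁻ t, ENNReal.ofReal t ∂ℓ.measure +
        ENNReal.ofReal B * ℓ.measure univ := by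
  rw [← lintegral_const, ← lintegral_const_mul' _ _ ENNReal.ofReal_ne_top,
    ← lintegral_add_right _ measurable_const]
  refine lintegral_congr_ae (ℓ.ae_pos.mono fun t ht => ?_)
  beta_reduce
  rw [ENNReal.ofReal_add (by positivity) hB, ENNReal.ofReal_mul hA]

theorem div_affine {A B : ℝ} (hA : 0 ≤ A) (hB : 0 ≤ B) :
    ℓ.div (fun t => A * t + B) = ENNReal.ofReal (A + B) := by
  have hzero : atZero (fun t => A * t + B) = ENNReal.ofReal B :=
    (ENNReal.tendsto_ofReal (tendsto_affine_atZero A B)).limUnder_eq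
  have hslope : slopeTop (fun t => A * t + B) = ENNReal.ofReal A :=
    (ENNReal.tendsto_ofReal (tendsto_affine_div_atTop A B)).limUnder_eq
  calc ℓ.div (fun t => A * t + B)
      = ENNReal.ofReal A * (∫⁻ t, ENNReal.ofReal t ∂ℓ.measure + ℓ.topMass) +
          ENNReal.ofReal B * (ℓ.measure univ + ℓ.zeroMass) := by
        rw [div, hzero, hslope, ℓ.lintegral_affine hA hB]
        ring
    _ = ENNReal.ofReal (A + B) := by
        rw [ℓ.lintegral_add, ℓ.measure_univ_add, mul_one, mul_one, ENNReal.ofReal_add hA hB]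

theorem div_le_div_add (hf : IsGenerator f) (hg : IsGenerator g) {A B : ℝ}
    (h : ∀ t, 0 < t → f t ≤ g t + (A * t + B)) :
    (ℓ.div f : EReal) ≤ ℓ.div g + (A + B : ℝ) := by
  have hle := ℓ.div_mono (hf.add (isGenerator_affine (le_max_right (-A) 0) (le_max_right (-B) 0)))
    (hg.add (isGenerator_affine (le_max_right A 0) (le_max_right B 0))) fun t ht => by
      have hA : A = max A 0 - max (-A) 0 := (max_zero_sub_eq_self A).symm
      have hB : B = max B 0 - max (-B) 0 := (max_zero_sub_eq_self B).symm
      have ht' := h t ht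
      rw [hA, hB] at ht'
      linarith
  rw [ℓ.div_add hf (isGenerator_affine (le_max_right (-A) 0) (le_max_right (-B) 0)),
    ℓ.div_add hg (isGenerator_affine (le_max_right A 0) (le_max_right B 0)),
    ℓ.div_affine (le_max_right _ _) (le_max_right _ _),
    ℓ.div_affine (le_max_right _ _) (le_max_right _ _)] at hle
  have hAB : A + B = max A 0 + max B 0 - (max (-A) 0 + max (-B) 0) := by
    linarith [max_zero_sub_eq_self A, max_zero_sub_eq_self B]
  rw [hAB]
  exact le_add_sub_of_add_ofReal_le (by positivity) (by positivity) hle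

theorem coe_div_const_mul (hf : IsGenerator f) {c : ℝ} (hc : 0 ≤ c) {n : ℝ≥0}
    (hn : ℓ.div f = n) : (ℓ.div (fun t => c * f t) : EReal) = (c * n : ℝ) := by
  rw [ℓ.div_const_mul hf hc, hn, coe_ennreal_ofReal_mul hc, EReal.coe_nnreal_eq_coe_real,
    EReal.coe_mul]

theorem div_le_coe (hf : IsGenerator f) (hg : IsGenerator g) {A B c : ℝ} (hc : 0 ≤ c) {n : ℝ≥0}
    (hn : ℓ.div g = n) (h : ∀ t, 0 < t → f t ≤ c * g t + (A * t + B)) :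
    (ℓ.div f : EReal) ≤ (c * n + (A + B) : ℝ) := by
  rw [EReal.coe_add, ← ℓ.coe_div_const_mul hg hc hn]
  exact ℓ.div_le_div_add hf (hg.const_mul hc) h

theorem coe_le_div (hf : IsGenerator f) (hg : IsGenerator g) {A B c : ℝ} (hc : 0 ≤ c) {n : ℝ≥0}
    (hn : ℓ.div f = n) (h : ∀ t, 0 < t → c * f t ≤ g t + (A * t + B)) :
    ((c * n - (A + B) : ℝ) : EReal) ≤ ℓ.div g := by
  rw [EReal.coe_sub, ← ℓ.coe_div_const_mul hf hc hn]
  exact EReal.sub_le_of_le_add (ℓ.div_le_div_add (hf.const_mul hc) hg h)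

theorem integrable_id : Integrable (fun t => t) ℓ.measure := by
  refine (lintegral_ofReal_ne_top_iff_integrable aestronglyMeasurable_id
    (ℓ.ae_pos.mono fun t ht => ht.le)).1 (ne_top_of_le_ne_top ENNReal.one_ne_top ?_)
  exact ℓ.lintegral_add ▸ le_self_add

instance : IsFiniteMeasure ℓ.measure :=
  ⟨(ℓ.measure_univ_add ▸ le_self_add : ℓ.measure univ ≤ 1).trans_lt ENNReal.one_lt_top⟩

theorem integral_id_add : ∫ t, t ∂ℓ.measure + ℓ.topMass = 1 := by
  have h := congrArg ENNReal.toReal ℓ.lintegral_add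
  rwa [ENNReal.toReal_add (ℓ.integrable_id.lintegral_lt_top.ne) ENNReal.coe_ne_top,
    ← integral_eq_lintegral_of_nonneg_ae (ℓ.ae_pos.mono fun t ht => ht.le)
      aestronglyMeasurable_id] at h

theorem measureReal_univ_add : ℓ.measure.real univ + ℓ.zeroMass = 1 := by
  have h := congrArg ENNReal.toReal ℓ.measure_univ_add
  rwa [ENNReal.toReal_add (measure_ne_top _ _) ENNReal.coe_ne_top] at h

theorem integral_affine (A B : ℝ) : ∫ t, (A * t + B) ∂ℓ.measure =
    A * ∫ t, t ∂ℓ.measure + B * ℓ.measure.real univ := by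
  rw [integral_add (ℓ.integrable_id.const_mul A) (integrable_const B), integral_const_mul,
    integral_const, smul_eq_mul, mul_comm B]

/-- The divergence of a law of ratios for an arbitrary `f`, with values in `[-∞, ∞]`. -/
def fDiv (f : ℝ → ℝ) : EReal :=
  extIntegral ℓ.measure f + limZero f * ((ℓ.zeroMass : ℝ) : EReal) +
    slopeInfty f * ((ℓ.topMass : ℝ) : EReal)

theorem fDiv_eq (hg : IsGenerator g) {A B : ℝ} (h : ∀ t, 0 < t → f t = g t + (A * t + B)) :
    ℓ.fDiv f = (ℓ.div g : EReal) + (A + B : ℝ) := by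
  have hint : extIntegral ℓ.measure f =
      ((∫⁻ t, ENNReal.ofReal (g t) ∂ℓ.measure : ℝ≥0∞) : EReal) +
        (A * ∫ t, t ∂ℓ.measure + B * ℓ.measure.real univ : ℝ) := by
    have hcongr : f =ᵐ[ℓ.measure] fun t => g t + (A * t + B) := ℓ.ae_pos.mono h
    rw [← ℓ.integral_affine, ← extIntegral_add (ℓ.ae_pos.mono hg.nonneg)
      (ℓ.aemeasurable_ofReal hg) (by exact (ℓ.integrable_id.const_mul A).add (integrable_const B)),
      extIntegral, extIntegral]
    congr 2
    · exact lintegral_congr_ae (hcongr.fun_comp ENNReal.ofReal)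
    · exact lintegral_congr_ae (hcongr.fun_comp fun y => ENNReal.ofReal (-y))
  have hAB : A * ∫ t, t ∂ℓ.measure + B * ℓ.measure.real univ + B * ℓ.zeroMass + A * ℓ.topMass =
      A + B := by
    linear_combination A * ℓ.integral_id_add + B * ℓ.measureReal_univ_add
  rw [fDiv, hint, limZero_eq_add hg h, slopeInfty_eq_add hg h, div, ← hAB]
  have hzero := EReal.right_distrib_of_nonneg_of_ne_top
    (EReal.coe_nonneg.2 ℓ.zeroMass.coe_nonneg) (EReal.coe_ne_top _) (atZero g) B
  have htop := EReal.right_distrib_of_nonneg_of_ne_top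
    (EReal.coe_nonneg.2 ℓ.topMass.coe_nonneg) (EReal.coe_ne_top _) (slopeTop g) A
  simp only [hzero, htop, EReal.coe_ennreal_add, EReal.coe_ennreal_mul, EReal.coe_add,
    EReal.coe_mul, EReal.coe_nnreal_eq_coe_real]
  ac_rfl

end RatioLaw

/-- The generator `(t - 1)²` of the `χ²`-divergence. -/
def chiSqFun (t : ℝ) : ℝ := (t - 1) ^ 2

/-- The generator `|t - 1|` of the total variation. -/
def totalVarFun (t : ℝ) : ℝ := |t - 1|

/-- The generator `(√t - 1)² / 2` of the squared Hellinger distance. -/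
def hellingerFun (t : ℝ) : ℝ := 1 / 2 * (√t - 1) ^ 2

/-- The generator of the Hellinger `α`-divergence, normalized by an affine function that vanishes
at `1` so as to have its minimum `0` there. -/
def powerFun (α t : ℝ) : ℝ := (t ^ α - 1 - α * (t - 1)) / (α - 1)

section Generators

theorem isGenerator_klFun : IsGenerator klFun :=
  isGenerator_of_convexOn convexOn_Ioi_klFun (fun _ ht => klFun_nonneg ht.le) klFun_one

theorem isGenerator_chiSqFun : IsGenerator chiSqFun := by
  refine isGenerator_of_convexOn ?_ (fun _ _ => sq_nonneg _) (by norm_num [chiSqFun])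
  have h := ((even_two.convexOn_pow (𝕜 := ℝ)).translate_left (-1)).subset
    (subset_univ (Ioi 0)) (convex_Ioi 0)
  exact h.congr fun t _ => congrArg (· ^ 2) (sub_eq_add_neg t 1).symm

theorem isGenerator_totalVarFun : IsGenerator totalVarFun := by
  refine isGenerator_of_convexOn ?_ (fun _ _ => abs_nonneg _) (by norm_num [totalVarFun])
  exact (convexOn_dist (1 : ℝ) (convex_Ioi 0)).congr fun t _ => Real.dist_eq t 1

theorem atZero_totalVarFun : atZero totalVarFun = 1 := by
  have hcont : Continuous totalVarFun := (continuous_id.sub continuous_const).abs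
  have h : Tendsto totalVarFun (𝓝[>] 0) (𝓝 (totalVarFun 0)) :=
    (hcont.tendsto 0).mono_left nhdsWithin_le_nhds
  exact (ENNReal.tendsto_ofReal h).limUnder_eq.trans (by simp [totalVarFun])

theorem slopeTop_totalVarFun : slopeTop totalVarFun = 1 := by
  have h := (ENNReal.tendsto_ofReal (tendsto_affine_div_atTop 1 (-1))).congr' <| by
    filter_upwards [eventually_ge_atTop 1] with t ht
    rw [one_mul, ← sub_eq_add_neg, ← abs_of_nonneg (sub_nonneg.2 ht), ← totalVarFun]
  exact h.limUnder_eq.trans ENNReal.ofReal_one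

theorem two_mul_hellingerFun {t : ℝ} (ht : 0 ≤ t) : 2 * hellingerFun t = t + 1 - 2 * √t := by
  rw [hellingerFun, sub_sq, Real.sq_sqrt ht]
  ring

theorem isGenerator_hellingerFun : IsGenerator hellingerFun := by
  refine isGenerator_of_convexOn ?_ (fun _ _ => by unfold hellingerFun; positivity)
    (by norm_num [hellingerFun])
  have hsqrt : ConcaveOn ℝ (Ioi 0) Real.sqrt :=
    Real.strictConcaveOn_sqrt.concaveOn.subset Ioi_subset_Ici_self (convex_Ioi 0)
  have haff : ConvexOn ℝ (Ioi (0 : ℝ)) fun t => (1 / 2 : ℝ) • (t + 1) :=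
    ((convexOn_id (convex_Ioi 0)).add_const 1).smul (by norm_num)
  refine (haff.sub hsqrt).congr fun t ht => ?_
  have h := two_mul_hellingerFun (mem_Ioi.1 ht).le
  simp only [Pi.sub_apply, smul_eq_mul]
  linarith

theorem convexOn_powerFun {α : ℝ} (h0 : 0 < α) (h1 : α ≠ 1) : ConvexOn ℝ (Ioi 0) (powerFun α) := by
  have haff : ConvexOn ℝ (Ioi (0 : ℝ)) fun t => -(1 + α * (t - 1)) / (α - 1) := by
    refine ⟨convex_Ioi 0, fun s _ t _ a b _ _ hab => le_of_eq ?_⟩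
    simp only [smul_eq_mul]
    linear_combination (1 - α) / (α - 1) * hab
  have hpow : ConvexOn ℝ (Ioi (0 : ℝ)) fun t => (α - 1)⁻¹ • t ^ α := by
    rcases h1.lt_or_gt with h1 | h1
    · have h := ((Real.concaveOn_rpow h0.le h1.le).subset Ioi_subset_Ici_self
        (convex_Ioi 0)).neg.smul (inv_nonneg.2 (sub_nonneg.2 h1.le))
      refine h.congr fun t _ => ?_
      simp only [Pi.neg_apply]
      rw [smul_neg, ← neg_smul, ← inv_neg, neg_sub]
    · exact ((convexOn_rpow h1.le).subset Ioi_subset_Ici_self (convex_Ioi 0)).smul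
        (inv_nonneg.2 (sub_nonneg.2 h1.le))
  refine (hpow.add haff).congr fun t _ => ?_
  rw [Pi.add_apply, powerFun, smul_eq_mul, inv_mul_eq_div, ← add_div]
  ring

theorem powerFun_nonneg {α t : ℝ} (h0 : 0 < α) (h1 : α ≠ 1) (ht : 0 < t) : 0 ≤ powerFun α t := by
  have hs : -1 ≤ t - 1 := by linarith
  rcases h1.lt_or_gt with h1 | h1
  · have h := rpow_one_add_le_one_add_mul_self hs h0.le h1.le
    rw [add_sub_cancel] at h
    exact div_nonneg_of_nonpos (by linarith) (by linarith)
  · have h := one_add_mul_self_le_rpow_one_add hs h1.le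
    rw [add_sub_cancel] at h
    exact div_nonneg (by linarith) (by linarith)

theorem isGenerator_powerFun {α : ℝ} (h0 : 0 < α) (h1 : α ≠ 1) : IsGenerator (powerFun α) :=
  isGenerator_of_convexOn (convexOn_powerFun h0 h1) (fun _ ht => powerFun_nonneg h0 h1 ht)
    (by simp [powerFun])

theorem isGenerator_rpow {α : ℝ} (h0 : 0 < α) (h1 : α < 1) : IsGenerator fun t => t ^ α where
  continuousOn := continuousOn_id.rpow_const fun _ ht => .inl (mem_Ioi.1 ht).ne'
  nonneg _ ht := Real.rpow_nonneg ht.le α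
  exists_atZero := ⟨_, ENNReal.tendsto_ofReal
    (((Real.continuous_rpow_const h0.le).tendsto 0).mono_left nhdsWithin_le_nhds)⟩
  exists_slopeTop := by
    refine ⟨_, ENNReal.tendsto_ofReal
      ((tendsto_rpow_neg_atTop (sub_pos.2 h1)).congr' ?_)⟩
    filter_upwards [eventually_gt_atTop 0] with t ht
    rw [neg_sub, Real.rpow_sub_one ht.ne']

theorem powerFun_two (t : ℝ) : powerFun 2 t = chiSqFun t := by
  rw [powerFun, chiSqFun, Real.rpow_two]
  ring

theorem rpow_eq_powerFun {α : ℝ} (h1 : α ≠ 1) (t : ℝ) :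
    t ^ α = (α - 1) * powerFun α t + 1 + α * (t - 1) := by
  rw [powerFun, mul_div_cancel₀ _ (sub_ne_zero.2 h1)]
  ring

theorem starConj_klFun {t : ℝ} (ht : 0 < t) : starConj klFun t = t - 1 - Real.log t := by
  rw [starConj, klFun_apply, Real.log_inv]
  field_simp
  ring

theorem starConj_chiSqFun {t : ℝ} (ht : 0 < t) : starConj chiSqFun t = (t - 1) ^ 2 / t := by
  rw [starConj, chiSqFun]
  field_simp
  ring

end Generators

section OneVariable

variable {t : ℝ}

theorem klFun_le_chiSqFun (ht : 0 < t) : klFun t ≤ chiSqFun t := by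
  have h := mul_le_mul_of_nonneg_left (Real.log_le_sub_one_of_pos ht) ht.le
  rw [klFun_apply, chiSqFun]
  linarith

theorem log_le_two_mul_sqrt_sub_two (ht : 0 < t) : Real.log t ≤ 2 * √t - 2 := by
  have h := Real.log_le_sub_one_of_pos (Real.sqrt_pos.2 ht)
  rw [Real.log_sqrt ht.le] at h
  linarith

theorem two_mul_hellingerFun_le_starConj_klFun (ht : 0 < t) :
    2 * hellingerFun t ≤ starConj klFun t := by
  rw [two_mul_hellingerFun ht.le, starConj_klFun ht]
  linarith [log_le_two_mul_sqrt_sub_two ht]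

theorem two_mul_hellingerFun_le_klFun (ht : 0 < t) : 2 * hellingerFun t ≤ klFun t := by
  have hlog := mul_le_mul_of_nonneg_left (log_le_two_mul_sqrt_sub_two (inv_pos.2 ht)) ht.le
  have hsqrt : t * √t⁻¹ = √t := by
    rw [Real.sqrt_inv, ← div_eq_mul_inv, Real.div_sqrt]
  rw [Real.log_inv] at hlog
  rw [two_mul_hellingerFun ht.le, klFun_apply]
  linarith

theorem hellingerFun_le_half_totalVarFun (ht : 0 < t) :
    hellingerFun t ≤ 1 / 2 * totalVarFun t := by
  have hfac : t - 1 = (√t - 1) * (√t + 1) := by linarith [Real.mul_self_sqrt ht.le]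
  have habs : |√t - 1| ≤ √t + 1 := abs_le.2 ⟨by linarith [Real.sqrt_nonneg t], by linarith⟩
  rw [hellingerFun, totalVarFun, hfac, abs_mul, abs_of_nonneg (by positivity : 0 ≤ √t + 1),
    ← sq_abs, sq]
  gcongr

theorem totalVarFun_le_hellingerFun (c : ℝ) (ht : 0 < t) :
    c * totalVarFun t ≤ (c ^ 2 - 1) * hellingerFun t + (1 * t + 1) := by
  have hfac : t - 1 = (√t - 1) * (√t + 1) := by linarith [Real.mul_self_sqrt ht.le]
  have hsum : 1 * t + 1 - hellingerFun t = 1 / 2 * (√t + 1) ^ 2 := by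
    rw [hellingerFun]
    linarith [Real.mul_self_sqrt ht.le]
  have hsq := two_mul_le_add_sq (c * |√t - 1|) (√t + 1)
  rw [mul_pow, sq_abs] at hsq
  have habs : totalVarFun t = |√t - 1| * (√t + 1) := by
    rw [totalVarFun, hfac, abs_mul, abs_of_nonneg (by positivity : 0 ≤ √t + 1)]
  rw [habs]
  have hH : c ^ 2 * hellingerFun t = 1 / 2 * (c ^ 2 * (√t - 1) ^ 2) := by
    rw [hellingerFun]
    ring
  linarith

theorem klFun_le_totalVarFun_add_chiSqFun (ht : 0 < t) :
    klFun t ≤ 1 / 2 * (totalVarFun t + chiSqFun t) := by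
  rw [klFun_apply, totalVarFun, chiSqFun]
  rcases le_total t 1 with h | h
  · rw [abs_of_nonpos (sub_nonpos.2 h)]
    nlinarith [mul_le_mul_of_nonneg_left (Real.log_le_sub_one_of_pos ht) ht.le,
      mul_nonneg ht.le (sub_nonneg.2 h)]
  · rw [abs_of_nonneg (sub_nonneg.2 h)]
    have hlog := mul_le_mul_of_nonneg_left (log_le_two_mul_sqrt_sub_two ht) ht.le
    have hs : 1 ≤ √t := Real.one_le_sqrt.2 h
    have hst : √t ^ 2 = t := Real.sq_sqrt ht.le
    generalize √t = s at hlog hs hst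
    subst hst
    have hcubic : 0 ≤ s ^ 3 / 2 - 3 / 2 * s ^ 2 + s + 1 := by
      nlinarith [mul_nonneg (zero_le_one.trans hs) (sq_nonneg (s - 3 / 2)), sq_nonneg (s - 2)]
    linear_combination hlog + mul_nonneg (sub_nonneg.2 hs) hcubic

theorem mul_log_le_rpow (γ : ℝ) {r : ℝ} (hr : 0 < r) (ht : 0 < t) :
    (γ - 1) * (t * Real.log t) ≤ t ^ γ / r + (Real.log r - 1) * t := by
  have hpow : 0 < t ^ (γ - 1) := Real.rpow_pos_of_pos ht _
  have hlog := mul_le_mul_of_nonneg_left (Real.log_le_sub_one_of_pos (div_pos hpow hr)) ht.le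
  rw [Real.log_div hpow.ne' hr.ne', Real.log_rpow ht, Real.rpow_sub_one ht.ne'] at hlog
  have hcancel : t * (t ^ γ / t / r - 1) = t ^ γ / r - t := by field_simp
  linarith

theorem sq_le_rpow {α m : ℝ} (hα : 2 ≤ α) (hm : 0 < m) (ht : 0 < t) :
    (α - 1) * t ^ 2 ≤ t ^ α * m ^ (2 - α) + (α - 2) * m * t := by
  have hb := one_add_mul_self_le_rpow_one_add (s := t / m - 1) (by linarith [div_pos ht hm])
    (by linarith : 1 ≤ α - 1)
  have hmul := mul_le_mul_of_nonneg_left hb (mul_pos ht hm).le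
  have hpow : t * m * (1 + (t / m - 1)) ^ (α - 1) = t ^ α * m ^ (2 - α) := by
    rw [add_sub_cancel, Real.div_rpow ht.le hm.le, Real.rpow_sub_one ht.ne',
      Real.rpow_sub_one hm.ne', Real.rpow_sub hm, Real.rpow_two]
    field_simp
  have hlin : t * m * (1 + (α - 1) * (t / m - 1)) = (α - 1) * t ^ 2 - (α - 2) * m * t := by
    field_simp
    ring
  linarith

theorem klFun_le_powerFun {β r : ℝ} (hβ : 1 < β) (hr : 0 < r) (ht : 0 < t) :
    klFun t ≤ r⁻¹ * powerFun β t + ((β / r + Real.log r - β) / (β - 1) * t + (1 - r⁻¹)) := by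
  have hβ' : 0 < β - 1 := sub_pos.2 hβ
  have h := mul_log_le_rpow β hr ht
  rw [rpow_eq_powerFun hβ.ne', ← mul_le_mul_iff_right₀ (inv_pos.2 hβ')] at h
  rw [klFun_apply]
  refine le_of_sub_nonneg ((sub_nonneg.2 h).trans_eq ?_)
  field_simp
  ring

theorem powerFun_le_klFun {α r : ℝ} (hα : α < 1) (hr : 0 < r) (ht : 0 < t) :
    r⁻¹ * powerFun α t ≤ klFun t + ((α / r + Real.log r - α) / (1 - α) * t + (r⁻¹ - 1)) := by
  have hα' : 0 < 1 - α := sub_pos.2 hα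
  have h := mul_log_le_rpow α hr ht
  rw [rpow_eq_powerFun hα.ne, ← mul_le_mul_iff_right₀ (inv_pos.2 hα')] at h
  rw [klFun_apply]
  refine le_of_sub_nonneg ((sub_nonneg.2 h).trans_eq ?_)
  field_simp
  ring

theorem chiSqFun_le_powerFun {α m : ℝ} (hα : 2 ≤ α) (hm : 0 < m) (ht : 0 < t) :
    chiSqFun t ≤ m ^ (2 - α) * powerFun α t +
      ((α * m ^ (2 - α) + (α - 2) * m - 2 * (α - 1)) / (α - 1) * t + (1 - m ^ (2 - α))) := by
  have hα' : 0 < α - 1 := by linarith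
  have h := sq_le_rpow hα hm ht
  rw [rpow_eq_powerFun (sub_pos.1 hα').ne', ← mul_le_mul_iff_right₀ (inv_pos.2 hα')] at h
  rw [chiSqFun]
  refine le_of_sub_nonneg ((sub_nonneg.2 h).trans_eq ?_)
  field_simp
  ring

theorem two_mul_totalVarFun_le_chiSqFun (c t : ℝ) :
    2 * c * totalVarFun t ≤ chiSqFun t + (0 * t + c ^ 2) := by
  rw [totalVarFun, chiSqFun, ← sq_abs (t - 1)]
  linarith [sq_nonneg (|t - 1| - c)]

theorem totalVarFun_le_chiSqFun {c : ℝ} (hc : 2 ≤ c) (ht : 0 < t) :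
    c ^ 2 / 2 * totalVarFun t ≤ chiSqFun t + ((c ^ 2 / 2 + 2 - 2 * c) * t + (c ^ 2 / 2 - 1)) := by
  rw [totalVarFun, chiSqFun]
  rcases le_total 1 t with h | h
  · rw [abs_of_nonneg (sub_nonneg.2 h)]
    nlinarith [sq_nonneg (t - c)]
  · rw [abs_of_nonpos (sub_nonpos.2 h)]
    nlinarith [sq_nonneg t, mul_nonneg ht.le (by nlinarith : 0 ≤ c ^ 2 - 2 * c)]

theorem klFun_add_starConj (ht : 0 < t) :
    klFun t + starConj klFun t = (t - 1) * Real.log t := by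
  rw [starConj_klFun ht, klFun_apply]
  ring

theorem sub_one_mul_log_ge {k : ℝ} (hk : 0 < k) (ht : 0 < t) :
    (Real.log k + (k ^ 2 - 1) / (2 * k)) * (t - 1) ≤
      (t - 1) * Real.log t + (k - 1) ^ 2 / (2 * k) * (t + 1) := by
  have hupper := Real.log_le_sub_one_of_pos (div_pos ht hk)
  have hlower := mul_le_mul_of_nonneg_left (Real.one_sub_inv_le_log_of_pos (div_pos ht hk)) ht.le
  rw [Real.log_div ht.ne' hk.ne'] at hupper hlower
  have hcancel : t * (1 - (t / k)⁻¹) = t - k := by field_simp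
  have hcoeff : (k ^ 2 - 1) / (2 * k) * (t - 1) =
      t - k - (t / k - 1) + (k - 1) ^ 2 / (2 * k) * (t + 1) := by
    field_simp
    ring
  linarith

theorem totalVarFun_le_klFun_add_starConj {k : ℝ} (hk : 0 < k) (ht : 0 < t) :
    (Real.log k + (k ^ 2 - 1) / (2 * k)) * totalVarFun t ≤ klFun t + starConj klFun t +
      ((k - 1) ^ 2 / (2 * k) * t + (k - 1) ^ 2 / (2 * k)) := by
  rw [klFun_add_starConj ht, totalVarFun]
  rcases le_total 1 t with h | h
  · rw [abs_of_nonneg (sub_nonneg.2 h)]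
    linarith [sub_one_mul_log_ge hk ht]
  · rw [abs_of_nonpos (sub_nonpos.2 h)]
    have hinv := mul_le_mul_of_nonneg_left (sub_one_mul_log_ge hk (inv_pos.2 ht)) ht.le
    have hcancel : t * t⁻¹ = 1 := mul_inv_cancel₀ ht.ne'
    rw [Real.log_inv] at hinv
    linear_combination hinv - (Real.log k + (k ^ 2 - 1) / (2 * k) + Real.log t -
      (k - 1) ^ 2 / (2 * k)) * hcancel

theorem totalVarFun_le_chiSqFun_add_starConj {w : ℝ} (hw : w ^ 2 < 1) (ht : 0 < t) :
    8 * w / (1 - w ^ 2) ^ 2 * totalVarFun t ≤ chiSqFun t + starConj chiSqFun t +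
      (4 * w ^ 2 * (1 + w ^ 2) / (1 - w ^ 2) ^ 2 * t +
        4 * w ^ 2 * (1 + w ^ 2) / (1 - w ^ 2) ^ 2) := by
  have hd : totalVarFun t ^ 2 = (t - 1) ^ 2 := sq_abs _
  have hw' : 1 - w ^ 2 ≠ 0 := by linarith
  have hsum : 0 ≤ (t + 1) ^ 3 / t * (1 - 4 * t / (1 - w ^ 2) / (t + 1) ^ 2) ^ 2 +
      4 / (1 - w ^ 2) ^ 2 * (totalVarFun t - w * (t + 1)) ^ 2 / (t + 1) := by positivity
  rw [starConj_chiSqFun ht, chiSqFun, ← sub_nonneg]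
  refine hsum.trans_eq ?_
  field_simp
  linear_combination 4 * t * hd

theorem nonneg_of_deriv2_nonneg {k k' k'' : ℝ → ℝ} (h1 : ∀ s, 0 < s → HasDerivAt k (k' s) s)
    (h2 : ∀ s, 0 < s → HasDerivAt k' (k'' s) s) (h3 : ∀ s, 0 ≤ k'' s) (hk : k 1 = 0)
    (hk' : k' 1 = 0) (ht : 0 < t) : 0 ≤ k t := by
  have hconv : ConvexOn ℝ (Ioi 0) k :=
    convexOn_of_hasDerivWithinAt2_nonneg (convex_Ioi 0)
      (fun s hs => (h1 s hs).continuousAt.continuousWithinAt)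
      (fun s hs => (h1 s (interior_subset hs)).hasDerivWithinAt)
      (fun s hs => (h2 s (interior_subset hs)).hasDerivWithinAt) (fun s _ => h3 s)
  have hmin : IsMinOn k (Ioi 0) 1 := by
    refine hconv.isMinOn_of_rightDeriv_eq_zero ?_ ?_
    · rw [interior_Ioi]
      exact mem_Ioi.2 one_pos
    · rw [(h1 1 one_pos).hasDerivWithinAt.derivWithin (uniqueDiffWithinAt_Ioi 1), hk']
  exact hk ▸ hmin (mem_Ioi.2 ht)

theorem two_mul_klFun_le (c : ℝ) (ht : 0 < t) :
    2 * c * klFun t ≤ starConj klFun t + c ^ 2 * (1 / 2 * chiSqFun t) := by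
  rw [starConj_klFun ht, klFun_apply, chiSqFun, ← sub_nonneg]
  refine nonneg_of_deriv2_nonneg
    (k := fun s => s - 1 - Real.log s + c ^ 2 * (1 / 2 * (s - 1) ^ 2) -
      2 * c * (s * Real.log s + 1 - s))
    (k' := fun s => 1 - s⁻¹ + c ^ 2 * (s - 1) - 2 * c * Real.log s)
    (k'' := fun s => (s⁻¹ - c) ^ 2) (fun s hs => ?_) (fun s hs => ?_) (fun s => sq_nonneg _)
    (by simp) (by simp) ht
  · have hid := hasDerivAt_id s
    have hlog := Real.hasDerivAt_log hs.ne'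
    refine ((((hid.sub_const 1).sub hlog).add
      ((((hid.sub_const 1).pow 2).const_mul (1 / 2)).const_mul (c ^ 2))).sub
      ((((hid.mul hlog).add_const 1).sub hid).const_mul (2 * c))).congr_deriv ?_
    simp only [id]
    field_simp
    ring
  · refine ((((hasDerivAt_inv hs.ne').const_sub 1).add
      (((hasDerivAt_id s).sub_const 1).const_mul (c ^ 2))).sub
      ((Real.hasDerivAt_log hs.ne').const_mul (2 * c))).congr_deriv ?_
    field_simp
    ring

theorem two_mul_hellingerFun_le (c : ℝ) (ht : 0 < t) :
    2 * c * (4 * hellingerFun t) ≤ klFun t + c ^ 2 * starConj klFun t := by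
  have hH : 4 * hellingerFun t = 2 * t + 2 - 4 * √t := by linarith [two_mul_hellingerFun ht.le]
  rw [starConj_klFun ht, klFun_apply, hH, ← sub_nonneg]
  refine nonneg_of_deriv2_nonneg
    (k := fun s => s * Real.log s + 1 - s + c ^ 2 * (s - 1 - Real.log s) -
      2 * c * (2 * s + 2 - 4 * √s))
    (k' := fun s => Real.log s + c ^ 2 * (1 - s⁻¹) - 2 * c * (2 - 2 * (√s)⁻¹))
    (k'' := fun s => ((√s)⁻¹ - c * s⁻¹) ^ 2) (fun s hs => ?_) (fun s hs => ?_)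
    (fun s => sq_nonneg _) (by norm_num) (by norm_num) ht
  · have hid := hasDerivAt_id s
    have hlog := Real.hasDerivAt_log hs.ne'
    refine (((((hid.mul hlog).add_const 1).sub hid).add
      (((hid.sub_const 1).sub hlog).const_mul (c ^ 2))).sub
      ((((hid.const_mul 2).add_const 2).sub
        ((Real.hasDerivAt_sqrt hs.ne').const_mul 4)).const_mul (2 * c))).congr_deriv ?_
    have hs' := (Real.sqrt_pos.2 hs).ne'
    simp only [id]
    field_simp
    ring
  · have hs' := Real.sqrt_pos.2 hs
    refine (((Real.hasDerivAt_log hs.ne').add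
      (((hasDerivAt_inv hs.ne').const_sub 1).const_mul (c ^ 2))).sub
      (((((Real.hasDerivAt_sqrt hs.ne').inv hs'.ne').const_mul 2).const_sub 2).const_mul
        (2 * c))).congr_deriv ?_
    have hsq : √s ^ 2 = s := Real.sq_sqrt hs.le
    generalize √s = r at hs' hsq
    subst hsq
    field_simp
    ring

end OneVariable

namespace RatioLaw

variable (ℓ : RatioLaw)

section Finite

theorem div_totalVarFun_le : ℓ.div totalVarFun ≤ 2 := by
  refine (ℓ.div_mono isGenerator_totalVarFun (isGenerator_affine zero_le_one zero_le_one)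
    fun t ht => ?_).trans_eq (by rw [ℓ.div_affine zero_le_one zero_le_one]; norm_num)
  rw [totalVarFun, abs_le]
  constructor <;> linarith

theorem div_hellingerFun_le : ℓ.div hellingerFun ≤ 1 := by
  have hhalf : (0 : ℝ) ≤ 1 / 2 := by norm_num
  refine (ℓ.div_mono isGenerator_hellingerFun (isGenerator_affine hhalf hhalf)
    fun t ht => ?_).trans_eq (by rw [ℓ.div_affine hhalf hhalf]; norm_num)
  linarith [two_mul_hellingerFun ht.le, Real.sqrt_nonneg t]

/-- The total variation `∫ |t - 1|` of a law of ratios, which is at most `2`. -/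
def totalVar : ℝ≥0 := (ℓ.div totalVarFun).toNNReal

/-- The squared Hellinger distance of a law of ratios, which is at most `1`. -/
def hellingerSq : ℝ≥0 := (ℓ.div hellingerFun).toNNReal

theorem div_totalVarFun : ℓ.div totalVarFun = ℓ.totalVar :=
  (ENNReal.coe_toNNReal (ne_top_of_le_ne_top (by norm_num) ℓ.div_totalVarFun_le)).symm

theorem div_hellingerFun : ℓ.div hellingerFun = ℓ.hellingerSq :=
  (ENNReal.coe_toNNReal (ne_top_of_le_ne_top (by norm_num) ℓ.div_hellingerFun_le)).symm

theorem totalVar_le_two : ℓ.totalVar ≤ 2 := by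
  exact_mod_cast ℓ.div_totalVarFun ▸ ℓ.div_totalVarFun_le

theorem hellingerSq_le_one : ℓ.hellingerSq ≤ 1 := by
  exact_mod_cast ℓ.div_hellingerFun ▸ ℓ.div_hellingerFun_le

theorem hellingerSq_le_half_totalVar : (ℓ.hellingerSq : ℝ) ≤ ℓ.totalVar / 2 := by
  have h := ℓ.div_mono isGenerator_hellingerFun (isGenerator_totalVarFun.const_mul (by norm_num))
    fun t ht => hellingerFun_le_half_totalVarFun ht
  rw [← EReal.coe_ennreal_le_coe_ennreal_iff, ℓ.coe_div_const_mul isGenerator_totalVarFun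
    (by norm_num) ℓ.div_totalVarFun, ℓ.div_hellingerFun, EReal.coe_nnreal_eq_coe_real,
    EReal.coe_le_coe_iff] at h
  linarith

theorem mul_totalVar_le {c : ℝ} (hc : 1 ≤ c) :
    c * ℓ.totalVar ≤ (c ^ 2 - 1) * ℓ.hellingerSq + 2 := by
  have hc' : 0 ≤ c ^ 2 - 1 := sub_nonneg.2 (one_le_pow₀ hc)
  have h := ℓ.coe_le_div isGenerator_totalVarFun (isGenerator_hellingerFun.const_mul hc')
    (zero_le_one.trans hc) ℓ.div_totalVarFun fun t ht => totalVarFun_le_hellingerFun c ht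
  rw [ℓ.coe_div_const_mul isGenerator_hellingerFun hc' ℓ.div_hellingerFun,
    EReal.coe_le_coe_iff] at h
  linarith

theorem half_totalVar_le :
    (ℓ.totalVar / 2 : ℝ) ≤ √ℓ.hellingerSq * √(2 - ℓ.hellingerSq) := by
  have hle := ℓ.hellingerSq_le_half_totalVar
  have hkey := fun c hc => ℓ.mul_totalVar_le (c := c) hc
  have hv : (0 : ℝ) ≤ ℓ.totalVar := ℓ.totalVar.coe_nonneg
  have hh : (0 : ℝ) ≤ ℓ.hellingerSq := ℓ.hellingerSq.coe_nonneg
  generalize (ℓ.totalVar : ℝ) = v at *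
  generalize (ℓ.hellingerSq : ℝ) = h at *
  rw [← Real.sqrt_mul hh]
  refine Real.le_sqrt_of_sq_le ?_
  rcases hh.eq_or_lt with rfl | hpos
  · have hlarge := hkey (max 1 (3 / v)) (le_max_left _ _)
    rcases hv.eq_or_lt with rfl | hv'
    · norm_num
    · have h3 : 3 ≤ max 1 (3 / v) * v := (div_le_iff₀ hv').1 (le_max_right _ _)
      linarith
  · have hopt := hkey (v / (2 * h)) ((one_le_div (by linarith)).2 (by linarith))
    field_simp at hopt
    linarith

end Finite

section Renyi

theorem one_add_ofReal_mul_coe {c : ℝ} (hc : 0 ≤ c) (n : ℝ≥0) :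
    1 + ENNReal.ofReal c * n = ENNReal.ofReal (1 + c * n) := by
  rw [← ENNReal.ofReal_coe_nnreal, ← ENNReal.ofReal_mul hc, ← ENNReal.ofReal_one,
    ← ENNReal.ofReal_add zero_le_one (by positivity)]

theorem div_klFun_le_log {β : ℝ} (hβ : 1 < β) :
    (ℓ.div klFun : EReal) ≤ ((β - 1)⁻¹ : ℝ) *
      ENNReal.log (1 + ENNReal.ofReal (β - 1) * ℓ.div (powerFun β)) := by
  have hβ' : 0 < β - 1 := sub_pos.2 hβ
  rcases eq_or_ne (ℓ.div (powerFun β)) ⊤ with htop | hfin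
  · rw [htop, ENNReal.mul_top (by simpa using hβ), add_top, ENNReal.log_top,
      EReal.coe_mul_top_of_pos (inv_pos.2 hβ')]
    exact le_top
  · lift ℓ.div (powerFun β) to ℝ≥0 using hfin with n hn
    have hr : 0 < 1 + (β - 1) * (n : ℝ) := by positivity
    refine (ℓ.div_le_coe isGenerator_klFun (isGenerator_powerFun (by linarith) hβ.ne')
      (inv_nonneg.2 hr.le) hn.symm fun t ht => klFun_le_powerFun hβ hr ht).trans_eq ?_
    rw [one_add_ofReal_mul_coe hβ'.le, ENNReal.log_ofReal_of_pos hr, ← EReal.coe_mul]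
    congr 1
    field_simp
    ring

theorem log_le_div_powerFun {β : ℝ} (hβ : 1 < β) :
    ((β - 1)⁻¹ : ℝ) * ENNReal.log (1 + ENNReal.ofReal (β - 1) * ℓ.div (powerFun β)) ≤
      (ℓ.div (powerFun β) : EReal) := by
  have hβ' : 0 < β - 1 := sub_pos.2 hβ
  rcases eq_or_ne (ℓ.div (powerFun β)) ⊤ with htop | hfin
  · rw [htop]
    exact le_top
  · lift ℓ.div (powerFun β) to ℝ≥0 using hfin with n hn
    have hr : 0 < 1 + (β - 1) * (n : ℝ) := by positivity
    rw [one_add_ofReal_mul_coe hβ'.le, ENNReal.log_ofReal_of_pos hr, ← EReal.coe_mul,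
      EReal.coe_nnreal_eq_coe_real, EReal.coe_le_coe_iff, inv_mul_le_iff₀ hβ']
    linarith [Real.log_le_sub_one_of_pos hr]

theorem div_rpow_add {α : ℝ} (h0 : 0 < α) (h1 : α < 1) :
    ℓ.div (fun t => t ^ α) + ENNReal.ofReal (1 - α) * ℓ.div (powerFun α) = 1 := by
  have hgen := isGenerator_powerFun h0 h1.ne
  have h1' : 0 ≤ 1 - α := sub_nonneg.2 h1.le
  have haff : (fun t => t ^ α + (1 - α) * powerFun α t) = fun t => α * t + (1 - α) := by
    funext t
    linear_combination rpow_eq_powerFun h1.ne t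
  rw [← ℓ.div_const_mul hgen h1', ← ℓ.div_add (isGenerator_rpow h0 h1) (hgen.const_mul h1'), haff,
    ℓ.div_affine h0.le h1', add_sub_cancel, ENNReal.ofReal_one]

theorem exists_div_powerFun_eq {α : ℝ} (h0 : 0 < α) (h1 : α < 1) :
    ∃ n p : ℝ≥0, ℓ.div (powerFun α) = n ∧ ℓ.div (fun t => t ^ α) = p ∧ p + (1 - α) * n = 1 := by
  have hsum := ℓ.div_rpow_add h0 h1
  have hne : ENNReal.ofReal (1 - α) ≠ 0 := by simpa using h1
  have hp : ℓ.div (fun t => t ^ α) ≠ ⊤ := fun h => by simp [h] at hsum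
  have hn : ℓ.div (powerFun α) ≠ ⊤ := fun h => by simp [h, ENNReal.mul_top hne] at hsum
  lift ℓ.div (powerFun α) to ℝ≥0 using hn with n
  lift ℓ.div (fun t => t ^ α) to ℝ≥0 using hp with p
  refine ⟨n, p, rfl, rfl, ?_⟩
  have hreal := congrArg ENNReal.toReal hsum
  rwa [ENNReal.toReal_add ENNReal.coe_ne_top (ENNReal.mul_ne_top ENNReal.ofReal_ne_top
    ENNReal.coe_ne_top), ENNReal.toReal_mul, ENNReal.toReal_ofReal (sub_nonneg.2 h1.le)] at hreal

theorem div_powerFun_le_log {α : ℝ} (h0 : 0 < α) (h1 : α < 1) :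
    (ℓ.div (powerFun α) : EReal) ≤ ((α - 1)⁻¹ : ℝ) * ENNReal.log (ℓ.div fun t => t ^ α) := by
  obtain ⟨n, p, hn, hp, hsum⟩ := ℓ.exists_div_powerFun_eq h0 h1
  have hneg : (α - 1)⁻¹ < 0 := inv_lt_zero.2 (sub_neg.2 h1)
  rcases eq_zero_or_pos p with rfl | hpos
  · rw [hp, ENNReal.coe_zero, ENNReal.log_zero, EReal.coe_mul_bot_of_neg hneg]
    exact le_top
  · rw [hn, hp, ← ENNReal.ofReal_coe_nnreal (p := p),
      ENNReal.log_ofReal_of_pos (NNReal.coe_pos.2 hpos), ← EReal.coe_mul,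
      EReal.coe_nnreal_eq_coe_real, EReal.coe_le_coe_iff]
    have hlog := Real.log_le_sub_one_of_pos (NNReal.coe_pos.2 hpos)
    refine (mul_le_mul_of_nonpos_left hlog hneg.le).trans_eq' ?_
    rw [eq_sub_of_add_eq hsum, inv_mul_eq_iff_eq_mul₀ (sub_neg.2 h1).ne]
    ring

theorem coe_le_div_klFun {α r : ℝ} (h0 : 0 < α) (h1 : α < 1) (hr : 0 < r) {p : ℝ≥0}
    (hp : ℓ.div (fun t => t ^ α) = p) :
    (((1 - p / r - Real.log r) / (1 - α) : ℝ) : EReal) ≤ ℓ.div klFun := by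
  obtain ⟨n, q, hn, hq, hsum⟩ := ℓ.exists_div_powerFun_eq h0 h1
  obtain rfl : q = p := ENNReal.coe_injective (hq.symm.trans hp)
  refine (EReal.coe_le_coe_iff.2 (le_of_eq ?_)).trans (ℓ.coe_le_div (isGenerator_powerFun h0 h1.ne)
    isGenerator_klFun (inv_nonneg.2 hr.le) hn fun t ht => powerFun_le_klFun h1 hr ht)
  have h1' : 1 - α ≠ 0 := (sub_pos.2 h1).ne'
  rw [eq_sub_of_add_eq hsum]
  field_simp
  ring

theorem log_le_div_klFun {α : ℝ} (h0 : 0 < α) (h1 : α < 1) :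
    ((α - 1)⁻¹ : ℝ) * ENNReal.log (ℓ.div fun t => t ^ α) ≤ (ℓ.div klFun : EReal) := by
  obtain ⟨-, p, -, hp, -⟩ := ℓ.exists_div_powerFun_eq h0 h1
  rcases eq_zero_or_pos p with rfl | hpos
  · have htop : (ℓ.div klFun : EReal) = ⊤ := by
      refine EReal.eq_top_iff_forall_lt _ |>.2 fun y => ?_
      have h := ℓ.coe_le_div_klFun h0 h1 (Real.exp_pos (-(1 - α) * y)) hp
      refine lt_of_lt_of_le (EReal.coe_lt_coe_iff.2 ?_) h
      rw [Real.log_exp, lt_div_iff₀ (sub_pos.2 h1), NNReal.coe_zero, zero_div]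
      linarith
    rw [htop]
    exact le_top
  · have h := ℓ.coe_le_div_klFun h0 h1 (r := p) (NNReal.coe_pos.2 hpos) hp
    refine h.trans_eq' ?_
    rw [hp, ← ENNReal.ofReal_coe_nnreal (p := p), ENNReal.log_ofReal_of_pos (NNReal.coe_pos.2 hpos),
      ← EReal.coe_mul, div_self (NNReal.coe_ne_zero.2 hpos.ne'), sub_self, zero_sub, neg_div,
      ← div_neg, neg_sub, inv_mul_eq_div]

theorem div_chiSqFun_add_one_le {α : ℝ} (hα : 2 < α) :
    ℓ.div chiSqFun + 1 ≤ (1 + ENNReal.ofReal (α - 1) * ℓ.div (powerFun α)) ^ (1 / (α - 1)) := by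
  have hα' : 0 < α - 1 := by linarith
  rcases eq_or_ne (ℓ.div (powerFun α)) ⊤ with htop | hfin
  · rw [htop, ENNReal.mul_top (by simpa using hα'), add_top,
      ENNReal.top_rpow_of_pos (one_div_pos.2 hα')]
    exact le_top
  · lift ℓ.div (powerFun α) to ℝ≥0 using hfin with n hn
    have hr : 0 < 1 + (α - 1) * (n : ℝ) := by positivity
    set m := (1 + (α - 1) * n : ℝ) ^ (1 / (α - 1)) with hm
    have hm0 : 0 < m := Real.rpow_pos_of_pos hr _
    have hmr : m ^ (2 - α) * (1 + (α - 1) * n) = m := by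
      have hm_pow : m ^ (α - 1) = 1 + (α - 1) * n := by
        rw [hm, ← Real.rpow_mul hr.le, one_div_mul_cancel hα'.ne', Real.rpow_one]
      rw [← hm_pow, ← Real.rpow_add hm0, show 2 - α + (α - 1) = 1 by ring, Real.rpow_one]
    have hconst : m ^ (2 - α) * n + ((α * m ^ (2 - α) + (α - 2) * m - 2 * (α - 1)) / (α - 1) +
        (1 - m ^ (2 - α))) = m - 1 := by
      field_simp
      linear_combination hmr
    have h := ℓ.div_le_coe isGenerator_chiSqFun (isGenerator_powerFun (by linarith) (by linarith))
      (Real.rpow_nonneg hm0.le _) hn.symm fun t ht => chiSqFun_le_powerFun hα.le hm0 ht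
    rw [one_add_ofReal_mul_coe hα'.le, ENNReal.ofReal_rpow_of_pos hr, ← hm,
      ← EReal.coe_ennreal_le_coe_ennreal_iff, EReal.coe_ennreal_add, EReal.coe_ennreal_one,
      EReal.coe_ennreal_ofReal, max_eq_left hm0.le]
    rw [hconst, EReal.coe_sub] at h
    exact EReal.add_le_of_le_sub h

end Renyi

section TotalVariation

theorem sq_totalVar_le_div_chiSqFun : ((ℓ.totalVar ^ 2 : ℝ) : EReal) ≤ ℓ.div chiSqFun := by
  refine (EReal.coe_le_coe_iff.2 (le_of_eq ?_)).trans (ℓ.coe_le_div isGenerator_totalVarFun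
    isGenerator_chiSqFun (c := 2 * ℓ.totalVar) (by positivity) ℓ.div_totalVarFun
    fun t _ => two_mul_totalVarFun_le_chiSqFun ℓ.totalVar t)
  ring

theorem mul_totalVar_sub_le_div_chiSqFun {c : ℝ} (hc : 2 ≤ c) :
    ((c ^ 2 / 2 * ℓ.totalVar - (c - 1) ^ 2 : ℝ) : EReal) ≤ ℓ.div chiSqFun := by
  refine (EReal.coe_le_coe_iff.2 (le_of_eq ?_)).trans (ℓ.coe_le_div isGenerator_totalVarFun
    isGenerator_chiSqFun (c := c ^ 2 / 2) (by positivity) ℓ.div_totalVarFun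
    fun t ht => totalVarFun_le_chiSqFun hc ht)
  ring

theorem totalVar_div_two_sub_le_div_chiSqFun (h1 : 1 ≤ ℓ.totalVar) (h2 : ℓ.totalVar < 2) :
    ((ℓ.totalVar / (2 - ℓ.totalVar) : ℝ) : EReal) ≤ ℓ.div chiSqFun := by
  have h2' : (0 : ℝ) < 2 - ℓ.totalVar := sub_pos.2 h2
  have hc : 2 ≤ 2 / (2 - ℓ.totalVar : ℝ) := by
    rw [le_div_iff₀ h2']
    linarith [NNReal.coe_le_coe.2 h1, NNReal.coe_one]
  refine (EReal.coe_le_coe_iff.2 (le_of_eq ?_)).trans (ℓ.mul_totalVar_sub_le_div_chiSqFun hc)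
  field_simp
  ring

theorem div_chiSqFun_eq_top (h : ℓ.totalVar = 2) : ℓ.div chiSqFun = ⊤ := by
  rw [← EReal.coe_ennreal_eq_top_iff, EReal.eq_top_iff_forall_lt]
  intro y
  refine (EReal.coe_lt_coe_iff.2 ?_).trans_le
    (ℓ.mul_totalVar_sub_le_div_chiSqFun (le_max_left 2 y))
  rw [h, NNReal.coe_ofNat]
  linarith [le_max_left 2 y, le_max_right 2 y]

theorem mul_totalVar_sub_le_div_klFun_add {k : ℝ} (hk : 1 ≤ k) :
    (((Real.log k + (k ^ 2 - 1) / (2 * k)) * ℓ.totalVar - (k - 1) ^ 2 / k : ℝ) : EReal) ≤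
      (ℓ.div klFun + ℓ.div (starConj klFun) : ℝ≥0∞) := by
  have hk0 : 0 < k := one_pos.trans_le hk
  have hc : 0 ≤ Real.log k + (k ^ 2 - 1) / (2 * k) :=
    add_nonneg (Real.log_nonneg hk) (div_nonneg (sub_nonneg.2 (one_le_pow₀ hk)) (by positivity))
  rw [← ℓ.div_add isGenerator_klFun isGenerator_klFun.starConj]
  refine (EReal.coe_le_coe_iff.2 (le_of_eq ?_)).trans (ℓ.coe_le_div isGenerator_totalVarFun
    (isGenerator_klFun.add isGenerator_klFun.starConj) hc ℓ.div_totalVarFun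
    fun t ht => totalVarFun_le_klFun_add_starConj hk0 ht)
  field_simp
  ring

theorem totalVar_mul_log_le (h : ℓ.totalVar < 2) :
    ((ℓ.totalVar * Real.log ((2 + ℓ.totalVar) / (2 - ℓ.totalVar)) : ℝ) : EReal) ≤
      (ℓ.div klFun + ℓ.div (starConj klFun) : ℝ≥0∞) := by
  have hv2 : (0 : ℝ) < 2 - ℓ.totalVar := sub_pos.2 h
  have hk : 1 ≤ (2 + ℓ.totalVar : ℝ) / (2 - ℓ.totalVar) := by
    rw [le_div_iff₀ hv2]
    linarith [ℓ.totalVar.coe_nonneg]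
  refine (EReal.coe_le_coe_iff.2 (le_of_eq ?_)).trans (ℓ.mul_totalVar_sub_le_div_klFun_add hk)
  have hv2' : (2 + ℓ.totalVar : ℝ) ≠ 0 := by positivity
  field_simp
  ring

theorem div_klFun_add_eq_top (h : ℓ.totalVar = 2) :
    ℓ.div klFun + ℓ.div (starConj klFun) = ⊤ := by
  rw [← EReal.coe_ennreal_eq_top_iff, EReal.eq_top_iff_forall_lt]
  intro y
  have hk : 1 ≤ Real.exp (max y 1) := Real.one_le_exp (by positivity)
  refine (EReal.coe_lt_coe_iff.2 ?_).trans_le (ℓ.mul_totalVar_sub_le_div_klFun_add hk)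
  rw [h, NNReal.coe_ofNat, Real.log_exp]
  have hpos : (Real.exp (max y 1) ^ 2 - 1) / (2 * Real.exp (max y 1)) * 2 -
      (Real.exp (max y 1) - 1) ^ 2 / Real.exp (max y 1) = 2 * (1 - (Real.exp (max y 1))⁻¹) := by
    field_simp
    ring
  linarith [inv_le_one_of_one_le₀ hk, le_max_left y 1, le_max_right y 1]

theorem totalVar_le_div_chiSqFun_add (h : ℓ.totalVar < 2) :
    ((8 * ℓ.totalVar ^ 2 / (4 - ℓ.totalVar ^ 2) : ℝ) : EReal) ≤
      (ℓ.div chiSqFun + ℓ.div (starConj chiSqFun) : ℝ≥0∞) := by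
  have hw : (ℓ.totalVar / 2 : ℝ) ^ 2 < 1 := by
    rw [sq_lt_one_iff₀ (by positivity), div_lt_one two_pos]
    exact h
  have hw' : 4 - (ℓ.totalVar : ℝ) ^ 2 ≠ 0 := by
    linarith
  rw [← ℓ.div_add isGenerator_chiSqFun isGenerator_chiSqFun.starConj]
  refine (EReal.coe_le_coe_iff.2 (le_of_eq ?_)).trans (ℓ.coe_le_div isGenerator_totalVarFun
    (isGenerator_chiSqFun.add isGenerator_chiSqFun.starConj)
    (c := 8 * (ℓ.totalVar / 2 : ℝ) / (1 - (ℓ.totalVar / 2 : ℝ) ^ 2) ^ 2)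
    (by positivity) ℓ.div_totalVarFun fun t ht => totalVarFun_le_chiSqFun_add_starConj hw ht)
  have hden : 1 - (ℓ.totalVar / 2 : ℝ) ^ 2 = (4 - (ℓ.totalVar : ℝ) ^ 2) / 4 := by ring
  rw [hden]
  field_simp
  ring

end TotalVariation

section Symmetrized

variable {f g k : ℝ → ℝ}

theorem mul_div_le_add (hf : IsGenerator f) (hg : IsGenerator g) (hk : IsGenerator k) {a c : ℝ}
    (ha : 0 ≤ a) (hc : 0 ≤ c) (h : ∀ t, 0 < t → a * f t ≤ g t + c * k t) :
    ENNReal.ofReal a * ℓ.div f ≤ ℓ.div g + ENNReal.ofReal c * ℓ.div k := by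
  rw [← ℓ.div_const_mul hf ha, ← ℓ.div_const_mul hk hc, ← ℓ.div_add hg (hk.const_mul hc)]
  exact ℓ.div_mono (hf.const_mul ha) (hg.add (hk.const_mul hc)) h

theorem div_klFun_le_div_chiSqFun : ℓ.div klFun ≤ ℓ.div chiSqFun :=
  ℓ.div_mono isGenerator_klFun isGenerator_chiSqFun fun _ => klFun_le_chiSqFun

theorem div_klFun_le_totalVar_add :
    ℓ.div klFun ≤ ENNReal.ofReal (1 / 2) * (ℓ.totalVar + ℓ.div chiSqFun) := by
  have hsum := isGenerator_totalVarFun.add isGenerator_chiSqFun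
  rw [← ℓ.div_totalVarFun, ← ℓ.div_add isGenerator_totalVarFun isGenerator_chiSqFun,
    ← ℓ.div_const_mul hsum one_half_pos.le]
  exact ℓ.div_mono isGenerator_klFun (hsum.const_mul one_half_pos.le)
    fun _ => klFun_le_totalVarFun_add_chiSqFun

theorem two_mul_div_klFun_le {c : ℝ} (hc : 0 ≤ c) :
    ENNReal.ofReal (2 * c) * ℓ.div klFun ≤ ℓ.div (starConj klFun) +
      ENNReal.ofReal (c ^ 2) * (ENNReal.ofReal (1 / 2) * ℓ.div chiSqFun) := by
  rw [← ℓ.div_const_mul isGenerator_chiSqFun one_half_pos.le]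
  exact ℓ.mul_div_le_add isGenerator_klFun isGenerator_klFun.starConj
    (isGenerator_chiSqFun.const_mul one_half_pos.le) (by positivity) (sq_nonneg c)
    fun _ ht => two_mul_klFun_le c ht

theorem two_mul_hellingerSq_le {c : ℝ} (hc : 0 ≤ c) :
    ENNReal.ofReal (2 * c) * ENNReal.ofReal (4 * ℓ.hellingerSq) ≤
      ℓ.div klFun + ENNReal.ofReal (c ^ 2) * ℓ.div (starConj klFun) := by
  have h4 : (0 : ℝ) ≤ 4 := by norm_num
  rw [ENNReal.ofReal_mul h4, ENNReal.ofReal_coe_nnreal, ← ℓ.div_hellingerFun,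
    ← ℓ.div_const_mul isGenerator_hellingerFun h4]
  exact ℓ.mul_div_le_add (isGenerator_hellingerFun.const_mul h4) isGenerator_klFun
    isGenerator_klFun.starConj (by positivity) (sq_nonneg c)
    fun _ ht => two_mul_hellingerFun_le c ht

theorem hellingerSq_eq_zero_of_div_eq_zero (h : ∀ t, 0 < t → 2 * hellingerFun t ≤ f t)
    (hf : IsGenerator f) (h0 : ℓ.div f = 0) : ℓ.hellingerSq = 0 := by
  have hle := ℓ.div_mono (isGenerator_hellingerFun.const_mul zero_le_two) hf h
  rw [h0, ℓ.div_const_mul isGenerator_hellingerFun zero_le_two, ℓ.div_hellingerFun] at hle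
  simpa using hle

end Symmetrized

end RatioLaw

section ENNRealArithmetic

variable {a b c d : ℝ≥0∞}

theorem sq_le_mul_of_forall (ha : a = 0 → b = 0) (hd : d = 0 → b = 0)
    (h : ∀ x : ℝ, 0 ≤ x → ENNReal.ofReal (2 * x) * b ≤ a + ENNReal.ofReal (x ^ 2) * d) :
    b ^ 2 ≤ a * d := by
  rcases eq_or_ne a 0 with ha0 | ha0
  · simp [ha ha0]
  rcases eq_or_ne d 0 with hd0 | hd0
  · simp [hd hd0]
  rcases eq_or_ne a ⊤ with rfl | ha1
  · simp [ENNReal.top_mul hd0]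
  rcases eq_or_ne d ⊤ with rfl | hd1
  · simp [ENNReal.mul_top ha0]
  have hb1 : b ≠ ⊤ := by
    rintro rfl
    have h1 := h 1 zero_le_one
    rw [ENNReal.mul_top (by simp), top_le_iff] at h1
    exact ENNReal.add_ne_top.2 ⟨ha1, ENNReal.mul_ne_top ENNReal.ofReal_ne_top hd1⟩ h1
  lift a to ℝ≥0 using ha1
  lift b to ℝ≥0 using hb1
  lift d to ℝ≥0 using hd1
  have hd_pos : (0 : ℝ) < d := NNReal.coe_pos.2 (pos_iff_ne_zero.2 (by simpa using hd0))
  have hopt := ENNReal.toReal_mono (by finiteness) (h (b / d) (by positivity))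
  rw [ENNReal.toReal_add (by finiteness) (by finiteness), ENNReal.toReal_mul, ENNReal.toReal_mul,
    ENNReal.toReal_ofReal (by positivity), ENNReal.toReal_ofReal (by positivity)] at hopt
  simp only [ENNReal.coe_toReal] at hopt
  have hreal : (b : ℝ) ^ 2 ≤ a * d := by
    field_simp at hopt
    linarith
  exact_mod_cast hreal

theorem mul_le_mul_of_sq_le_mul (hac : c ≠ ⊤ → a ≠ ⊤) (h1 : a ^ 2 ≤ b * c)
    (h2 : b ^ 2 ≤ a * d) : a * b ≤ c * d := by
  rcases eq_or_ne a 0 with rfl | ha0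
  · simp
  rcases eq_or_ne b 0 with rfl | hb0
  · simp
  have hc0 : c ≠ 0 := by
    rintro rfl
    simp [ha0] at h1
  have hd0 : d ≠ 0 := by
    rintro rfl
    simp [hb0] at h2
  rcases eq_or_ne c ⊤ with rfl | hc1
  · simp [ENNReal.top_mul hd0]
  rcases eq_or_ne d ⊤ with rfl | hd1
  · simp [ENNReal.mul_top hc0]
  have ha1 := hac hc1
  have hb1 : b ≠ ⊤ := by
    rintro rfl
    simp [ENNReal.mul_eq_top, ha1, hd1] at h2
  have hprod : a * b * (a * b) ≤ a * b * (c * d) :=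
    calc a * b * (a * b) = a ^ 2 * b ^ 2 := by ring
      _ ≤ b * c * (a * d) := mul_le_mul' h1 h2
      _ = a * b * (c * d) := by ring
  exact (ENNReal.mul_le_mul_iff_right (mul_ne_zero ha0 hb0) (ENNReal.mul_ne_top ha1 hb1)).1 hprod

theorem add_le_add_of_two_mul_le (hac : a ≤ 2 * c) (hbd : b ≤ 2 * d) (h1 : 2 * a ≤ b + c)
    (h2 : 2 * b ≤ a + d) : a + b ≤ c + d := by
  rcases eq_or_ne (c + d) ⊤ with htop | hfin
  · simp [htop]
  obtain ⟨hc1, hd1⟩ := ENNReal.add_ne_top.1 hfin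
  have ha1 : a ≠ ⊤ := ne_top_of_le_ne_top (by finiteness) hac
  have hb1 : b ≠ ⊤ := ne_top_of_le_ne_top (by finiteness) hbd
  refine (ENNReal.add_le_add_iff_left (ENNReal.add_ne_top.2 ⟨ha1, hb1⟩)).1 ?_
  calc a + b + (a + b) = 2 * a + 2 * b := by ring
    _ ≤ b + c + (a + d) := add_le_add h1 h2
    _ = a + b + (c + d) := by ring

end ENNRealArithmetic

namespace RatioLaw

variable (ℓ : RatioLaw)

theorem div_eq_zero_of_totalVar_eq_zero {f : ℝ → ℝ} (h1 : f 1 = 0) (h : ℓ.totalVar = 0) :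
    ℓ.div f = 0 := by
  have hV := ℓ.div_totalVarFun
  rw [h, div, atZero_totalVarFun, slopeTop_totalVarFun, one_mul, one_mul, ENNReal.coe_zero,
    add_eq_zero, add_eq_zero,
    lintegral_eq_zero_iff' (ℓ.aemeasurable_ofReal isGenerator_totalVarFun)] at hV
  obtain ⟨⟨hint, hz⟩, ht⟩ := hV
  have hone : ∫⁻ t, ENNReal.ofReal (f t) ∂ℓ.measure = 0 := by
    refine (lintegral_congr_ae (hint.mono fun t ht => ?_)).trans lintegral_zero
    have ht1 : |t - 1| ≤ 0 := ENNReal.ofReal_eq_zero.1 ht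
    rw [sub_eq_zero.1 (abs_nonpos_iff.1 ht1), h1, ENNReal.ofReal_zero]
  rw [div, hone, hz, ht, mul_zero, mul_zero, add_zero, add_zero]

theorem div_klFun_eq_zero_of_starConj (h : ℓ.div (starConj klFun) = 0) : ℓ.div klFun = 0 := by
  have hH := ℓ.hellingerSq_eq_zero_of_div_eq_zero
    (fun _ ht => two_mul_hellingerFun_le_starConj_klFun ht) isGenerator_klFun.starConj h
  have hV := ℓ.half_totalVar_le
  rw [hH, NNReal.coe_zero, Real.sqrt_zero, zero_mul] at hV
  exact ℓ.div_eq_zero_of_totalVar_eq_zero klFun_one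
    (NNReal.coe_eq_zero.1 (le_antisymm (by linarith) ℓ.totalVar.coe_nonneg))

theorem sq_div_klFun_le : ℓ.div klFun ^ 2 ≤
    ℓ.div (starConj klFun) * (ENNReal.ofReal (1 / 2) * ℓ.div chiSqFun) := by
  refine sq_le_mul_of_forall ℓ.div_klFun_eq_zero_of_starConj (fun h => ?_)
    fun x hx => ℓ.two_mul_div_klFun_le hx
  have hχ : ℓ.div chiSqFun = 0 := by simpa using h
  exact le_zero_iff.1 (hχ ▸ ℓ.div_klFun_le_div_chiSqFun)

theorem sq_four_mul_hellingerSq_le :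
    ENNReal.ofReal (4 * ℓ.hellingerSq) ^ 2 ≤ ℓ.div klFun * ℓ.div (starConj klFun) := by
  refine sq_le_mul_of_forall (fun h => ?_) (fun h => ?_) fun x hx => ℓ.two_mul_hellingerSq_le hx
  · simp [ℓ.hellingerSq_eq_zero_of_div_eq_zero
      (fun _ ht => two_mul_hellingerFun_le_klFun ht) isGenerator_klFun h]
  · simp [ℓ.hellingerSq_eq_zero_of_div_eq_zero
      (fun _ ht => two_mul_hellingerFun_le_starConj_klFun ht) isGenerator_klFun.starConj h]

end RatioLaw

section Modulus

variable {f : ℝ → ℝ}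

theorem pos_of_strictConvexOn (hf : StrictConvexOn ℝ (Ioi 0) f) (h0 : ∀ t, 0 < t → 0 ≤ f t)
    (h1 : f 1 = 0) {t : ℝ} (ht : 0 < t) (ht1 : t ≠ 1) : 0 < f t := by
  have hmid := hf.2 (mem_Ioi.2 ht) (mem_Ioi.2 one_pos) ht1 (one_half_pos (α := ℝ)) one_half_pos
    (by norm_num)
  have hmid0 := h0 ((1 / 2 : ℝ) • t + (1 / 2 : ℝ) • 1) (by positivity)
  simp only [h1, smul_eq_mul, mul_zero, add_zero] at hmid hmid0
  linarith

theorem exists_mul_totalVarFun_sub_le (hf : StrictConvexOn ℝ (Ioi 0) f)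
    (h0 : ∀ t, 0 < t → 0 ≤ f t) (h1 : f 1 = 0) {ε : ℝ} (hε : 0 < ε) (hε1 : ε < 1) :
    ∃ m : ℝ, 0 < m ∧ ∀ t, 0 < t → m * (totalVarFun t - ε) ≤ f t := by
  have hright : 0 < f (1 + ε) :=
    pos_of_strictConvexOn hf h0 h1 (by linarith) (by linarith)
  have hleft : 0 < f (1 - ε) :=
    pos_of_strictConvexOn hf h0 h1 (by linarith) (by linarith)
  set m := min (f (1 + ε)) (f (1 - ε)) / ε with hm
  have hm0 : 0 < m := div_pos (lt_min hright hleft) hε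
  refine ⟨m, hm0, fun t ht => ?_⟩
  rw [totalVarFun]
  rcases le_or_gt |t - 1| ε with hnear | hfar
  · exact (mul_nonpos_of_nonneg_of_nonpos hm0.le (by linarith)).trans (h0 t ht)
  have hd : 0 < |t - 1| := hε.trans hfar
  have hchord := map_mul_add_le_of_convexOn hf.convexOn h1 (div_nonneg hε.le hd.le)
    ((div_le_one hd).2 hfar.le) ht
  have hshrink : ε / |t - 1| * t + (1 - ε / |t - 1|) = 1 + ε ∨
      ε / |t - 1| * t + (1 - ε / |t - 1|) = 1 - ε := by
    have hsplit : ε / |t - 1| * t + (1 - ε / |t - 1|) = 1 + ε * ((t - 1) / |t - 1|) := by ring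
    rw [hsplit]
    rcases abs_choice (t - 1) with h | h <;> rw [h] at hd ⊢
    · exact .inl (by rw [div_self hd.ne', mul_one])
    · exact .inr (by rw [div_neg, div_self (neg_pos.1 hd).ne, mul_neg_one, sub_eq_add_neg])
  have hmin : min (f (1 + ε)) (f (1 - ε)) ≤ ε / |t - 1| * f t := by
    rcases hshrink with h | h <;> rw [h] at hchord
    · exact (min_le_left _ _).trans hchord
    · exact (min_le_right _ _).trans hchord
  have hlin : m * |t - 1| ≤ f t := by
    rw [hm, div_mul_eq_mul_div, div_le_iff₀ hε]
    rw [div_mul_eq_mul_div, le_div_iff₀ hd] at hmin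
    linarith
  linarith [mul_pos hm0 hε]

theorem RatioLaw.exists_totalVar_le_of_div_le (hf : StrictConvexOn ℝ (Ioi 0) f)
    (h0 : ∀ t, 0 < t → 0 ≤ f t) (h1 : f 1 = 0) {η : ℝ} (hη : 0 < η) :
    ∃ δ : ℝ, 0 < δ ∧ ∀ ℓ : RatioLaw, (ℓ.div f : EReal) ≤ δ → (ℓ.totalVar : ℝ) ≤ η := by
  set ε := min (η / 2) (1 / 2)
  have hε : 0 < ε := lt_min (half_pos hη) one_half_pos
  have hεη : ε ≤ η / 2 := min_le_left _ _
  obtain ⟨m, hm, hle⟩ := exists_mul_totalVarFun_sub_le hf h0 h1 hε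
    ((min_le_right _ _).trans_lt one_half_lt_one)
  refine ⟨m * ε, mul_pos hm hε, fun ℓ hℓ => ?_⟩
  have hv := ℓ.coe_le_div (A := 0) (B := m * ε) isGenerator_totalVarFun
    (isGenerator_of_convexOn hf.convexOn h0 h1) hm.le ℓ.div_totalVarFun
    fun t ht => by linarith [hle t ht]
  have hreal := EReal.coe_le_coe_iff.1 (hv.trans hℓ)
  have hmul : m * ℓ.totalVar ≤ m * (2 * ε) := by linarith
  linarith [le_of_mul_le_mul_left hmul hm]

/-- The largest total variation of a law of ratios whose divergence for `f` is at most `x`. -/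
def totalVarModulus (f : ℝ → ℝ) (x : EReal) : ℝ :=
  sSup {v : ℝ | ∃ ℓ : RatioLaw, ℓ.totalVar = v ∧ (ℓ.div f : EReal) ≤ x}

theorem RatioLaw.totalVar_le_totalVarModulus (ℓ : RatioLaw) (f : ℝ → ℝ) :
    (ℓ.totalVar : ℝ) ≤ totalVarModulus f (ℓ.div f) := by
  refine le_csSup ⟨2, ?_⟩ ⟨ℓ, rfl, le_rfl⟩
  rintro _ ⟨ℓ', rfl, -⟩
  exact ℓ'.totalVar_le_two

theorem tendsto_totalVarModulus (hf : StrictConvexOn ℝ (Ioi 0) f) (h0 : ∀ t, 0 < t → 0 ≤ f t)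
    (h1 : f 1 = 0) : Tendsto (totalVarModulus f) (𝓝 0) (𝓝 0) := by
  refine tendsto_order.2 ⟨fun a ha => .of_forall fun x => ha.trans_le ?_, fun η hη => ?_⟩
  · refine Real.sSup_nonneg ?_
    rintro _ ⟨ℓ, rfl, -⟩
    exact ℓ.totalVar.coe_nonneg
  · obtain ⟨δ, hδ, hle⟩ := RatioLaw.exists_totalVar_le_of_div_le hf h0 h1 (half_pos hη)
    filter_upwards [eventually_le_nhds (EReal.coe_pos.2 hδ)] with x hx
    refine (Real.sSup_le ?_ (half_pos hη).le).trans_lt (half_lt_self hη)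
    rintro _ ⟨ℓ, rfl, hℓ⟩
    exact hle ℓ (hℓ.trans hx)

end Modulus

section StateDivergence

variable {K : Type u} [NormedAddCommGroup K] [InnerProductSpace ℂ K] [CompleteSpace K]
  (ρ σ : State K) {f g : ℝ → ℝ}

theorem div_ratioLaw_swap (hf : IsGenerator f) :
    (σ.ratioLaw ρ).div f = (ρ.ratioLaw σ).div (starConj f) := by
  have hint : ∫⁻ t, ENNReal.ofReal (f t) ∂(σ.ratioLaw ρ).measure =
      ∫⁻ t, ENNReal.ofReal (starConj f t) ∂(ρ.ratioLaw σ).measure :=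
    (lintegral_modularMeasure_swap ρ σ fun t => ENNReal.ofReal (f t)).trans
      (lintegral_congr_ae ((ρ.ratioLaw σ).ae_pos.mono fun t ht => (ENNReal.ofReal_mul ht.le).symm))
  have hzero : atZero (starConj f) = slopeTop f := hf.tendsto_starConj_atZero.limUnder_eq
  have hslope : slopeTop (starConj f) = atZero f := hf.tendsto_starConj_slopeTop.limUnder_eq
  rw [RatioLaw.div, RatioLaw.div, hint, hzero, hslope]
  exact add_right_comm _ _ _

theorem fDiv_eq_div (hg : IsGenerator g) (A : ℝ) (h : ∀ t, 0 < t → f t = g t + A * (t - 1)) :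
    fDiv f ρ σ = (ρ.ratioLaw σ).div g := by
  refine ((ρ.ratioLaw σ).fDiv_eq hg (A := A) (B := -A) fun t ht => ?_).trans ?_
  · rw [h t ht, mul_sub_one, sub_eq_add_neg]
  · rw [add_neg_cancel, EReal.coe_zero, add_zero]

theorem fDiv_eq_div_self (hf : IsGenerator f) : fDiv f ρ σ = (ρ.ratioLaw σ).div f :=
  fDiv_eq_div ρ σ hf 0 fun t _ => by rw [zero_mul, add_zero]

theorem totalVar_eq : totalVar ρ σ = ((ρ.ratioLaw σ).totalVar : ℝ) := by
  rw [← EReal.coe_nnreal_eq_coe_real, ← RatioLaw.div_totalVarFun]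
  exact fDiv_eq_div_self ρ σ isGenerator_totalVarFun

theorem hellingerSq_eq : hellingerSq ρ σ = ((ρ.ratioLaw σ).hellingerSq : ℝ) := by
  rw [← EReal.coe_nnreal_eq_coe_real, ← RatioLaw.div_hellingerFun]
  exact fDiv_eq_div_self ρ σ isGenerator_hellingerFun

theorem chiSq_eq : chiSq ρ σ = (ρ.ratioLaw σ).div chiSqFun :=
  fDiv_eq_div_self ρ σ isGenerator_chiSqFun

theorem umegaki_eq : umegaki ρ σ = (ρ.ratioLaw σ).div klFun :=
  fDiv_eq_div ρ σ isGenerator_klFun 1 fun t _ => by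
    rw [klFun_apply]
    ring

theorem umegaki_add_eq :
    umegaki ρ σ + umegaki σ ρ =
      ((ρ.ratioLaw σ).div klFun + (ρ.ratioLaw σ).div (starConj klFun) : ℝ≥0∞) := by
  rw [umegaki_eq, umegaki_eq, div_ratioLaw_swap ρ σ isGenerator_klFun, EReal.coe_ennreal_add]

theorem chiSq_add_eq :
    chiSq ρ σ + chiSq σ ρ =
      ((ρ.ratioLaw σ).div chiSqFun + (ρ.ratioLaw σ).div (starConj chiSqFun) : ℝ≥0∞) := by
  rw [chiSq_eq, chiSq_eq, div_ratioLaw_swap ρ σ isGenerator_chiSqFun, EReal.coe_ennreal_add]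

theorem umegakiBase_eq {b : ℝ} (hb : 1 < b) :
    umegakiBase b ρ σ = ((Real.log b)⁻¹ : ℝ) * umegaki ρ σ := by
  have hb' : 0 ≤ (Real.log b)⁻¹ := inv_nonneg.2 (Real.log_nonneg hb.le)
  rw [umegaki_eq, ← coe_ennreal_ofReal_mul hb', ← RatioLaw.div_const_mul _ isGenerator_klFun hb']
  refine fDiv_eq_div ρ σ (isGenerator_klFun.const_mul hb') (Real.log b)⁻¹ fun t _ => ?_
  rw [klFun_apply, Real.logb, div_eq_mul_inv]
  ring

theorem umegakiBase_add_eq {b : ℝ} (hb : 1 < b) :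
    umegakiBase b ρ σ + umegakiBase b σ ρ =
      ((Real.log b)⁻¹ : ℝ) * (umegaki ρ σ + umegaki σ ρ) := by
  rw [umegakiBase_eq ρ σ hb, umegakiBase_eq σ ρ hb, EReal.left_distrib_of_nonneg_of_ne_top
    (EReal.coe_nonneg.2 (inv_nonneg.2 (Real.log_nonneg hb.le))) (EReal.coe_ne_top _)]

theorem hellingerAlpha_eq {α : ℝ} (h0 : 0 < α) (h1 : α ≠ 1) :
    hellingerAlpha α ρ σ = (ρ.ratioLaw σ).div (powerFun α) :=
  fDiv_eq_div ρ σ (isGenerator_powerFun h0 h1) (α / (α - 1)) fun t _ => by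
    rw [powerFun]
    ring

theorem petzRenyi_eq_of_lt_one {α : ℝ} (h0 : 0 < α) (h1 : α < 1) :
    petzRenyi α ρ σ = ((α - 1)⁻¹ : ℝ) * ENNReal.log ((ρ.ratioLaw σ).div fun t => t ^ α) := by
  rw [petzRenyi, fDiv_eq_div_self ρ σ (isGenerator_rpow h0 h1), EReal.toENNReal_coe]

theorem petzRenyi_eq_of_one_lt {β : ℝ} (hβ : 1 < β) :
    petzRenyi β ρ σ = ((β - 1)⁻¹ : ℝ) *
      ENNReal.log (1 + ENNReal.ofReal (β - 1) * (ρ.ratioLaw σ).div (powerFun β)) := by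
  have hβ' : 0 ≤ β - 1 := sub_nonneg.2 hβ.le
  have hgen := isGenerator_powerFun (one_pos.trans hβ) hβ.ne'
  have hpow : fDiv (fun t => t ^ β) ρ σ =
      ((ENNReal.ofReal (β - 1) * (ρ.ratioLaw σ).div (powerFun β) : ℝ≥0∞) : EReal) +
        (β + (1 - β) : ℝ) := by
    rw [← RatioLaw.div_const_mul _ hgen hβ']
    refine (ρ.ratioLaw σ).fDiv_eq (hgen.const_mul hβ') fun t _ => ?_
    rw [rpow_eq_powerFun hβ.ne']
    ring
  rw [petzRenyi, hpow, add_sub_cancel, EReal.coe_one, ← EReal.coe_ennreal_one,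
    ← EReal.coe_ennreal_add, EReal.toENNReal_coe, add_comm]

end StateDivergence

section StateInequalities

variable {K : Type u} [NormedAddCommGroup K] [InnerProductSpace ℂ K] [CompleteSpace K]
  (ρ σ : State K)

theorem umegakiBase_le_extLog {b : ℝ} (hb : 1 < b) :
    umegakiBase b ρ σ ≤ extLog b (1 + chiSq ρ σ) := by
  have h : ((ρ.ratioLaw σ).div klFun : EReal) ≤ ENNReal.log (1 + (ρ.ratioLaw σ).div chiSqFun) :=
    ((ρ.ratioLaw σ).div_klFun_le_log one_lt_two).trans_eq (by norm_num [funext powerFun_two])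
  rw [umegakiBase_eq ρ σ hb, umegaki_eq, extLog, chiSq_eq, ← EReal.coe_ennreal_one,
    ← EReal.coe_ennreal_add, EReal.toENNReal_coe]
  exact mul_le_mul_of_nonneg_left h
    (EReal.coe_nonneg.2 (inv_nonneg.2 (Real.log_nonneg hb.le)))

theorem chiSq_le_rpow_sub_one {α : ℝ} (hα : 2 < α) :
    chiSq ρ σ ≤ (((1 + ((α - 1 : ℝ) : EReal) * hellingerAlpha α ρ σ).toENNReal ^
      (1 / (α - 1)) : ℝ≥0∞) : EReal) - 1 := by
  have hα' : 0 ≤ α - 1 := by linarith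
  rw [chiSq_eq, hellingerAlpha_eq ρ σ (by linarith) (by linarith), ← coe_ennreal_ofReal_mul hα',
    ← EReal.coe_ennreal_one, ← EReal.coe_ennreal_add, EReal.toENNReal_coe,
    EReal.le_sub_iff_add_le (.inl (EReal.coe_ennreal_ne_bot 1))
      (.inl (EReal.coe_ennreal_eq_top_iff.not.2 ENNReal.one_ne_top)), ← EReal.coe_ennreal_add]
  exact EReal.coe_ennreal_le_coe_ennreal_iff.2 ((ρ.ratioLaw σ).div_chiSqFun_add_one_le hα)

theorem sq_totalVar_le_chiSq : (((ρ.ratioLaw σ).totalVar ^ 2 : ℝ) : EReal) ≤ chiSq ρ σ :=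
  chiSq_eq ρ σ ▸ (ρ.ratioLaw σ).sq_totalVar_le_div_chiSqFun

theorem totalVar_div_le_chiSq (h1 : 1 ≤ (ρ.ratioLaw σ).totalVar)
    (h2 : (ρ.ratioLaw σ).totalVar < 2) :
    (((ρ.ratioLaw σ).totalVar / (2 - (ρ.ratioLaw σ).totalVar) : ℝ) : EReal) ≤ chiSq ρ σ :=
  chiSq_eq ρ σ ▸ (ρ.ratioLaw σ).totalVar_div_two_sub_le_div_chiSqFun h1 h2

theorem chiSq_eq_top (h : (ρ.ratioLaw σ).totalVar = 2) : chiSq ρ σ = ⊤ := by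
  rw [chiSq_eq, (ρ.ratioLaw σ).div_chiSqFun_eq_top h, EReal.coe_ennreal_top]

theorem umegaki_sq_div_le :
    umegaki ρ σ ^ 2 / umegaki σ ρ ≤ ((1 / 2 : ℝ) : EReal) * chiSq ρ σ := by
  have h := (ρ.ratioLaw σ).sq_div_klFun_le
  rw [← div_ratioLaw_swap ρ σ isGenerator_klFun] at h
  have hnonneg : 0 ≤ ((ENNReal.ofReal (1 / 2) * (ρ.ratioLaw σ).div chiSqFun : ℝ≥0∞) : EReal) :=
    EReal.coe_ennreal_nonneg _
  rw [umegaki_eq, umegaki_eq, chiSq_eq, ← coe_ennreal_ofReal_mul one_half_pos.le]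
  rcases eq_or_ne ((σ.ratioLaw ρ).div klFun) 0 with hzero | hzero
  · rwa [hzero, EReal.coe_ennreal_zero, EReal.div_zero]
  rcases eq_or_ne ((σ.ratioLaw ρ).div klFun) ⊤ with htop | htop
  · rwa [htop, EReal.coe_ennreal_top, EReal.div_top]
  rw [EReal.div_le_iff_le_mul (EReal.coe_ennreal_pos.2 (pos_iff_ne_zero.2 hzero))
    (EReal.coe_ennreal_eq_top_iff.not.2 htop), ← EReal.coe_ennreal_pow, ← EReal.coe_ennreal_mul]
  exact EReal.coe_ennreal_le_coe_ennreal_iff.2 h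

theorem le_umegaki_mul : ((16 * ((ρ.ratioLaw σ).hellingerSq : ℝ) ^ 2 : ℝ) : EReal) ≤
    umegaki ρ σ * umegaki σ ρ := by
  have hsq : 16 * ((ρ.ratioLaw σ).hellingerSq : ℝ) ^ 2 = (4 * (ρ.ratioLaw σ).hellingerSq) ^ 2 := by
    ring
  rw [umegaki_eq, umegaki_eq, div_ratioLaw_swap ρ σ isGenerator_klFun, hsq,
    ← max_eq_left (sq_nonneg (4 * ((ρ.ratioLaw σ).hellingerSq : ℝ))), ← EReal.coe_ennreal_ofReal,
    ENNReal.ofReal_pow (by positivity), ← EReal.coe_ennreal_mul]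
  exact EReal.coe_ennreal_le_coe_ennreal_iff.2 (ρ.ratioLaw σ).sq_four_mul_hellingerSq_le

theorem umegaki_mul_le :
    umegaki ρ σ * umegaki σ ρ ≤ ((1 / 4 : ℝ) : EReal) * (chiSq ρ σ * chiSq σ ρ) := by
  have h1 := (ρ.ratioLaw σ).sq_div_klFun_le
  have h2 := (σ.ratioLaw ρ).sq_div_klFun_le
  rw [← div_ratioLaw_swap ρ σ isGenerator_klFun] at h1
  rw [← div_ratioLaw_swap σ ρ isGenerator_klFun] at h2
  have h := mul_le_mul_of_sq_le_mul (fun hc => ?_) h1 h2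
  · have hfour : ENNReal.ofReal (1 / 4) = ENNReal.ofReal (1 / 2) * ENNReal.ofReal (1 / 2) := by
      rw [← ENNReal.ofReal_mul one_half_pos.le]
      norm_num
    rw [umegaki_eq, umegaki_eq, chiSq_eq, chiSq_eq, ← EReal.coe_ennreal_mul,
      ← EReal.coe_ennreal_mul, ← coe_ennreal_ofReal_mul (by norm_num), hfour,
      EReal.coe_ennreal_le_coe_ennreal_iff, mul_mul_mul_comm]
    exact h
  · refine ne_top_of_le_ne_top (fun htop => hc ?_) (ρ.ratioLaw σ).div_klFun_le_div_chiSqFun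
    rw [htop, ENNReal.mul_top (by norm_num)]

theorem le_umegaki_add : ((8 * (ρ.ratioLaw σ).hellingerSq : ℝ) : EReal) ≤
    umegaki ρ σ + umegaki σ ρ := by
  have h0 : 0 ≤ 8 * ((ρ.ratioLaw σ).hellingerSq : ℝ) := by positivity
  have h := (ρ.ratioLaw σ).two_mul_hellingerSq_le zero_le_one
  rw [mul_one, ← ENNReal.ofReal_mul zero_le_two, ← mul_assoc, one_pow, ENNReal.ofReal_one,
    one_mul] at h
  norm_num1 at h
  rw [umegaki_add_eq, ← max_eq_left h0, ← EReal.coe_ennreal_ofReal]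
  exact EReal.coe_ennreal_le_coe_ennreal_iff.2 h

theorem div_klFun_le_two_mul :
    (ρ.ratioLaw σ).div klFun ≤ 2 * (ENNReal.ofReal (1 / 2) * (ρ.ratioLaw σ).div chiSqFun) := by
  rw [← mul_assoc, ← ENNReal.ofReal_ofNat 2, ← ENNReal.ofReal_mul zero_le_two,
    mul_one_div_cancel two_ne_zero, ENNReal.ofReal_one, one_mul]
  exact (ρ.ratioLaw σ).div_klFun_le_div_chiSqFun

theorem two_mul_div_klFun_le_add : 2 * (ρ.ratioLaw σ).div klFun ≤
    (σ.ratioLaw ρ).div klFun + ENNReal.ofReal (1 / 2) * (ρ.ratioLaw σ).div chiSqFun := by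
  have h := (ρ.ratioLaw σ).two_mul_div_klFun_le zero_le_one
  rwa [← div_ratioLaw_swap ρ σ isGenerator_klFun, mul_one, one_pow, ENNReal.ofReal_one, one_mul,
    ENNReal.ofReal_ofNat] at h

theorem umegaki_add_le :
    umegaki ρ σ + umegaki σ ρ ≤ ((1 / 2 : ℝ) : EReal) * (chiSq ρ σ + chiSq σ ρ) := by
  rw [umegaki_eq, umegaki_eq, chiSq_eq, chiSq_eq, ← EReal.coe_ennreal_add, ← EReal.coe_ennreal_add,
    ← coe_ennreal_ofReal_mul one_half_pos.le, mul_add, EReal.coe_ennreal_le_coe_ennreal_iff]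
  exact add_le_add_of_two_mul_le (div_klFun_le_two_mul ρ σ) (div_klFun_le_two_mul σ ρ)
    (two_mul_div_klFun_le_add ρ σ) (two_mul_div_klFun_le_add σ ρ)

theorem umegaki_le_totalVar_add_chiSq :
    umegaki ρ σ ≤ ((1 / 2 : ℝ) : EReal) * (totalVar ρ σ + chiSq ρ σ) := by
  rw [umegaki_eq, totalVar_eq, chiSq_eq, ← EReal.coe_nnreal_eq_coe_real, ← EReal.coe_ennreal_add,
    ← coe_ennreal_ofReal_mul one_half_pos.le]
  exact EReal.coe_ennreal_le_coe_ennreal_iff.2 (ρ.ratioLaw σ).div_klFun_le_totalVar_add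

theorem totalVar_mul_logb_le {b : ℝ} (hb : 1 < b) (h : (ρ.ratioLaw σ).totalVar < 2) :
    (((ρ.ratioLaw σ).totalVar * Real.logb b ((2 + (ρ.ratioLaw σ).totalVar) /
      (2 - (ρ.ratioLaw σ).totalVar)) : ℝ) : EReal) ≤ umegakiBase b ρ σ + umegakiBase b σ ρ := by
  rw [umegakiBase_add_eq ρ σ hb, umegaki_add_eq, Real.logb, div_eq_inv_mul, mul_left_comm,
    EReal.coe_mul]
  exact mul_le_mul_of_nonneg_left ((ρ.ratioLaw σ).totalVar_mul_log_le h)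
    (EReal.coe_nonneg.2 (inv_nonneg.2 (Real.log_nonneg hb.le)))

theorem umegakiBase_add_eq_top {b : ℝ} (hb : 1 < b) (h : (ρ.ratioLaw σ).totalVar = 2) :
    umegakiBase b ρ σ + umegakiBase b σ ρ = ⊤ := by
  rw [umegakiBase_add_eq ρ σ hb, umegaki_add_eq, (ρ.ratioLaw σ).div_klFun_add_eq_top h,
    EReal.coe_ennreal_top, EReal.coe_mul_top_of_pos (inv_pos.2 (Real.log_pos hb))]

theorem totalVar_le_chiSq_add (h : (ρ.ratioLaw σ).totalVar < 2) :
    ((8 * (ρ.ratioLaw σ).totalVar ^ 2 / (4 - (ρ.ratioLaw σ).totalVar ^ 2) : ℝ) : EReal) ≤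
      chiSq ρ σ + chiSq σ ρ :=
  chiSq_add_eq ρ σ ▸ (ρ.ratioLaw σ).totalVar_le_div_chiSqFun_add h

theorem chiSq_add_eq_top (h : (ρ.ratioLaw σ).totalVar = 2) : chiSq ρ σ + chiSq σ ρ = ⊤ := by
  rw [chiSq_add_eq, (ρ.ratioLaw σ).div_chiSqFun_eq_top h, top_add, EReal.coe_ennreal_top]

theorem hellingerAlpha_le_petzRenyi {α : ℝ} (h0 : 0 < α) (h1 : α < 1) :
    hellingerAlpha α ρ σ ≤ petzRenyi α ρ σ := by
  rw [hellingerAlpha_eq ρ σ h0 h1.ne, petzRenyi_eq_of_lt_one ρ σ h0 h1]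
  exact (ρ.ratioLaw σ).div_powerFun_le_log h0 h1

theorem petzRenyi_le_umegaki {α : ℝ} (h0 : 0 < α) (h1 : α < 1) :
    petzRenyi α ρ σ ≤ umegaki ρ σ := by
  rw [umegaki_eq, petzRenyi_eq_of_lt_one ρ σ h0 h1]
  exact (ρ.ratioLaw σ).log_le_div_klFun h0 h1

theorem umegaki_le_petzRenyi {β : ℝ} (hβ : 1 < β) : umegaki ρ σ ≤ petzRenyi β ρ σ := by
  rw [umegaki_eq, petzRenyi_eq_of_one_lt ρ σ hβ]
  exact (ρ.ratioLaw σ).div_klFun_le_log hβ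

theorem petzRenyi_le_hellingerAlpha {β : ℝ} (hβ : 1 < β) :
    petzRenyi β ρ σ ≤ hellingerAlpha β ρ σ := by
  rw [hellingerAlpha_eq ρ σ (one_pos.trans hβ) hβ.ne', petzRenyi_eq_of_one_lt ρ σ hβ]
  exact (ρ.ratioLaw σ).log_le_div_powerFun hβ

theorem totalVar_le_totalVarModulus {f : ℝ → ℝ} (hf : IsGenerator f) :
    totalVar ρ σ ≤ totalVarModulus f (fDiv f ρ σ) := by
  rw [totalVar_eq, fDiv_eq_div_self ρ σ hf]
  exact EReal.coe_le_coe_iff.2 ((ρ.ratioLaw σ).totalVar_le_totalVarModulus f)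

theorem tendsto_totalVar {f : ℝ → ℝ} (hf : StrictConvexOn ℝ (Ioi 0) f)
    (h0 : ∀ t, 0 < t → 0 ≤ f t) (h1 : f 1 = 0) {ι : Type*} {l : Filter ι} {ρ σ : ι → State K}
    (h : Tendsto (fun n => fDiv f (ρ n) (σ n)) l (𝓝 0)) :
    Tendsto (fun n => totalVar (ρ n) (σ n)) l (𝓝 0) := by
  have hgen := isGenerator_of_convexOn hf.convexOn h0 h1
  refine tendsto_of_tendsto_of_tendsto_of_le_of_le tendsto_const_nhds
    ((continuous_coe_real_ereal.tendsto 0).comp ((tendsto_totalVarModulus hf h0 h1).comp h))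
    (fun n => ?_) fun n => totalVar_le_totalVarModulus (ρ n) (σ n) hgen
  rw [totalVar_eq]
  exact EReal.coe_nonneg.2 (NNReal.coe_nonneg _)

end StateInequalities

end QuantumDiv

end

theorem mainTheorem5 :
    (∀ (K : Type u) [NormedAddCommGroup K] [InnerProductSpace ℂ K] [CompleteSpace K]
      (ρ σ : State K),
      -- finiteness and range of `V` and `H²`; `v` and `h` name their real values below
      ∃ v h : ℝ, (totalVar ρ σ = (v : EReal) ∧ 0 ≤ v ∧ v ≤ 2) ∧
        (hellingerSq ρ σ = (h : EReal) ∧ 0 ≤ h ∧ h ≤ 1) ∧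
      -- `H² ≤ V / 2 ≤ H √(2 - H²)`
      (h ≤ v / 2 ∧ v / 2 ≤ √h * √(2 - h)) ∧
      -- `D ≤ log (1 + χ²)`, to any base
      (∀ b : ℝ, 1 < b → umegakiBase b ρ σ ≤ extLog b (1 + chiSq ρ σ)) ∧
      -- `χ² ≤ (1 + (α - 1) H_α)^(1 / (α - 1)) - 1`
      (∀ α : ℝ, 2 < α → chiSq ρ σ ≤
        ((((1 + ((α - 1 : ℝ) : EReal) * hellingerAlpha α ρ σ).toENNReal ^ (1 / (α - 1)) : ENNReal)
          : EReal) - 1)) ∧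
      -- `χ²` against `V`
      (v ≤ 1 → ((v ^ 2 : ℝ) : EReal) ≤ chiSq ρ σ) ∧
      (1 < v → v < 2 → ((v / (2 - v) : ℝ) : EReal) ≤ chiSq ρ σ) ∧
      (v = 2 → chiSq ρ σ = ⊤) ∧
      -- `D`, `χ²` and `H²`
      (umegaki ρ σ ^ 2 / umegaki σ ρ ≤ ((1 / 2 : ℝ) : EReal) * chiSq ρ σ) ∧
      (((16 * h ^ 2 : ℝ) : EReal) ≤ umegaki ρ σ * umegaki σ ρ ∧
        umegaki ρ σ * umegaki σ ρ ≤ ((1 / 4 : ℝ) : EReal) * (chiSq ρ σ * chiSq σ ρ)) ∧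
      (((8 * h : ℝ) : EReal) ≤ umegaki ρ σ + umegaki σ ρ ∧
        umegaki ρ σ + umegaki σ ρ ≤ ((1 / 2 : ℝ) : EReal) * (chiSq ρ σ + chiSq σ ρ)) ∧
      -- `D ≤ (V + χ²) / 2`
      (umegaki ρ σ ≤ ((1 / 2 : ℝ) : EReal) * (totalVar ρ σ + chiSq ρ σ)) ∧
      -- symmetrized `D` and `χ²` against `V`
      (∀ b : ℝ, 1 < b →
        (v < 2 → ((v * Real.logb b ((2 + v) / (2 - v)) : ℝ) : EReal)
          ≤ umegakiBase b ρ σ + umegakiBase b σ ρ) ∧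
        (v = 2 → umegakiBase b ρ σ + umegakiBase b σ ρ = ⊤)) ∧
      (v < 2 → ((8 * v ^ 2 / (4 - v ^ 2) : ℝ) : EReal) ≤ chiSq ρ σ + chiSq σ ρ) ∧
      (v = 2 → chiSq ρ σ + chiSq σ ρ = ⊤) ∧
      -- Hellinger, Petz-Rényi and Umegaki
      (∀ α β : ℝ, 0 < α → α < 1 → 1 < β →
        hellingerAlpha α ρ σ ≤ petzRenyi α ρ σ ∧ petzRenyi α ρ σ ≤ umegaki ρ σ ∧
        umegaki ρ σ ≤ petzRenyi β ρ σ ∧ petzRenyi β ρ σ ≤ hellingerAlpha β ρ σ)) ∧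
    (∀ f : ℝ → ℝ, StrictConvexOn ℝ (Ioi 0) f → (∀ t, 0 < t → 0 ≤ f t) → f 1 = 0 →
      (∃ ψ : EReal → ℝ, Tendsto ψ (𝓝[>] 0) (𝓝 0) ∧
        ∀ (K : Type u) [NormedAddCommGroup K] [InnerProductSpace ℂ K] [CompleteSpace K]
          (ρ σ : State K), totalVar ρ σ ≤ (ψ (fDiv f ρ σ) : EReal)) ∧
      (∀ (K : Type u) [NormedAddCommGroup K] [InnerProductSpace ℂ K] [CompleteSpace K]
        (ρ σ : ℕ → State K), Tendsto (fun n => fDiv f (ρ n) (σ n)) atTop (𝓝 0) →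
          Tendsto (fun n => totalVar (ρ n) (σ n)) atTop (𝓝 0))) := by
  refine ⟨fun K _ _ _ ρ σ => ?_, fun f hf h0 h1 => ?_⟩
  · let ℓ := ρ.ratioLaw σ
    have htwo : (ℓ.totalVar : ℝ) = 2 → ℓ.totalVar = 2 := fun h => NNReal.coe_injective h
    exact ⟨ℓ.totalVar, ℓ.hellingerSq,
      ⟨totalVar_eq ρ σ, ℓ.totalVar.coe_nonneg, ℓ.totalVar_le_two⟩,
      ⟨hellingerSq_eq ρ σ, ℓ.hellingerSq.coe_nonneg, ℓ.hellingerSq_le_one⟩,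
      ⟨ℓ.hellingerSq_le_half_totalVar, ℓ.half_totalVar_le⟩,
      fun b hb => umegakiBase_le_extLog ρ σ hb, fun α hα => chiSq_le_rpow_sub_one ρ σ hα,
      fun _ => sq_totalVar_le_chiSq ρ σ, fun h1 h2 => totalVar_div_le_chiSq ρ σ h1.le h2,
      fun h => chiSq_eq_top ρ σ (htwo h), umegaki_sq_div_le ρ σ,
      ⟨le_umegaki_mul ρ σ, umegaki_mul_le ρ σ⟩, ⟨le_umegaki_add ρ σ, umegaki_add_le ρ σ⟩,
      umegaki_le_totalVar_add_chiSq ρ σ,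
      fun b hb => ⟨totalVar_mul_logb_le ρ σ hb, fun h => umegakiBase_add_eq_top ρ σ hb (htwo h)⟩,
      totalVar_le_chiSq_add ρ σ, fun h => chiSq_add_eq_top ρ σ (htwo h),
      fun α β h0 h1 hβ => ⟨hellingerAlpha_le_petzRenyi ρ σ h0 h1, petzRenyi_le_umegaki ρ σ h0 h1,
        umegaki_le_petzRenyi ρ σ hβ, petzRenyi_le_hellingerAlpha ρ σ hβ⟩⟩
  · have hgen : IsGenerator f := isGenerator_of_convexOn hf.convexOn h0 h1
    exact ⟨⟨totalVarModulus f, (tendsto_totalVarModulus hf h0 h1).mono_left nhdsWithin_le_nhds,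
        fun K _ _ _ ρ σ => totalVar_le_totalVarModulus ρ σ hgen⟩,
      fun K _ _ _ ρ σ => tendsto_totalVar hf h0 h1⟩
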